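/- Let $R$ be a reduced crystallographic root system spanning the dual of a finite-dimensional real vector space $\mathfrak h_{\mathbb R}$ that carries an inner product invariant under the Weyl group $W$; let $|\alpha|$ be the length of a root $\alpha$ in the dual norm, $R_+$ a system of positive roots, $Q^\vee$ the coroot lattice, and $P$ the weight lattice. Put $T=\mathfrak h_{\mathbb R}/2\pi Q^\vee$ with normalized Haar measure $\mu$, and let $L^2(T,d\mu)^W$ be the Hilbert space of $W$-invariant square-integrable functions. Let $k_\alpha\ge 0$ ($\alpha\in R$) be real with $k_{w\alpha}=k_\alpha$ for all $w\in W$, and let $-1<p<1$. For $p\neq 0$ write $p=e^{2\pi i\tau}$ with $\operatorname{Im}\tau>0$ and let $\wp$ be the Weierstrass function with periods $2\pi$ and $2\pi\tau$; for $p=0$ let $\wp(x)=\frac{1}{4\sin^2(x/2)}-\frac1{12}$. Let $$\mathcal H_E(p)=-\Delta+V,\qquad V(h)=\sum_{\alpha\in R_+}k_\alpha(k_\alpha-1)|\alpha|^2\,\wp(\langle\alpha,h\rangle),$$ where $\Delta$ is the Laplacian of $T$. Put $\Phi(h)=\prod_{\alpha\in R_+}|\sin(\langle\alpha,h\rangle/2)|^{k_\alpha}$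 and $\mathcal P=\mathbb C[P]^W\,\Phi\subset L^2(T,d\mu)^W$, where $\mathbb C[P]^W$ is the space of $W$-invariant finite linear combinations of the functions $h\mapsto e^{i\langle\lambda,h\rangle}$, $\lambda\in P$. **Theorem.** (1) Let $\mathcal H_E(p)$ have as its domain the set of all $f\in C^2(T)^W$ which lie in the domains of all the multiplication operators by $\wp(\langle\alpha,h\rangle)$, $\alpha\in R$, i.e. $\wp(\langle\alpha,h\rangle)f\in L^2(T,d\mu)$ for every $\alpha\in R$. This domain is dense in $L^2(T,d\mu)^W$, the space $\mathcal P$ is contained in the domain of the adjoint $\mathcal H_E(p)^*$, and the restriction $\mathcal H_E(p)^*|_{\mathcal P}$ is essentially self-adjoint (densely defined and closable, with self-adjoint closure). (2) If moreover $k_\alpha\ne 1$ for all $\alpha\in R$, then the same three assertions hold when $\mathcal H_E(p)$ has as its domain the set of all $f\in C^2(T)^W$ with $Vf\in L^2(T,d\mu)$. -/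

import Mathlib

set_option linter.unusedSectionVars false

noncomputable section

namespace CalogeroMoser

open MeasureTheory

section Torus
variable {ι M V : Type*} [AddCommGroup M] [Module ℝ M]
  [NormedAddCommGroup V] [InnerProductSpace ℝ V]

/-- The inner product of `V` is invariant under the Weyl group (equivalently, under the
reflections, which generate it). -/
class IsWeylInvariantInner (R : RootPairing ι ℝ M V) : Prop where
  inner_coreflection : ∀ (i : ι) (x y : V),
    inner ℝ (R.coreflection i x) (R.coreflection i y) = inner ℝ x y

/-- The lattice `2πQ^∨`, where `Q^∨` is the coroot lattice. -/
def periodLattice (R : RootPairing ι ℝ M V) : AddSubgroup V :=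
  AddSubgroup.closure (Set.range fun i => (2 * Real.pi) • R.coroot i)

/-- The torus `T = V / 2πQ^∨`. -/
def Torus (R : RootPairing ι ℝ M V) : Type _ := V ⧸ periodLattice R

variable (R : RootPairing ι ℝ M V)

instance : AddCommGroup (Torus R) := inferInstanceAs (AddCommGroup (V ⧸ periodLattice R))
instance : TopologicalSpace (Torus R) := inferInstanceAs (TopologicalSpace (V ⧸ periodLattice R))
instance : IsTopologicalAddGroup (Torus R) :=
  inferInstanceAs (IsTopologicalAddGroup (V ⧸ periodLattice R))
instance : MeasurableSpace (Torus R) := borel _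
instance : BorelSpace (Torus R) := ⟨rfl⟩

/-- The projection `V → T`. -/
def Torus.mk : V →+ Torus R := QuotientAddGroup.mk' (periodLattice R)

/-- Some representative in `V` of a point of `T`. -/
def Torus.rep (t : Torus R) : V := Quotient.out (s := QuotientAddGroup.leftRel (periodLattice R)) t

theorem Torus.mk_rep (t : Torus R) : Torus.mk R (Torus.rep R t) = t :=
  Quotient.out_eq (s := QuotientAddGroup.leftRel (periodLattice R)) t

theorem Torus.isQuotientMap_mk : Topology.IsQuotientMap (Torus.mk R) :=
  QuotientAddGroup.isQuotientMap_mk (periodLattice R)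

theorem Torus.mk_eq_iff {x y : V} : Torus.mk R x = Torus.mk R y ↔ -x + y ∈ periodLattice R :=
  QuotientAddGroup.eq

instance [Finite ι] [R.IsRootSystem] : CompactSpace (Torus R) := by
  have := Fintype.ofFinite ι
  let f : (ι → ℝ) → Torus R := fun c => Torus.mk R (∑ i, c i • ((2 * Real.pi) • R.coroot i))
  have hf : Continuous f := by
    refine (Torus.isQuotientMap_mk R).continuous.comp ?_
    fun_prop
  have hK : IsCompact (f '' Set.univ.pi fun _ => Set.Icc (0 : ℝ) 1) :=
    (isCompact_univ_pi fun _ => isCompact_Icc).image hf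
  refine ⟨?_⟩
  convert hK
  symm
  rw [Set.eq_univ_iff_forall]
  intro t
  have hx : Torus.rep R t ∈ Submodule.span ℝ (Set.range R.coroot) := by
    rw [RootPairing.IsRootSystem.span_coroot_eq_top]; trivial
  obtain ⟨c, hc⟩ := (Submodule.mem_span_range_iff_exists_fun ℝ).1 hx
  have hpi : (2 * Real.pi) ≠ 0 := by positivity
  have hmem : (fun i => Int.fract (c i / (2 * Real.pi))) ∈ Set.univ.pi fun _ => Set.Icc (0 : ℝ) 1 :=
    Set.mem_univ_pi.2 fun i => Set.mem_Icc.2 ⟨Int.fract_nonneg _, (Int.fract_lt_one _).le⟩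
  refine ⟨_, hmem, ?_⟩
  rw [← Torus.mk_rep R t, Torus.mk_eq_iff, ← hc, neg_add_eq_sub, ← Finset.sum_sub_distrib]
  refine sum_mem fun i _ => ?_
  have : c i • R.coroot i - Int.fract (c i / (2 * Real.pi)) • ((2 * Real.pi) • R.coroot i)
      = ⌊c i / (2 * Real.pi)⌋ • ((2 * Real.pi) • R.coroot i) := by
    rw [Int.fract, ← Int.cast_smul_eq_zsmul ℝ]
    simp only [smul_smul, ← sub_smul]
    congr 1
    field_simp
    ring
  rw [this]
  exact zsmul_mem (AddSubgroup.subset_closure (Set.mem_range_self i)) _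

theorem coreflection_mem_periodLattice (i : ι) :
    periodLattice R ≤ (periodLattice R).comap (R.coreflection i : V →+ V) := by
  rw [periodLattice, AddSubgroup.closure_le]
  rintro _ ⟨j, rfl⟩
  refine AddSubgroup.subset_closure ⟨R.reflectionPerm i j, ?_⟩
  simp

/-- The action on `T` of the reflection in the root with index `i`. -/
def reflT (i : ι) : Torus R →+ Torus R :=
  QuotientAddGroup.map (periodLattice R) (periodLattice R) (R.coreflection i : V →+ V)
    (coreflection_mem_periodLattice R i)

theorem reflT_mk (i : ι) (h : V) :
    reflT R i (Torus.mk R h) = Torus.mk R (R.coreflection i h) := rfl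

theorem reflT_reflT (i : ι) (t : Torus R) : reflT R i (reflT R i t) = t := by
  rw [← Torus.mk_rep R t, reflT_mk, reflT_mk, R.coreflection_same]

variable [FiniteDimensional ℝ V]
theorem continuous_reflT (i : ι) : Continuous (reflT R i) := by
  rw [(Torus.isQuotientMap_mk R).continuous_iff]
  exact (Torus.isQuotientMap_mk R).continuous.comp
    (R.coreflection i : V →ₗ[ℝ] V).continuous_of_finiteDimensional

variable [Finite ι] [R.IsRootSystem]
/-- The normalized Haar measure `μ` of `T`. -/
def haar : Measure (Torus R) := Measure.addHaarMeasure ⊤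
instance : (haar R).IsAddHaarMeasure := inferInstanceAs (Measure.addHaarMeasure ⊤).IsAddHaarMeasure
instance : IsProbabilityMeasure (haar R) := ⟨Measure.addHaarMeasure_self⟩
instance : (haar R).Regular := inferInstanceAs (Measure.addHaarMeasure ⊤).Regular

theorem measurePreserving_reflT (i : ι) : MeasurePreserving (reflT R i) (haar R) (haar R) :=
  (reflT R i).measurePreserving (continuous_reflT R i)
    (fun t => ⟨_, reflT_reflT R i t⟩) rfl

/-- `L²(T, dμ)^W` as a subspace of `L²(T, dμ)`: the classes invariant under the reflections,
which generate `W`. -/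
def invariantSubmodule : Submodule ℂ (Lp ℂ 2 (haar R)) :=
  ⨅ i, LinearMap.eqLocus
    (Lp.compMeasurePreservingₗ ℂ (reflT R i) (measurePreserving_reflT R i)) LinearMap.id

/-- The Hilbert space `L²(T, dμ)^W`. -/
abbrev L2W : Type _ := invariantSubmodule R

theorem isClosed_invariantSubmodule :
    IsClosed (invariantSubmodule R : Set (Lp ℂ 2 (haar R))) := by
  rw [invariantSubmodule, Submodule.coe_iInf]
  refine isClosed_iInter fun i => ?_
  exact isClosed_eq (Lp.isometry_compMeasurePreserving (measurePreserving_reflT R i)).continuous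
    continuous_id

instance : CompleteSpace (L2W R) := (isClosed_invariantSubmodule R).completeSpace_coe
theorem mem_invariantSubmodule_iff {u : Lp ℂ 2 (haar R)} :
    u ∈ invariantSubmodule R ↔ ∀ i, (fun t => u (reflT R i t)) =ᵐ[haar R] u := by
  simp only [invariantSubmodule, Submodule.mem_iInf, LinearMap.mem_eqLocus, LinearMap.id_apply]
  refine forall_congr' fun i => ?_
  have h := Lp.coeFn_compMeasurePreserving u (measurePreserving_reflT R i)
  constructor
  · intro e
    have e' : Lp.compMeasurePreserving (reflT R i) (measurePreserving_reflT R i) u = u := e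
    rw [e'] at h
    exact h.symm
  · intro e
    exact Lp.ext (h.trans e)

/-- The function on `T` induced by a function `f` on `V`, given by evaluating `f` at representatives;
it is only used for `2πQ^∨`-periodic `f`, where the choice of representatives is irrelevant. -/
def onTorus (f : V → ℂ) (t : Torus R) : ℂ := f (Torus.rep R t)

theorem onTorus_mk {f : V → ℂ} (hf : ∀ x, ∀ l ∈ periodLattice R, f (x + l) = f x) (h : V) :
    onTorus R f (Torus.mk R h) = f h := by
  have : -h + Torus.rep R (Torus.mk R h) ∈ periodLattice R := by
    rw [← Torus.mk_eq_iff, Torus.mk_rep]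
  rw [onTorus, ← hf h _ this]
  congr 1
  abel

/-- `g ∈ C²(T)`. -/
def IsC2 (g : Torus R → ℂ) : Prop := ContDiff ℝ 2 fun h => g (Torus.mk R h)

/-- The Laplacian of a function on `T`. -/
def torusLaplacian (g : Torus R → ℂ) : Torus R → ℂ :=
  onTorus R (Laplacian.laplacian fun h => g (Torus.mk R h))

section Laplace
open Laplacian

theorem laplacian_comp_isometry (e : V ≃ₗᵢ[ℝ] V) {f : V → ℂ} (hf : ContDiff ℝ 2 f) (x : V) :
    laplacian (fun y => f (e y)) x = laplacian f (e x) := by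
  let v := stdOrthonormalBasis ℝ V
  rw [InnerProductSpace.laplacian_eq_iteratedFDeriv_orthonormalBasis _ v,
    InnerProductSpace.laplacian_eq_iteratedFDeriv_orthonormalBasis _ (v.map e)]
  refine Finset.sum_congr rfl fun i _ => ?_
  have h := (e : V →L[ℝ] V).iteratedFDeriv_comp_right hf x (i := 2) le_rfl
  have h' : (f ∘ (e : V →L[ℝ] V)) = fun y => f (e y) := rfl
  rw [h'] at h
  rw [h, ContinuousMultilinearMap.compContinuousLinearMap_apply]
  congr 1
  ext j
  fin_cases j <;> simp

theorem laplacian_add_right (f : V → ℂ) (l x : V) :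
    laplacian (fun y => f (y + l)) x = laplacian f (x + l) := by
  let v := stdOrthonormalBasis ℝ V
  rw [InnerProductSpace.laplacian_eq_iteratedFDeriv_orthonormalBasis _ v,
    InnerProductSpace.laplacian_eq_iteratedFDeriv_orthonormalBasis _ v]
  simp only [iteratedFDeriv_comp_add_right]

theorem continuous_laplacian {f : V → ℂ} (hf : ContDiff ℝ 2 f) : Continuous (laplacian f) := by
  let v := stdOrthonormalBasis ℝ V
  rw [InnerProductSpace.laplacian_eq_iteratedFDeriv_orthonormalBasis _ v]
  refine continuous_finsetSum _ fun i _ => ?_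
  have := hf.continuous_iteratedFDeriv (m := 2) le_rfl
  fun_prop

end Laplace

variable {R}

theorem IsC2.continuous {g : Torus R → ℂ} (hg : IsC2 R g) : Continuous g :=
  (Torus.isQuotientMap_mk R).continuous_iff.2 (ContDiff.continuous hg)

theorem torusLaplacian_mk (g : Torus R → ℂ) (h : V) :
    torusLaplacian R g (Torus.mk R h) = Laplacian.laplacian (fun h => g (Torus.mk R h)) h := by
  refine onTorus_mk R (fun x l hl => ?_) h
  rw [← laplacian_add_right]
  refine congr_fun (congr_arg _ (funext fun y => congr_arg g ?_)) x
  rw [Torus.mk_eq_iff]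
  simpa using hl

theorem IsC2.continuous_laplacian {g : Torus R → ℂ} (hg : IsC2 R g) :
    Continuous (torusLaplacian R g) := by
  rw [(Torus.isQuotientMap_mk R).continuous_iff]
  have : torusLaplacian R g ∘ Torus.mk R = Laplacian.laplacian (fun h => g (Torus.mk R h)) :=
    funext fun h => torusLaplacian_mk g h
  rw [this]
  exact CalogeroMoser.continuous_laplacian hg

theorem memLp_of_continuous {g : Torus R → ℂ} (hg : Continuous g) : MemLp g 2 (haar R) := by
  obtain ⟨C, hC⟩ := (isCompact_range hg).isBounded.exists_norm_le
  exact MemLp.of_bound hg.aestronglyMeasurable C (ae_of_all _ fun t => hC _ ⟨t, rfl⟩)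

variable (R) in
/-- The classes in `L²(T, dμ)^W` of the functions in `C²(T)^W`. -/
def c2Submodule : Submodule ℂ (L2W R) where
  carrier := {u | ∃ g, IsC2 R g ∧ (u : Lp ℂ 2 (haar R)) =ᵐ[haar R] g}
  zero_mem' := ⟨fun _ => 0, contDiff_const, Lp.coeFn_zero _ _ _⟩
  add_mem' := by
    rintro u v ⟨g, hg, hu⟩ ⟨g', hg', hv⟩
    exact ⟨g + g', ContDiff.add hg hg', (Lp.coeFn_add _ _).trans (hu.add hv)⟩
  smul_mem' := by
    rintro c u ⟨g, hg, hu⟩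
    exact ⟨c • g, ContDiff.const_smul c hg, (Lp.coeFn_smul _ _).trans (hu.const_smul c)⟩

variable (R) in
/-- The domain in `L²(T, dμ)^W` of the operator of multiplication by the `2πQ^∨`-periodic
function `v`. -/
def mulDomain (v : V → ℂ) : Submodule ℂ (L2W R) where
  carrier := {u | MemLp (fun t => onTorus R v t * (u : Lp ℂ 2 (haar R)) t) 2 (haar R)}
  zero_mem' := by
    refine (MemLp.zero (ε := ℂ)).ae_eq ?_
    filter_upwards [Lp.coeFn_zero ℂ 2 (haar R)] with t ht
    change 0 = onTorus R v t * (0 : Lp ℂ 2 (haar R)) t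
    rw [ht, Pi.zero_apply, mul_zero]
  add_mem' := by
    intro u u' hu hu'
    refine (MemLp.add hu hu').ae_eq ?_
    filter_upwards [Lp.coeFn_add (u : Lp ℂ 2 (haar R)) u'] with t ht
    change onTorus R v t * (u : Lp ℂ 2 (haar R)) t + onTorus R v t * (u' : Lp ℂ 2 (haar R)) t =
      onTorus R v t * ((u : Lp ℂ 2 (haar R)) + (u' : Lp ℂ 2 (haar R)) : Lp ℂ 2 (haar R)) t
    rw [ht, Pi.add_apply, mul_add]
  smul_mem' := by
    intro c u hu
    refine (MemLp.const_smul hu c).ae_eq ?_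
    filter_upwards [Lp.coeFn_smul c (u : Lp ℂ 2 (haar R))] with t ht
    change c • (onTorus R v t * (u : Lp ℂ 2 (haar R)) t) =
      onTorus R v t * (c • (u : Lp ℂ 2 (haar R)) : Lp ℂ 2 (haar R)) t
    rw [ht, Pi.smul_apply, smul_eq_mul, smul_eq_mul]
    ring

/-- The representative in `C²(T)` of an element of `c2Submodule`. -/
def c2Rep (u : L2W R) (hu : u ∈ c2Submodule R) : Torus R → ℂ := hu.choose

theorem isC2_c2Rep {u : L2W R} (hu : u ∈ c2Submodule R) : IsC2 R (c2Rep u hu) := hu.choose_spec.1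

theorem c2Rep_ae_eq {u : L2W R} (hu : u ∈ c2Submodule R) :
    (u : Lp ℂ 2 (haar R)) =ᵐ[haar R] c2Rep u hu := hu.choose_spec.2

theorem c2Rep_eq {u : L2W R} (hu : u ∈ c2Submodule R) {g : Torus R → ℂ} (hg : IsC2 R g)
    (h : (u : Lp ℂ 2 (haar R)) =ᵐ[haar R] g) : c2Rep u hu = g :=
  ((isC2_c2Rep hu).continuous.ae_eq_iff_eq (haar R) hg.continuous).1
    ((c2Rep_ae_eq hu).symm.trans h)

theorem c2Rep_reflT {u : L2W R} (hu : u ∈ c2Submodule R) (i : ι) (t : Torus R) :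
    c2Rep u hu (reflT R i t) = c2Rep u hu t := by
  have h : (fun t => c2Rep u hu (reflT R i t)) = c2Rep u hu := by
    refine (((isC2_c2Rep hu).continuous.comp (continuous_reflT R i)).ae_eq_iff_eq (haar R)
      (isC2_c2Rep hu).continuous).1 ?_
    have h1 := (measurePreserving_reflT R i).quasiMeasurePreserving.ae_eq_comp (c2Rep_ae_eq hu)
    exact h1.symm.trans (((mem_invariantSubmodule_iff R).1 u.2 i).trans (c2Rep_ae_eq hu))
  exact congr_fun h t

theorem torusLaplacian_reflT [IsWeylInvariantInner R] {g : Torus R → ℂ} (hg : IsC2 R g)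
    (i : ι) (hinv : ∀ t, g (reflT R i t) = g t) (t : Torus R) :
    torusLaplacian R g (reflT R i t) = torusLaplacian R g t := by
  rw [← Torus.mk_rep R t, reflT_mk, torusLaplacian_mk, torusLaplacian_mk]
  let e : V ≃ₗᵢ[ℝ] V := (R.coreflection i).isometryOfInner
    (IsWeylInvariantInner.inner_coreflection i)
  have h := laplacian_comp_isometry e hg (Torus.rep R t)
  have h' : (fun y => g (Torus.mk R (e y))) = fun y => g (Torus.mk R y) :=
    funext fun y => hinv (Torus.mk R y)
  rw [h'] at h
  exact h.symm

/-- A potential: a function on `T` invariant under the Weyl group, written as a function on `V`. -/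
structure IsPotential (R : RootPairing ι ℝ M V) (v : V → ℂ) : Prop where
  periodic : ∀ x, ∀ l ∈ periodLattice R, v (x + l) = v x
  invariant : ∀ i x, v (R.coreflection i x) = v x

/-- The value `-Δg + v g` at the `C²` representative `g` of `u`. -/
def schrodingerFun (v : V → ℂ) (u : L2W R) (hu : u ∈ c2Submodule R) (t : Torus R) : ℂ :=
  -torusLaplacian R (c2Rep u hu) t + onTorus R v t * c2Rep u hu t

theorem memLp_schrodingerFun (v : V → ℂ) {u : L2W R} (hu : u ∈ c2Submodule R ⊓ mulDomain R v) :
    MemLp (schrodingerFun v u hu.1) 2 (haar R) := by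
  refine MemLp.add (memLp_of_continuous (isC2_c2Rep hu.1).continuous_laplacian).neg
    (MemLp.ae_eq ?_ hu.2)
  filter_upwards [c2Rep_ae_eq hu.1] with t ht
  rw [ht]

theorem schrodingerFun_mem [IsWeylInvariantInner R] {v : V → ℂ} (hv : IsPotential R v)
    {u : L2W R} (hu : u ∈ c2Submodule R ⊓ mulDomain R v) :
    (memLp_schrodingerFun v hu).toLp _ ∈ invariantSubmodule R := by
  rw [mem_invariantSubmodule_iff]
  intro i
  have h := (memLp_schrodingerFun v hu).coeFn_toLp
  have h1 := (measurePreserving_reflT R i).quasiMeasurePreserving.ae_eq_comp h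
  refine h1.trans (Filter.EventuallyEq.trans ?_ h.symm)
  refine ae_of_all _ fun t => ?_
  have h2 : onTorus R v (reflT R i t) = onTorus R v t := by
    rw [← Torus.mk_rep R t, reflT_mk, onTorus_mk R hv.periodic, onTorus_mk R hv.periodic,
      hv.invariant]
  simp only [Function.comp_apply, schrodingerFun, c2Rep_reflT, h2,
    torusLaplacian_reflT (isC2_c2Rep hu.1) i (c2Rep_reflT hu.1 i)]

variable (R) in
/-- The operator `-Δ + v` in `L²(T, dμ)^W`, with domain the set of all `u ∈ C²(T)^W` such that
`v u ∈ L²(T, dμ)`. -/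
def schrodinger [IsWeylInvariantInner R] (v : V → ℂ) (hv : IsPotential R v) :
    L2W R →ₗ.[ℂ] L2W R where
  domain := c2Submodule R ⊓ mulDomain R v
  toFun :=
    { toFun u := ⟨(memLp_schrodingerFun v u.2).toLp _, schrodingerFun_mem hv u.2⟩
      map_add' := by
        rintro ⟨u, hu⟩ ⟨u', hu'⟩
        have e : c2Rep (u + u') (add_mem hu hu').1 = c2Rep u hu.1 + c2Rep u' hu'.1 :=
          c2Rep_eq _ (ContDiff.add (isC2_c2Rep hu.1) (isC2_c2Rep hu'.1))
            ((Lp.coeFn_add _ _).trans ((c2Rep_ae_eq hu.1).add (c2Rep_ae_eq hu'.1)))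
        apply Subtype.ext
        refine (MemLp.toLp_congr (memLp_schrodingerFun v (add_mem hu hu'))
          ((memLp_schrodingerFun v hu).add (memLp_schrodingerFun v hu'))
          (ae_of_all _ fun t => ?_)).trans
          (MemLp.toLp_add (memLp_schrodingerFun v hu) (memLp_schrodingerFun v hu'))
        have := (ContDiff.contDiffAt (x := Torus.rep R t) (isC2_c2Rep hu.1)).laplacian_add
          (ContDiff.contDiffAt (x := Torus.rep R t) (isC2_c2Rep hu'.1))
        simp only [schrodingerFun, Pi.add_apply, e, torusLaplacian, onTorus]
        have h2 : (fun h => c2Rep u hu.1 (Torus.mk R h) + c2Rep u' hu'.1 (Torus.mk R h)) =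
          (fun h => c2Rep u hu.1 (Torus.mk R h)) + fun h => c2Rep u' hu'.1 (Torus.mk R h) := rfl
        rw [h2, this]
        ring
      map_smul' := by
        rintro c ⟨u, hu⟩
        have e : c2Rep (c • u) ((c2Submodule R).smul_mem c hu.1) = c • c2Rep u hu.1 :=
          c2Rep_eq _ (ContDiff.const_smul c (isC2_c2Rep hu.1))
            ((Lp.coeFn_smul _ _).trans ((c2Rep_ae_eq hu.1).const_smul c))
        apply Subtype.ext
        refine (MemLp.toLp_congr (memLp_schrodingerFun v (Submodule.smul_mem _ c hu))
          ((memLp_schrodingerFun v hu).const_smul c)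
          (ae_of_all _ fun t => ?_)).trans (MemLp.toLp_const_smul c (memLp_schrodingerFun v hu))
        have := InnerProductSpace.laplacian_smul c
          (ContDiff.contDiffAt (x := Torus.rep R t) (isC2_c2Rep hu.1))
        simp only [schrodingerFun, Pi.smul_apply, e, torusLaplacian, onTorus, smul_eq_mul]
        have h2 : (fun h => c * c2Rep u hu.1 (Torus.mk R h)) =
          c • (fun h => c2Rep u hu.1 (Torus.mk R h)) := rfl
        rw [h2, this, smul_eq_mul]
        ring }
end Torus

section Weierstrass

/-- `τ = log p / (2πi)`, so that `p = exp(2πiτ)`. -/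
def tau (p : ℝ) : ℂ := Complex.log p / (2 * Real.pi * Complex.I)

theorem exp_tau {p : ℝ} (hp : p ≠ 0) : Complex.exp (2 * Real.pi * Complex.I * tau p) = p := by
  rw [tau, mul_div_cancel₀, Complex.exp_log]
  · exact_mod_cast hp
  · simp [Real.pi_ne_zero]

theorem tau_im_pos {p : ℝ} (h0 : p ≠ 0) (h1 : |p| < 1) : 0 < (tau p).im := by
  have h : tau p = (-(Complex.log p) * Complex.I) / ((2 * Real.pi : ℝ) : ℂ) := by
    rw [tau]
    push_cast
    have : (Real.pi : ℂ) ≠ 0 := by simp [Real.pi_ne_zero]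
    field_simp
    simp
  rw [h, Complex.div_ofReal_im]
  simp only [Complex.mul_im, Complex.neg_re, Complex.I_im, Complex.I_re, mul_one, mul_zero,
    add_zero, Complex.log_re, Complex.norm_real, Real.norm_eq_abs]
  have := Real.log_neg (abs_pos.2 h0) h1
  have := Real.pi_pos
  apply div_pos <;> linarith

/-- The periods `2π` and `2πτ`, where `p = exp(2πiτ)`. -/
def periods (p : ℝ) (h0 : p ≠ 0) (h1 : |p| < 1) : PeriodPair where
  ω₁ := 2 * Real.pi
  ω₂ := 2 * Real.pi * tau p
  indep := by
    rw [LinearIndependent.pair_iff]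
    intro s t h
    have hpi : (2 * Real.pi : ℂ) ≠ 0 := by simp [Real.pi_ne_zero]
    have h' : (2 * Real.pi : ℂ) * (s + t * tau p) = 0 := by
      rw [← h, Complex.real_smul, Complex.real_smul]
      ring
    replace h' := (mul_eq_zero.1 h').resolve_left hpi
    have him := congr_arg Complex.im h'
    rw [Complex.add_im, Complex.ofReal_im, Complex.im_ofReal_mul, zero_add, Complex.zero_im] at him
    have ht : t = 0 := (mul_eq_zero.1 him).resolve_right (tau_im_pos h0 h1).ne'
    subst ht
    refine ⟨?_, rfl⟩
    have := congr_arg Complex.re h'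
    simpa using this

/-- The function `℘(x; π, πτ)` of a real variable `x`, where `p = exp(2πiτ)` and the half-periods are
`π` and `πτ`; for `p = 0`, its limit `1 / (4 sin² (x/2)) - 1/12`. -/
def wp (p : Set.Ioo (-1 : ℝ) 1) (x : ℝ) : ℂ :=
  if h : (p : ℝ) = 0 then ((1 / (4 * Real.sin (x / 2) ^ 2) - 1 / 12 : ℝ) : ℂ)
  else (periods p h (abs_lt.2 p.2)).weierstrassP x

theorem wp_add (p : Set.Ioo (-1 : ℝ) 1) (x : ℝ) (n : ℤ) :
    wp p (x + n * (2 * Real.pi)) = wp p x := by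
  unfold wp
  split_ifs with h
  · have : (x + n * (2 * Real.pi)) / 2 = x / 2 + n * Real.pi := by ring
    have hsq : ((-1 : ℝ) ^ n) ^ 2 = 1 := by
      rw [← zpow_natCast, ← zpow_mul, mul_comm, zpow_mul]
      norm_num
    rw [this, Real.sin_add_int_mul_pi, mul_pow, hsq, one_mul]
  · let L := periods p h (abs_lt.2 p.2)
    have hl : ((n : ℂ) * (2 * Real.pi)) ∈ L.lattice :=
      PeriodPair.mem_lattice.2 ⟨n, 0, by simp [L, periods]⟩
    have := L.periodic_weierstrassP ⟨_, hl⟩ x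
    push_cast
    exact this

theorem wp_neg (p : Set.Ioo (-1 : ℝ) 1) (x : ℝ) : wp p (-x) = wp p x := by
  unfold wp
  split_ifs with h
  · rw [neg_div, Real.sin_neg, neg_sq]
  · push_cast
    exact PeriodPair.weierstrassP_neg _ _

end Weierstrass

section Hamiltonian
variable {ι M V : Type*} [AddCommGroup M] [Module ℝ M]
  [NormedAddCommGroup V] [InnerProductSpace ℝ V] [FiniteDimensional ℝ V]
  [Fintype ι] (R : RootPairing ι ℝ M V)

/-- `|α|²` for the root `α` with index `i`, in the norm dual to that of `V`. -/
def rootNormSq (i : ι) : ℝ := ‖LinearMap.toContinuousLinearMap (R.root' i)‖ ^ 2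

open Classical in
/-- The potential `∑_{α ∈ R₊} k_α (k_α - 1) |α|² ℘(⟨α, h⟩)`. -/
def potential (b : R.Base) (k : ι → ℝ) (p : Set.Ioo (-1 : ℝ) 1) (h : V) : ℂ :=
  ∑ i with b.IsPos i, ((k i * (k i - 1) * rootNormSq R i : ℝ) : ℂ) * wp p (R.root' i h)

theorem root'_reflectionPerm (i j : ι) (h : V) :
    R.root' (R.reflectionPerm i j) h = R.root' j (R.coreflection i h) := by
  exact (LinearMap.congr_fun (R.flip.coroot'_reflectionPerm (i := i) (j := j)) h)

theorem rootNormSq_reflectionPerm [IsWeylInvariantInner R] (i j : ι) :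
    rootNormSq R (R.reflectionPerm i j) = rootNormSq R j := by
  let e : V ≃ₗᵢ[ℝ] V := (R.coreflection i).isometryOfInner
    (IsWeylInvariantInner.inner_coreflection i)
  have h : LinearMap.toContinuousLinearMap (R.root' (R.reflectionPerm i j)) =
      (LinearMap.toContinuousLinearMap (R.root' j)).comp (e : V →L[ℝ] V) := by
    ext x
    exact root'_reflectionPerm R i j x
  rw [rootNormSq, h, rootNormSq, ContinuousLinearMap.opNorm_comp_linearIsometryEquiv]

open Classical in
theorem sum_eq_two_mul_sum_pos (b : R.Base) (F : ι → ℂ)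
    (hF : ∀ i, F (R.reflectionPerm i i) = F i) : ∑ i, F i = 2 * ∑ i with b.IsPos i, F i := by
  let := R.indexNeg
  rw [← Finset.sum_filter_add_sum_filter_not Finset.univ b.IsPos, two_mul]
  congr 1
  refine Finset.sum_nbij' (fun i => R.reflectionPerm i i) (fun i => R.reflectionPerm i i)
    ?_ ?_ ?_ ?_ ?_
  · intro i hi
    simp only [Finset.mem_filter, Finset.mem_univ, true_and] at hi ⊢
    exact (RootPairing.Base.IsPos.or_neg b i).resolve_left hi
  · intro i hi
    simp only [Finset.mem_filter, Finset.mem_univ, true_and] at hi ⊢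
    intro h
    exact (RootPairing.Base.IsPos.neg_iff_not b i).1 h hi
  · intro i _
    exact neg_neg i
  · intro i _
    exact neg_neg i
  · intro i _
    exact (hF i).symm

theorem wp_periodic [R.IsCrystallographic] (p : Set.Ioo (-1 : ℝ) 1) (i : ι) (x : V) :
    ∀ l ∈ periodLattice R, wp p (R.root' i (x + l)) = wp p (R.root' i x) := by
  intro l hl
  have : ∃ n : ℤ, R.root' i l = n * (2 * Real.pi) := by
    refine AddSubgroup.closure_induction ?_ ⟨0, by simp⟩ ?_ ?_ hl
    · rintro _ ⟨j, rfl⟩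
      refine ⟨R.pairingIn ℤ i j, ?_⟩
      have := R.algebraMap_pairingIn ℤ i j
      rw [map_smul, RootPairing.root'_coroot_eq_pairing, ← this]
      simp [mul_comm]
    · rintro a b _ _ ⟨m, hm⟩ ⟨n, hn⟩
      exact ⟨m + n, by rw [map_add, hm, hn]; push_cast; ring⟩
    · rintro a _ ⟨m, hm⟩
      exact ⟨-m, by rw [map_neg, hm]; push_cast; ring⟩
  obtain ⟨n, hn⟩ := this
  rw [map_add, hn, wp_add]

theorem isPotential_potential [R.IsCrystallographic] [IsWeylInvariantInner R] (b : R.Base)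
    (k : ι → ℝ) (hk : ∀ i j, k (R.reflectionPerm i j) = k j) (p : Set.Ioo (-1 : ℝ) 1) :
    IsPotential R (potential R b k p) where
  periodic x l hl := by
    simp only [potential, wp_periodic R p _ x l hl]
  invariant j x := by
    classical
    let F : V → ι → ℂ := fun h i =>
      ((k i * (k i - 1) * rootNormSq R i : ℝ) : ℂ) * wp p (R.root' i h)
    have hF : ∀ j h i, F h (R.reflectionPerm j i) = F (R.coreflection j h) i := by
      intro j h i
      simp only [F, hk, rootNormSq_reflectionPerm, root'_reflectionPerm]
    have hneg : ∀ h i, F h (R.reflectionPerm i i) = F h i := by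
      intro h i
      have : R.root' i (R.coreflection i h) = -R.root' i h := by
        rw [RootPairing.coreflection_apply, map_sub, map_smul]
        simp
        ring
      rw [hF]
      simp only [F, this, wp_neg]
    have h2 : (2 : ℂ) ≠ 0 := two_ne_zero
    change ∑ i with b.IsPos i, F (R.coreflection j x) i = ∑ i with b.IsPos i, F x i
    apply mul_left_cancel₀ h2
    rw [← sum_eq_two_mul_sum_pos R b _ (hneg _), ← sum_eq_two_mul_sum_pos R b _ (hneg _)]
    simp only [← hF]
    exact Equiv.sum_comp (R.reflectionPerm j) (F x)

/-- The Hamiltonian `H_E(p) = -Δ + ∑_{α ∈ R₊} k_α (k_α - 1) |α|² ℘(⟨α, h⟩)` in `L²(T, dμ)^W`, with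
domain the set of all `u ∈ C²(T)^W` whose product with the potential is in `L²(T, dμ)`. -/
def hamiltonian [R.IsRootSystem] [R.IsCrystallographic] [IsWeylInvariantInner R] (b : R.Base)
    (k : ι → ℝ) (hk : ∀ i j, k (R.reflectionPerm i j) = k j) (p : Set.Ioo (-1 : ℝ) 1) :
    L2W R →ₗ.[ℂ] L2W R :=
  schrodinger R (potential R b k p) (isPotential_potential R b k hk p)

/-- The common domain in `L²(T, dμ)^W` of the operators of multiplication by the functions
`℘(⟨α, h⟩)`, for all roots `α`. -/
def wpDomain [R.IsRootSystem] (p : Set.Ioo (-1 : ℝ) 1) : Submodule ℂ (L2W R) :=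
  ⨅ i, mulDomain R fun h => wp p (R.root' i h)

open Classical in
/-- The function `∏_{α ∈ R₊} |sin (⟨α, h⟩ / 2)| ^ k_α`. -/
def groundState (b : R.Base) (k : ι → ℝ) (h : V) : ℝ :=
  ∏ i with b.IsPos i, |Real.sin (R.root' i h / 2)| ^ k i

/-- The weight lattice `P`. -/
def weightLattice : AddSubgroup M where
  carrier := {w | ∀ i, ∃ n : ℤ, R.coroot' i w = n}
  zero_mem' i := ⟨0, by simp⟩
  add_mem' {v w} hv hw i := by
    obtain ⟨m, hm⟩ := hv i
    obtain ⟨n, hn⟩ := hw i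
    exact ⟨m + n, by rw [map_add, hm, hn]; push_cast; rfl⟩
  neg_mem' {w} hw i := by
    obtain ⟨n, hn⟩ := hw i
    exact ⟨-n, by rw [map_neg, hn]; push_cast; rfl⟩

/-- The function `e^w : h ↦ exp(i⟨w, h⟩)`. -/
def expWeight (w : M) (h : V) : ℂ := Complex.exp (Complex.I * (R.toLinearMap w h : ℝ))

/-- `ℂ[P]^W`, as a space of functions on `V`. -/
def invariantPolynomials : Submodule ℂ (V → ℂ) where
  carrier := {F | F ∈ Submodule.span ℂ (expWeight R '' weightLattice R) ∧
    ∀ i h, F (R.coreflection i h) = F h}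
  zero_mem' := ⟨zero_mem _, fun _ _ => rfl⟩
  add_mem' hF hG := ⟨add_mem hF.1 hG.1, fun i h => congr_arg₂ (· + ·) (hF.2 i h) (hG.2 i h)⟩
  smul_mem' c _ hF := ⟨Submodule.smul_mem _ c hF.1, fun i h => congr_arg (c * ·) (hF.2 i h)⟩

/-- The space `𝒫 = ℂ[P]^W · ∏_{α ∈ R₊} |sin (⟨α, h⟩ / 2)| ^ k_α` in `L²(T, dμ)^W`. -/
def polySpace [R.IsRootSystem] (b : R.Base) (k : ι → ℝ) : Submodule ℂ (L2W R) where
  carrier := {u | ∃ F ∈ invariantPolynomials R, (u : Lp ℂ 2 (haar R)) =ᵐ[haar R]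
    onTorus R fun h => F h * groundState R b k h}
  zero_mem' := by
    refine ⟨0, zero_mem _, (Lp.coeFn_zero _ _ _).trans (ae_of_all _ fun t => ?_)⟩
    simp [onTorus]
  add_mem' := by
    rintro u v ⟨F, hF, hu⟩ ⟨G, hG, hv⟩
    refine ⟨F + G, add_mem hF hG, ((Lp.coeFn_add _ _).trans (hu.add hv)).trans
      (ae_of_all _ fun t => ?_)⟩
    simp [onTorus, add_mul]
  smul_mem' := by
    rintro c u ⟨F, hF, hu⟩
    refine ⟨c • F, Submodule.smul_mem _ c hF, ((Lp.coeFn_smul _ _).trans (hu.const_smul c)).trans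
      (ae_of_all _ fun t => ?_)⟩
    simp [onTorus, mul_assoc]

end Hamiltonian

section SelfAdjoint
variable {E : Type*} [NormedAddCommGroup E] [InnerProductSpace ℂ E] [CompleteSpace E]

/-- A densely defined operator is essentially self-adjoint if it is closable and its closure is
self-adjoint. -/
def IsEssentiallySelfAdjoint (A : E →ₗ.[ℂ] E) : Prop :=
  Dense (A.domain : Set E) ∧ A.IsClosable ∧ IsSelfAdjoint A.closure

/-- The subspace `D` lies in the domain of `A`, and `A|_D` is essentially self-adjoint. -/
def IsEssentiallySelfAdjointOn (A : E →ₗ.[ℂ] E) (D : Submodule ℂ E) : Prop :=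
  D ≤ A.domain ∧ IsEssentiallySelfAdjoint (A.domRestrict D)

end SelfAdjoint

end CalogeroMoser

end

/-! Let `Φ` be the ground state. As a product over all roots it is the product of the `|sin (α/2)| ^
(k_α/2)`, the value of `phiReg` at `ε = 0`. Conjugation by `Φ` turns the Laplacian into `L + ΔΦ/Φ`,
where `L = Δ + 2 ∇log Φ · ∇` (`conjLaplacian`). The function `ΔΦ/Φ` contains the double sum of `k_α
k_β (α, β) cot (α/2) cot (β/2)`, and this collapses to a constant plus the contribution of
proportional roots (`exists_sum_cotan_eq`). Hence `ΔΦ/Φ` is a constant plus the sum over positive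
roots of `k_α (k_α - 1) |α|² / (4 sin² (α/2))`, which is the singular part of the potential. Since
`℘(x) - 1/(4 sin² (x/2))` is bounded on the real line, `V - ΔΦ/Φ` is a bounded real function
(`multiplier`), and formally the Hamiltonian sends `FΦ` to `-(LF)Φ` plus this bounded function times
`FΦ`.

The operator `L` maps invariant trigonometric polynomials with weights in a saturated finite set to
polynomials of the same kind (`exists_conjugated_laplacian_eq`), and it is symmetric for the weight
`Φ²`. So on `𝒫`, up to a bounded symmetric operator, the Hamiltonian is symmetric and preserves
finite-dimensional spaces that exhaust `𝒫`. On each of them adding `ic` with `c ≠ 0` gives a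
bijection, and the bounded perturbation is harmless once `|c|` exceeds its norm
(`isEssentiallySelfAdjoint_of_finiteDimensional_invariant`).

It remains to see that the adjoint really acts on `𝒫` by this formula, i.e. that Green's formula
between `FΦ` and a function `u` of the domain has no contribution from the walls. If `℘(α) u` is
square-integrable, the continuous function `u` must vanish on the walls of `α`. Invariance under the
reflection then kills the normal derivative, so `|u| ≤ C sin² (α/2)`, which compensates the double
pole of `ΔΦ/Φ`. Green's formula is proved for the regularization `(sin² + ε) ^ (k/4)` and passes to
the limit by dominated convergence (`green`).

When only `Vu` is known to be square-integrable, the singularities of the other roots are removed by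
multiplying with their `sin²`. The coefficient of `℘(α)` is nonzero if `k_α ≠ 0, 1`, and a wall with
`k_α = 0` needs no condition because `Φ` does not involve it. For `k_α = 1` the potential does not
see the wall although `Φ` vanishes there, which is why this value is excluded from the second
assertion. All density statements come from Stone–Weierstrass and sums over Weyl orbits. -/

set_option linter.unusedSectionVars false
noncomputable section
namespace CalogeroMoser

/-! ### Criteria for essential self-adjointness -/

section SelfAdjointCriterion
variable {E : Type*} [NormedAddCommGroup E] [InnerProductSpace ℂ E] [CompleteSpace E]

open LinearPMap in
theorem le_adjoint_of_symmetric {B : E →ₗ.[ℂ] E} (hd : Dense (B.domain : Set E))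
    (hs : ∀ x y : B.domain, inner ℂ (B x) (y : E) = inner ℂ (x : E) (B y)) : B ≤ B† :=
  IsFormalAdjoint.le_adjoint hd hs

/-- Symmetry makes `⟪Bx, x⟫` real, so the cross term with the imaginary scalar `ic` has no real
part. -/
theorem norm_sq_add_smul_of_symmetric {B : E →ₗ.[ℂ] E}
    (hs : ∀ x y : B.domain, inner ℂ (B x) (y : E) = inner ℂ (x : E) (B y)) (c : ℝ)
    (x : B.domain) :
    ‖B x + (c * Complex.I) • (x : E)‖ ^ 2 = ‖B x‖ ^ 2 + c ^ 2 * ‖(x : E)‖ ^ 2 := by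
  have him : (inner ℂ (B x) (x : E)).im = 0 := by
    have h := congr_arg Complex.im (hs x x)
    have h' := congr_arg Complex.im (inner_conj_symm (𝕜 := ℂ) (B x) (x : E))
    rw [Complex.conj_im] at h'
    linarith
  rw [@norm_add_sq ℂ, inner_smul_right, norm_smul]
  have h2 : RCLike.re ((c * Complex.I) * inner ℂ (B x) (x : E)) = 0 := by
    simp [him]
  rw [h2]
  simp [mul_pow]

open LinearPMap in
/-- A densely defined symmetric operator for which the ranges of `B ± ic` are dense is essentially
self-adjoint. -/
theorem isEssentiallySelfAdjoint_of_dense_range {B : E →ₗ.[ℂ] E} (hd : Dense (B.domain : Set E))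
    (hs : ∀ x y : B.domain, inner ℂ (B x) (y : E) = inner ℂ (x : E) (B y)) {c : ℝ} (hc : c ≠ 0)
    (hr : DenseRange fun x : B.domain => B x + (c * Complex.I) • (x : E))
    (hr' : DenseRange fun x : B.domain => B x + ((-c : ℝ) * Complex.I) • (x : E)) :
    IsEssentiallySelfAdjoint B := by
  have hle := le_adjoint_of_symmetric hd hs
  have hclo : B†.IsClosed := adjoint_isClosed hd
  have hcl : B.IsClosable := isClosable_iff_exists_closed_extension.2 ⟨_, hclo, hle⟩
  refine ⟨hd, hcl, ?_⟩
  have hBc : B.closure = B† := by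
    apply le_antisymm
    · have h := hclo.isClosable.closure_mono hle
      have h2 : B†.closure = B† := by
        apply eq_of_eq_graph
        rw [← hclo.isClosable.graph_closure_eq_closure_graph]
        exact hclo.submodule_topologicalClosure_eq
      rwa [h2] at h
    · apply le_of_le_graph
      rw [← hcl.graph_closure_eq_closure_graph]
      rintro ⟨y, z⟩ hyz
      rw [mem_graph_iff] at hyz
      obtain ⟨y', rfl, rfl⟩ := hyz
      -- Approximate `(B† + ic) y'` by values of `B + ic` at points `w n`. The norm identity makes
      -- `w n` a Cauchy sequence, and its limit lies in the domain of the closure.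
      obtain ⟨x, hx⟩ := mem_closure_iff_seq_limit.1 (hr (B† y' + (c * Complex.I) • (y' : E)))
      obtain ⟨hx, hlim⟩ := hx
      choose w hw using hx
      have hw' : ∀ n, B (w n) + (c * Complex.I) • (w n : E) = x n := hw
      have hbound : ∀ n m, ‖(w n : E) - w m‖ ≤ |c|⁻¹ * ‖x n - x m‖ := by
        intro n m
        have h := norm_sq_add_smul_of_symmetric hs c (w n - w m)
        have h1 : B (w n - w m) + (c * Complex.I) • ((w n - w m : B.domain) : E) = x n - x m := by
          rw [← hw', ← hw', LinearPMap.map_sub]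
          simp only [Submodule.coe_sub, smul_sub]
          abel
        rw [h1] at h
        have h2 : (|c| * ‖(w n : E) - w m‖) ^ 2 ≤ ‖x n - x m‖ ^ 2 := by
          rw [h, mul_pow, sq_abs]
          simp only [Submodule.coe_sub]
          nlinarith [sq_nonneg ‖B (w n - w m)‖]
        have h3 := abs_le_of_sq_le_sq' h2 (norm_nonneg _)
        rw [inv_mul_eq_div, le_div_iff₀ (abs_pos.2 hc), mul_comm]
        exact h3.2
      have hcau : CauchySeq fun n => (w n : E) := by
        have hx := hlim.cauchySeq
        rw [Metric.cauchySeq_iff] at hx ⊢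
        intro ε hε
        obtain ⟨N, hN⟩ := hx (|c| * ε) (by positivity)
        refine ⟨N, fun m hm n hn => ?_⟩
        have := hN m hm n hn
        rw [dist_eq_norm] at this ⊢
        refine (hbound m n).trans_lt ?_
        rw [inv_mul_eq_div, div_lt_iff₀ (abs_pos.2 hc), mul_comm]
        exact this
      obtain ⟨u, hu⟩ := cauchySeq_tendsto_of_complete hcau
      have hBw : Filter.Tendsto (fun n => B (w n)) Filter.atTop
          (nhds (B† y' + (c * Complex.I) • (y' : E) - (c * Complex.I) • u)) := by
        have : (fun n => B (w n)) = fun n => x n - (c * Complex.I) • (w n : E) := by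
          funext n
          rw [← hw']
          abel
        rw [this]
        exact hlim.sub (hu.const_smul _)
      have hmem : (u, B† y' + (c * Complex.I) • (y' : E) - (c * Complex.I) • u) ∈
          B.graph.topologicalClosure := by
        refine mem_closure_of_tendsto (hu.prodMk_nhds hBw) (Filter.Eventually.of_forall fun n => ?_)
        exact mem_graph B (w n)
      have hmem' : (u, B† y' + (c * Complex.I) • (y' : E) - (c * Complex.I) • u) ∈ B†.graph := by
        have h := Submodule.topologicalClosure_mono (le_graph_of_le hle) hmem
        rwa [hclo.submodule_topologicalClosure_eq] at h
      rw [mem_graph_iff] at hmem'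
      obtain ⟨u', hu', hBu⟩ := hmem'
      simp only at hu' hBu
      subst hu'
      -- The difference lies in the kernel of `B† + ic`, which is the orthogonal complement of the
      -- range of `B - ic`.
      have hzero : (y' : E) - u' = 0 := by
        refine hr'.eq_zero_of_inner_left ℂ ?_
        intro x
        have h1 := adjoint_isFormalAdjoint hd (y' - u') x
        rw [LinearPMap.map_sub, hBu] at h1
        have h2 : B† y' - (B† y' + (c * Complex.I) • (y' : E) - (c * Complex.I) • (u' : E)) =
            -((c * Complex.I) • ((y' : E) - u')) := by
          rw [smul_sub]; abel
        rw [h2] at h1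
        simp only [inner_add_right, inner_smul_right]
        rw [Submodule.coe_sub] at h1
        rw [← h1, inner_neg_left, inner_smul_left]
        simp
      rw [sub_eq_zero] at hzero
      have : ((u' : E), B† y' + (c * Complex.I) • (y' : E) - (c * Complex.I) • (u' : E)) =
        ((y' : E), B† y') := by rw [hzero]; simp
      rwa [← this]
  -- `B†† ≤ B†` because `B ≤ B†`. Conversely the graph of `B†` is the closure of that of `B`, so the
  -- adjunction between `B` and `B†` passes to the limit in its first argument.
  rw [isSelfAdjoint_def, hBc]
  have hd' : Dense (B†.domain : Set E) := hd.mono hle.1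
  apply le_antisymm
  · refine ⟨fun x hx => ?_, fun x y hxy => ?_⟩
    · refine mem_adjoint_domain_of_exists _ ⟨B†† ⟨x, hx⟩, fun z => ?_⟩
      have h := adjoint_isFormalAdjoint hd' ⟨x, hx⟩ ⟨z, hle.1 z.2⟩
      rw [h, ← hle.2 (x := z) (y := ⟨z, hle.1 z.2⟩) rfl]
    · refine (adjoint_apply_eq hd y fun z => ?_).symm
      have h := adjoint_isFormalAdjoint hd' x ⟨z, hle.1 z.2⟩
      rw [h, ← hle.2 (x := z) (y := ⟨z, hle.1 z.2⟩) rfl, hxy]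
  · refine IsFormalAdjoint.le_adjoint hd' fun x z => ?_
    have hx : ((x : E), B† x) ∈ closure (B.graph : Set (E × E)) := by
      have h := mem_graph B† x
      have hg : B†.graph = B.graph.topologicalClosure := by
        rw [hcl.graph_closure_eq_closure_graph, hBc]
      rwa [hg] at h
    have hsub : closure (B.graph : Set (E × E)) ⊆
        {q | inner ℂ q.2 (z : E) = inner ℂ q.1 (B† z)} := by
      refine closure_minimal ?_ (isClosed_eq (by fun_prop) (by fun_prop))
      rintro ⟨a, a'⟩ ha
      obtain ⟨w, hw, hw'⟩ := (mem_graph_iff B).1 ha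
      simp only at hw hw'
      subst hw hw'
      exact ((adjoint_isFormalAdjoint hd).symm w z)
    exact hsub hx

/-- A densely defined operator that exhausts its domain by finite-dimensional subspaces, each of
which is invariant under it up to a fixed bounded symmetric operator, and that is symmetric up to the
latter, is essentially self-adjoint. -/
theorem isEssentiallySelfAdjoint_of_finiteDimensional_invariant {B : E →ₗ.[ℂ] E}
    (hd : Dense (B.domain : Set E)) (T : E →L[ℂ] E)
    (hT : ∀ x y, inner ℂ (T x) y = inner ℂ x (T y))
    (hs : ∀ x y : B.domain, inner ℂ (B x - T x) (y : E) = inner ℂ (x : E) (B y - T y))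
    (hK : ∀ x : B.domain, ∃ K : Submodule ℂ E, FiniteDimensional ℂ K ∧ (x : E) ∈ K ∧
      ∀ y ∈ K, ∃ hy : y ∈ B.domain, B ⟨y, hy⟩ - T y ∈ K) :
    IsEssentiallySelfAdjoint B := by
  have hsB : ∀ x y : B.domain, inner ℂ (B x) (y : E) = inner ℂ (x : E) (B y) := by
    intro x y
    have h := hs x y
    rw [inner_sub_left, inner_sub_right, hT] at h
    exact sub_left_injective h
  let A : E →ₗ.[ℂ] E := ⟨B.domain, B.toFun - (T : E →ₗ[ℂ] E).comp B.domain.subtype⟩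
  have hA : ∀ x : B.domain, A x = B x - T x := fun x => rfl
  have hsA : ∀ x y : A.domain, inner ℂ (A x) (y : E) = inner ℂ (x : E) (A y) := hs
  -- On a finite-dimensional space preserved by the symmetric operator `A = B - T`, the norm
  -- identity makes `A + ic` injective, hence surjective. Therefore the range of `A + ic` contains
  -- the whole domain.
  have hsolve : ∀ c : ℝ, c ≠ 0 → ∀ z : B.domain, ∃ x : B.domain,
      B x - T x + (c * Complex.I) • (x : E) = z := by
    intro c hc z
    obtain ⟨K, hKf, hzK, hKB⟩ := hK z
    choose hdom hmem using hKB
    let S : K →ₗ[ℂ] K :=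
      { toFun y := ⟨B ⟨y, hdom y y.2⟩ - T y + (c * Complex.I) • (y : E),
          K.add_mem (hmem y y.2) (K.smul_mem _ y.2)⟩
        map_add' a a' := by
          apply Subtype.ext
          have h : B ⟨((a + a' : K) : E), hdom _ (a + a').2⟩ =
              B ⟨a, hdom a a.2⟩ + B ⟨a', hdom a' a'.2⟩ := by
            rw [← LinearPMap.map_add]; rfl
          refine (congr_arg (fun q => q - T ((a : E) + a') + (c * Complex.I) • ((a : E) + a'))
            h).trans ?_
          simp only [Submodule.coe_add, map_add, smul_add]
          abel
        map_smul' r a := by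
          apply Subtype.ext
          have h : B ⟨((r • a : K) : E), hdom _ (r • a).2⟩ = r • B ⟨a, hdom a a.2⟩ := by
            rw [← LinearPMap.map_smul]; rfl
          refine (congr_arg (fun q => q - T (r • (a : E)) + (c * Complex.I) • (r • (a : E)))
            h).trans ?_
          simp only [Submodule.coe_smul, map_smul, RingHom.id_apply, smul_add, smul_sub,
            smul_comm r] }
    have hinj : Function.Injective S := by
      rw [← LinearMap.ker_eq_bot, LinearMap.ker_eq_bot']
      intro y hy
      have h := norm_sq_add_smul_of_symmetric hsA c ⟨y, hdom y y.2⟩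
      have h0 : A ⟨y, hdom y y.2⟩ + (c * Complex.I) • (y : E) = 0 := congr_arg Subtype.val hy
      simp only [h0] at h
      have hc2 : 0 < c ^ 2 := by positivity
      have h1 : ‖(y : E)‖ ^ 2 = 0 := by
        have hn := sq_nonneg ‖A ⟨y, hdom y y.2⟩‖
        have hy2 := sq_nonneg ‖(y : E)‖
        have : c ^ 2 * ‖(y : E)‖ ^ 2 ≤ 0 := by
          rw [norm_zero] at h
          linarith
        nlinarith
      exact Subtype.ext (norm_eq_zero.1 (pow_eq_zero_iff two_ne_zero |>.1 h1))
    obtain ⟨y, hy⟩ := (LinearMap.injective_iff_surjective.1 hinj) ⟨z, hzK⟩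
    exact ⟨⟨y, hdom y y.2⟩, congr_arg Subtype.val hy⟩
  have hrange : ∀ c : ℝ, ‖T‖ < |c| →
      DenseRange fun x : B.domain => B x + (c * Complex.I) • (x : E) := by
    intro c hc
    have hc0 : c ≠ 0 := by
      rintro rfl
      simp only [abs_zero] at hc
      exact (norm_nonneg T).not_gt hc
    let L : B.domain →ₗ[ℂ] E := B.toFun + (c * Complex.I) • B.domain.subtype
    have hL : (fun x : B.domain => B x + (c * Complex.I) • (x : E)) = L := rfl
    rw [hL, DenseRange, ← LinearMap.coe_range, Submodule.dense_iff_topologicalClosure_eq_top,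
      Submodule.topologicalClosure_eq_top_iff, Submodule.eq_bot_iff]
    intro y hy
    have hy' : ∀ x : B.domain, inner ℂ (B x + (c * Complex.I) • (x : E)) y = 0 := fun x =>
      (Submodule.mem_orthogonal _ _).1 hy _ ⟨x, rfl⟩
    -- Let `y` be orthogonal to the range of `B + ic`. For `z = (A + ic) x` this gives `⟪z, y⟫ =
    -- -⟪Tx, y⟫`, while `|c| ‖x‖ ≤ ‖z‖`.
    have hest : ∀ z : B.domain, ‖inner ℂ (z : E) y‖ ≤ ‖T‖ / |c| * ‖(z : E)‖ * ‖y‖ := by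
      intro z
      obtain ⟨x, hx⟩ := hsolve c hc0 z
      have h1 : inner ℂ (z : E) y = - inner ℂ (T x) y := by
        rw [← hx, sub_add_eq_add_sub, inner_sub_left, hy' x, zero_sub]
      have h2 : |c| * ‖(x : E)‖ ≤ ‖(z : E)‖ := by
        have h := norm_sq_add_smul_of_symmetric hsA c x
        rw [hA, hx] at h
        refine abs_le_of_sq_le_sq' ?_ (norm_nonneg _) |>.2
        rw [h, mul_pow, sq_abs]
        nlinarith [sq_nonneg ‖B x - T x‖]
      have hcp : 0 < |c| := abs_pos.2 hc0
      rw [h1, norm_neg]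
      refine (norm_inner_le_norm _ _).trans ?_
      refine mul_le_mul_of_nonneg_right ?_ (norm_nonneg _)
      refine (T.le_opNorm _).trans ?_
      rw [div_mul_eq_mul_div, le_div_iff₀ hcp, mul_assoc]
      exact mul_le_mul_of_nonneg_left (by linarith) (norm_nonneg _)
    have hclosed : ∀ z : E, ‖inner ℂ z y‖ ≤ ‖T‖ / |c| * ‖z‖ * ‖y‖ := by
      intro z
      refine hd.induction (P := fun z => ‖inner ℂ z y‖ ≤ ‖T‖ / |c| * ‖z‖ * ‖y‖)
        (fun z hz => hest ⟨z, hz⟩) ?_ z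
      exact isClosed_le (by fun_prop) (by fun_prop)
    -- The estimate holds for all `z` by density. For `z = y` it forces `y = 0`, because `‖T‖ / |c|
    -- < 1`.
    have h := hclosed y
    rw [inner_self_eq_norm_sq_to_K] at h
    have hlt : ‖T‖ / |c| < 1 := (div_lt_one ((norm_nonneg T).trans_lt hc)).2 hc
    by_contra hne
    have hpos : 0 < ‖y‖ := norm_pos_iff.2 hne
    have h3 : ‖((‖y‖ : ℂ) ^ 2)‖ = ‖y‖ ^ 2 := by simp
    have h4 : ‖y‖ ^ 2 ≤ ‖T‖ / |c| * ‖y‖ * ‖y‖ := h3 ▸ h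
    nlinarith [mul_pos hpos hpos]
  have hpos : 0 < ‖T‖ + 1 := by positivity
  refine isEssentiallySelfAdjoint_of_dense_range hd hsB hpos.ne' (hrange _ ?_) (hrange _ ?_)
  · rw [abs_of_pos hpos]; linarith
  · rw [abs_neg, abs_of_pos hpos]; linarith

end SelfAdjointCriterion
end CalogeroMoser

end

noncomputable section
namespace CalogeroMoser
open MeasureTheory

/-! ### Cotangent identities in rank two -/

section Trigonometry

/-- The cotangent, as a quotient. -/
def cotan (x : ℝ) : ℝ := Real.cos x / Real.sin x

theorem cotan_neg (x : ℝ) : cotan (-x) = -cotan x := by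
  simp [cotan, div_neg]

theorem cotan_add {x y : ℝ} (hx : Real.sin x ≠ 0) (hy : Real.sin y ≠ 0)
    (hxy : Real.sin (x + y) ≠ 0) :
    cotan (x + y) * (cotan x + cotan y) = cotan x * cotan y - 1 := by
  unfold cotan
  rw [div_add_div _ _ hx hy, div_mul_div_comm, div_mul_div_comm, div_sub_one (mul_ne_zero hx hy),
    div_eq_div_iff (mul_ne_zero hxy (mul_ne_zero hx hy)) (mul_ne_zero hx hy), Real.sin_add,
    Real.cos_add]
  ring

/-- One step of the recursion `(γ₁, γ₀) ↦ (n γ₁ - γ₀, γ₁)` along which products of cotangents are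
summed; the integers `n`, `m` of the two directions are swapped. -/
def rotStep (d : (ℝ × ℝ) × (ℤ × ℤ)) : (ℝ × ℝ) × (ℤ × ℤ) :=
  ((d.2.1 * d.1.1 - d.1.2, d.1.1), (d.2.2, d.2.1))

/-- The product of the cotangents of the two angles. -/
def cotProd (d : (ℝ × ℝ) × (ℤ × ℤ)) : ℝ := cotan d.1.1 * cotan d.1.2


/-- A product of two cotangents does not change when both angles change sign, so the products repeat
with period `q` once `q` steps amount to `-1`. The number 12 is a common multiple of the values of
`q` that occur: 3, 4 and 6. -/
theorem sum_cotProd_rotStep_of_neg {q r : ℕ} (hqr : 12 = q * r) {x y : ℝ} {n m : ℤ}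
    (h : rotStep^[q] ((x, y), (n, m)) = ((-x, -y), (n, m))) :
    ∑ l ∈ Finset.range 12, cotProd (rotStep^[l] ((x, y), (n, m))) =
      r * ∑ l ∈ Finset.range q, cotProd (rotStep^[l] ((x, y), (n, m))) := by
  let neg : (ℝ × ℝ) × (ℤ × ℤ) → (ℝ × ℝ) × (ℤ × ℤ) := fun d => (-d.1, d.2)
  have hneg : ∀ (l : ℕ) d, rotStep^[l] (neg d) = neg (rotStep^[l] d) := by
    intro l d
    refine (Function.Semiconj.iterate_right (f := neg) (fun d => ?_) l d).symm
    ext <;> simp [neg, rotStep]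
    ring
  have hprod : ∀ d, cotProd (neg d) = cotProd d := by
    intro d
    simp [cotProd, neg, cotan_neg]
  have hper : ∀ l, cotProd (rotStep^[l + q] ((x, y), (n, m))) =
      cotProd (rotStep^[l] ((x, y), (n, m))) := by
    intro l
    have hn : ((-x, -y), (n, m)) = neg ((x, y), (n, m)) := rfl
    rw [Function.iterate_add_apply, h, hn, hneg, hprod]
  have hper' : ∀ j l, cotProd (rotStep^[q * j + l] ((x, y), (n, m))) =
      cotProd (rotStep^[l] ((x, y), (n, m))) := by
    intro j
    induction j with
    | zero => intro l; simp
    | succ j ih =>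
      intro l
      have e : q * (j + 1) + l = q * j + l + q := by ring
      rw [e, hper, ih]
  rw [hqr]
  clear hqr
  induction r with
  | zero => simp
  | succ r ih =>
    rw [Nat.mul_succ, Finset.sum_range_add, ih]
    simp only [hper']
    push_cast
    ring

/-- The pairs are the Cartan integers of two roots at an acute angle in `A₂`, `B₂` and `G₂`, for
which 3, 4 and 6 steps amount to `-1`. Over these steps the products telescope through 1, 2 and 4
applications of `cotan_add`, each leaving `-1`. With the multiplicities 4, 3 and 2 this gives the
constants `-4`, `-6` and `-8`. -/
theorem sum_cotProd_rotStep_of_pos {n m : ℤ}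
    (hnm : (n, m) ∈ ({(1, 1), (1, 2), (2, 1), (1, 3), (3, 1)} : Set (ℤ × ℤ))) :
    ∃ K : ℝ, ∀ x y : ℝ,
      (∀ l : ℕ, Real.sin (rotStep^[l] ((x, y), (n, m))).1.1 ≠ 0) →
      ∑ l ∈ Finset.range 12, cotProd (rotStep^[l] ((x, y), (n, m))) = K := by
  simp only [Set.mem_insert_iff, Set.mem_singleton_iff, Prod.mk.injEq] at hnm
  obtain ⟨rfl, rfl⟩ | ⟨rfl, rfl⟩ | ⟨rfl, rfl⟩ | ⟨rfl, rfl⟩ | ⟨rfl, rfl⟩ := hnm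
  · refine ⟨-4, fun x y h => ?_⟩
    rw [sum_cotProd_rotStep_of_neg (q := 3) (r := 4) rfl (by ext <;> simp [rotStep]; ring)]
    have h0 := h 0
    have h1 := h 1
    have h2 := h 2
    simp only [Finset.sum_range_succ, Function.iterate_succ, Function.iterate_zero, id,
      Function.comp_apply, rotStep, cotProd, Finset.range_zero, Finset.sum_empty, Int.cast_one,
      one_mul, zero_add] at h0 h1 h2 ⊢
    have e0 : x - y - x = -y := by ring
    simp only [e0, Real.sin_neg, neg_ne_zero, cotan_neg] at h0 h1 h2 ⊢
    have t0 := cotan_add (x := x - y) (y := y) h1 h2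
      (by rw [show x - y + y = x by ring]; exact h0)
    rw [show x - y + y = x by ring] at t0
    push_cast
    linarith
  · refine ⟨-6, fun x y h => ?_⟩
    rw [sum_cotProd_rotStep_of_neg (q := 4) (r := 3) rfl (by ext <;> simp [rotStep] <;> ring)]
    have h0 := h 0
    have h1 := h 1
    have h2 := h 2
    have h3 := h 3
    simp only [Finset.sum_range_succ, Function.iterate_succ, Function.iterate_zero, id,
      Function.comp_apply, rotStep, cotProd, Finset.range_zero, Finset.sum_empty, Int.cast_one,
      Int.cast_ofNat, one_mul, zero_add] at h0 h1 h2 h3 ⊢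
    have e0 : 2 * (x - y) - x = x - 2 * y := by ring
    have e1 : x - 2 * y - (x - y) = -y := by ring
    simp only [e0, e1, Real.sin_neg, neg_ne_zero, cotan_neg] at h0 h1 h2 h3 ⊢
    have t0 := cotan_add (x := x - y) (y := y) h1 h3
      (by rw [show x - y + y = x by ring]; exact h0)
    rw [show x - y + y = x by ring] at t0
    have t1 := cotan_add (x := x - 2 * y) (y := y) h2 h3
      (by rw [show x - 2 * y + y = x - y by ring]; exact h1)
    rw [show x - 2 * y + y = x - y by ring] at t1
    push_cast
    linarith
  · refine ⟨-6, fun x y h => ?_⟩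
    rw [sum_cotProd_rotStep_of_neg (q := 4) (r := 3) rfl (by ext <;> simp [rotStep] <;> ring)]
    have h0 := h 0
    have h1 := h 1
    have h2 := h 2
    have h3 := h 3
    simp only [Finset.sum_range_succ, Function.iterate_succ, Function.iterate_zero, id,
      Function.comp_apply, rotStep, cotProd, Finset.range_zero, Finset.sum_empty, Int.cast_one,
      Int.cast_ofNat, one_mul, zero_add] at h0 h1 h2 h3 ⊢
    have e0 : 2 * x - y - x = x - y := by ring
    have e1 : 2 * (x - y) - (2 * x - y) = -y := by ring
    simp only [e0, e1, Real.sin_neg, neg_ne_zero, cotan_neg] at h0 h1 h2 h3 ⊢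
    have t0 := cotan_add (x := x) (y := (x - y)) h0 h2
      (by rw [show x + (x - y) = 2 * x - y by ring]; exact h1)
    rw [show x + (x - y) = 2 * x - y by ring] at t0
    have t1 := cotan_add (x := x - y) (y := y) h2 h3
      (by rw [show x - y + y = x by ring]; exact h0)
    rw [show x - y + y = x by ring] at t1
    push_cast
    linarith
  · refine ⟨-8, fun x y h => ?_⟩
    rw [sum_cotProd_rotStep_of_neg (q := 6) (r := 2) rfl (by ext <;> simp [rotStep] <;> ring)]
    have h0 := h 0
    have h1 := h 1
    have h2 := h 2
    have h3 := h 3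
    have h4 := h 4
    have h5 := h 5
    simp only [Finset.sum_range_succ, Function.iterate_succ, Function.iterate_zero, id,
      Function.comp_apply, rotStep, cotProd, Finset.range_zero, Finset.sum_empty, Int.cast_one,
      Int.cast_ofNat, one_mul, zero_add] at h0 h1 h2 h3 h4 h5 ⊢
    have e0 : 3 * (x - y) - x = 2 * x - 3 * y := by ring
    have e1 : 2 * x - 3 * y - (x - y) = x - 2 * y := by ring
    have e2 : 3 * (x - 2 * y) - (2 * x - 3 * y) = x - 3 * y := by ring
    have e3 : x - 3 * y - (x - 2 * y) = -y := by ring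
    simp only [e0, e1, e2, e3, Real.sin_neg, neg_ne_zero, cotan_neg] at h0 h1 h2 h3 h4 h5 ⊢
    have t0 := cotan_add (x := x - y) (y := y) h1 h5
      (by rw [show x - y + y = x by ring]; exact h0)
    rw [show x - y + y = x by ring] at t0
    have t1 := cotan_add (x := x - y) (y := (x - 2 * y)) h1 h3
      (by rw [show x - y + (x - 2 * y) = 2 * x - 3 * y by ring]; exact h2)
    rw [show x - y + (x - 2 * y) = 2 * x - 3 * y by ring] at t1
    have t2 := cotan_add (x := x - 3 * y) (y := y) h4 h5
      (by rw [show x - 3 * y + y = x - 2 * y by ring]; exact h3)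
    rw [show x - 3 * y + y = x - 2 * y by ring] at t2
    have t3 := cotan_add (x := x - 2 * y) (y := y) h3 h5
      (by rw [show x - 2 * y + y = x - y by ring]; exact h1)
    rw [show x - 2 * y + y = x - y by ring] at t3
    push_cast
    linarith
  · refine ⟨-8, fun x y h => ?_⟩
    rw [sum_cotProd_rotStep_of_neg (q := 6) (r := 2) rfl (by ext <;> simp [rotStep] <;> ring)]
    have h0 := h 0
    have h1 := h 1
    have h2 := h 2
    have h3 := h 3
    have h4 := h 4
    have h5 := h 5
    simp only [Finset.sum_range_succ, Function.iterate_succ, Function.iterate_zero, id,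
      Function.comp_apply, rotStep, cotProd, Finset.range_zero, Finset.sum_empty, Int.cast_one,
      Int.cast_ofNat, one_mul, zero_add] at h0 h1 h2 h3 h4 h5 ⊢
    have e0 : 3 * x - y - x = 2 * x - y := by ring
    have e1 : 3 * (2 * x - y) - (3 * x - y) = 3 * x - 2 * y := by ring
    have e2 : 3 * x - 2 * y - (2 * x - y) = x - y := by ring
    have e3 : 3 * (x - y) - (3 * x - 2 * y) = -y := by ring
    simp only [e0, e1, e2, e3, Real.sin_neg, neg_ne_zero, cotan_neg] at h0 h1 h2 h3 h4 h5 ⊢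
    have t0 := cotan_add (x := 2 * x - y) (y := x) h2 h0
      (by rw [show 2 * x - y + x = 3 * x - y by ring]; exact h1)
    rw [show 2 * x - y + x = 3 * x - y by ring] at t0
    have t1 := cotan_add (x := 2 * x - y) (y := (x - y)) h2 h4
      (by rw [show 2 * x - y + (x - y) = 3 * x - 2 * y by ring]; exact h3)
    rw [show 2 * x - y + (x - y) = 3 * x - 2 * y by ring] at t1
    have t2 := cotan_add (x := x - y) (y := y) h4 h5
      (by rw [show x - y + y = x by ring]; exact h0)
    rw [show x - y + y = x by ring] at t2
    have t3 := cotan_add (x := x - y) (y := x) h4 h0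
      (by rw [show x - y + x = 2 * x - y by ring]; exact h2)
    rw [show x - y + x = 2 * x - y by ring] at t3
    push_cast
    linarith

end Trigonometry

/-! ### The Weierstrass function on the real line -/

section WeierstrassBounds

/-- For `0 < y ≤ π/2` one has `sin y ≥ y/2` and `y² - sin² y ≤ y⁴`, so the difference is at most `y⁴
/ ((y²/4) y²) = 4`. At `y = 0` both quotients are zero by convention. -/
theorem exists_bound_inv_sin_sq_sub_inv_sq :
    ∃ C : ℝ, ∀ y : ℝ, |y| ≤ Real.pi / 2 → |1 / Real.sin y ^ 2 - 1 / y ^ 2| ≤ C := by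
  have key : ∀ y : ℝ, 0 < y → y ≤ Real.pi / 2 → |1 / Real.sin y ^ 2 - 1 / y ^ 2| ≤ 4 := by
    intro y hy hy2
    have hpi := Real.pi_lt_four
    have hs : 2 / Real.pi * y ≤ Real.sin y := Real.mul_le_sin hy.le hy2
    have hs2 : y / 2 ≤ Real.sin y := by
      refine le_trans ?_ hs
      have : 1 / 2 ≤ 2 / Real.pi := by
        rw [div_le_div_iff₀ two_pos Real.pi_pos]; linarith
      nlinarith
    have hsp : 0 < Real.sin y := by linarith
    have hle : Real.sin y ≤ y := Real.sin_le hy.le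
    have hd : y ^ 2 - Real.sin y ^ 2 ≤ y ^ 4 := by
      nlinarith [Real.sin_gt_sub_cube hy, pow_pos hy 3]
    have hden : y ^ 2 / 4 ≤ Real.sin y ^ 2 := by nlinarith
    rw [abs_of_nonneg, div_sub_div _ _ (by positivity) (by positivity), div_le_iff₀ (by positivity)]
    · nlinarith [mul_le_mul_of_nonneg_right hden (sq_nonneg y)]
    · rw [sub_nonneg]
      exact one_div_le_one_div_of_le (by positivity) (pow_le_pow_left₀ hsp.le hle 2)
  refine ⟨4, fun y hy => ?_⟩
  rcases lt_trichotomy y 0 with h | rfl | h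
  · have := key (-y) (by linarith) (by linarith [neg_abs_le y])
    simpa using this
  · simp
  · exact key y h (by linarith [le_abs_self y])

theorem exists_lattice_sub_mem_Icc (x : ℝ) :
    ∃ n : ℤ, x + n * (2 * Real.pi) ∈ Set.Icc (-Real.pi) Real.pi := by
  have hpi : 0 < 2 * Real.pi := by positivity
  refine ⟨-toIcoDiv hpi (-Real.pi) x, ?_⟩
  have h := sub_toIcoDiv_zsmul_mem_Ico hpi (-Real.pi) x
  rw [zsmul_eq_mul] at h
  push_cast
  constructor <;> [linarith [h.1]; linarith [h.2]]

theorem real_mem_lattice {p : ℝ} (h0 : p ≠ 0) (h1 : |p| < 1) {x : ℝ}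
    (hx : (x : ℂ) ∈ (periods p h0 h1).lattice) : ∃ n : ℤ, x = n * (2 * Real.pi) := by
  obtain ⟨m, n, h⟩ := PeriodPair.mem_lattice.1 hx
  have him := congr_arg Complex.im h
  have ht := tau_im_pos h0 h1
  simp only [periods, Complex.ofReal_im] at him
  have e : (m * (2 * Real.pi) + n * (2 * Real.pi * tau p) : ℂ) =
    ((m * (2 * Real.pi) : ℝ) : ℂ) + ((n * (2 * Real.pi) : ℝ) : ℂ) * tau p := by push_cast; ring
  rw [e, Complex.add_im, Complex.ofReal_im, Complex.im_ofReal_mul, zero_add] at him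
  have hn : (n : ℝ) = 0 := by
    have := (mul_eq_zero.1 him).resolve_right ht.ne'
    exact (mul_eq_zero.1 this).resolve_right (by positivity)
  refine ⟨m, ?_⟩
  have hre : ((m * (2 * Real.pi) : ℝ) : ℂ) = x := by
    rw [← h]; simp [periods, Int.cast_eq_zero.1 hn]
  exact_mod_cast hre.symm

/-- Removing `1/x²` from `℘` leaves `weierstrassPExcept 0`, which is continuous on `[-π, π]` because
`0` is the only lattice point there. Then `1/x²` is compared with `1/(4 sin² (x/2))`, and
periodicity does the rest. As division by zero gives zero, the bound includes the poles. -/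
theorem exists_bound_wp_sub (p : Set.Ioo (-1 : ℝ) 1) :
    ∃ C : ℝ, ∀ x : ℝ, ‖wp p x - ((1 / (4 * Real.sin (x / 2) ^ 2) : ℝ) : ℂ)‖ ≤ C := by
  by_cases h0 : (p : ℝ) = 0
  · refine ⟨1 / 12, fun x => ?_⟩
    rw [wp, dif_pos h0, ← Complex.ofReal_sub]
    simp
  · let L := periods p h0 (abs_lt.2 p.2)
    have hc : ContinuousOn (fun x : ℝ => L.weierstrassPExcept 0 x) (Set.Icc (-Real.pi) Real.pi) := by
      refine (L.differentiableOn_weierstrassPExcept 0).continuousOn.comp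
        Complex.continuous_ofReal.continuousOn ?_
      intro x hx hmem
      obtain ⟨n, rfl⟩ := real_mem_lattice h0 (abs_lt.2 p.2) hmem.1
      apply hmem.2
      have hpi := Real.pi_pos
      have h1 : (-1 : ℝ) < n := by by_contra h; push Not at h; nlinarith [hx.1]
      have h2 : (n : ℝ) < 1 := by by_contra h; push Not at h; nlinarith [hx.2]
      have h1' : -1 < n := by exact_mod_cast h1
      have h2' : n < 1 := by exact_mod_cast h2
      have : n = 0 := by omega
      simp [this]
    obtain ⟨C, hC⟩ := isCompact_Icc.exists_bound_of_continuousOn hc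
    obtain ⟨C', hC'⟩ := exists_bound_inv_sin_sq_sub_inv_sq
    refine ⟨C + C' / 4, fun x => ?_⟩
    obtain ⟨n, hn⟩ := exists_lattice_sub_mem_Icc x
    have hs : Real.sin ((x + n * (2 * Real.pi)) / 2) ^ 2 = Real.sin (x / 2) ^ 2 := by
      have h : (x + n * (2 * Real.pi)) / 2 = x / 2 + n * Real.pi := by ring
      rw [h, Real.sin_add_int_mul_pi, mul_pow, ← zpow_natCast, ← zpow_mul, mul_comm n, zpow_mul]
      norm_num
    rw [← wp_add p x n, ← hs]
    set y := x + n * (2 * Real.pi)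
    have h1 : wp p y = L.weierstrassPExcept 0 y + 1 / (y : ℂ) ^ 2 := by
      rw [wp, dif_neg h0]
      have := L.weierstrassPExcept_def 0 (y : ℂ)
      simp only [ZeroMemClass.coe_zero, sub_zero] at this
      rw [this]
      simp [L]
    have h2 : wp p y - ((1 / (4 * Real.sin (y / 2) ^ 2) : ℝ) : ℂ) = L.weierstrassPExcept 0 y -
        ((1 / 4 * (1 / Real.sin (y / 2) ^ 2 - 1 / (y / 2) ^ 2) : ℝ) : ℂ) := by
      rw [h1]
      push_cast
      have : (4 : ℂ) ≠ 0 := by norm_num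
      rw [div_pow, mul_sub]
      ring_nf
      try field_simp
    rw [h2]
    refine (norm_sub_le _ _).trans (add_le_add (hC y hn) ?_)
    rw [Complex.norm_real, Real.norm_eq_abs, abs_mul]
    have := hC' (y / 2) (by rw [abs_div, abs_two]; exact div_le_div_of_nonneg_right (abs_le.2 hn) two_pos.le)
    rw [abs_of_pos (by norm_num : (0 : ℝ) < 1 / 4)]
    linarith

theorem exists_bound_wp_mul_sin_sq (p : Set.Ioo (-1 : ℝ) 1) :
    ∃ C : ℝ, ∀ x : ℝ, ‖wp p x‖ * Real.sin (x / 2) ^ 2 ≤ C := by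
  obtain ⟨C, hC⟩ := exists_bound_wp_sub p
  refine ⟨C + 1 / 4, fun x => ?_⟩
  have hs : Real.sin (x / 2) ^ 2 ≤ 1 := Real.sin_sq_le_one _
  have h0 : 0 ≤ C := (norm_nonneg _).trans (hC x)
  have h1 : ‖wp p x‖ ≤ C + 1 / (4 * Real.sin (x / 2) ^ 2) := by
    have := norm_le_norm_sub_add (wp p x) ((1 / (4 * Real.sin (x / 2) ^ 2) : ℝ) : ℂ)
    refine this.trans (add_le_add (hC x) ?_)
    rw [Complex.norm_real, Real.norm_eq_abs, abs_of_nonneg (by positivity)]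
  refine (mul_le_mul_of_nonneg_right h1 (sq_nonneg _)).trans ?_
  rw [add_mul]
  refine add_le_add ?_ ?_
  · nlinarith [sq_nonneg (Real.sin (x / 2))]
  · rcases eq_or_ne (Real.sin (x / 2)) 0 with h | h
    · simp [h]
    · field_simp; exact le_refl _

/-- Since `p` is real, the conjugate of `τ` is `a - τ`, with `a = 0` for `p > 0` and `a = 1` for `p
< 0`. -/
theorem conj_mem_lattice {p : ℝ} (h0 : p ≠ 0) (h1 : |p| < 1) {z : ℂ}
    (hz : z ∈ (periods p h0 h1).lattice) : star z ∈ (periods p h0 h1).lattice := by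
  obtain ⟨m, n, rfl⟩ := PeriodPair.mem_lattice.1 hz
  have harg : ∃ a : ℤ, Complex.arg (p : ℂ) = a * Real.pi := by
    rcases lt_or_gt_of_ne h0 with h | h
    · exact ⟨1, by rw [Complex.arg_ofReal_of_neg h]; simp⟩
    · exact ⟨0, by rw [Complex.arg_ofReal_of_nonneg h.le]; simp⟩
  obtain ⟨a, ha⟩ := harg
  have hpi : (Real.pi : ℂ) ≠ 0 := by simp [Real.pi_ne_zero]
  have htau : star (tau p) = a - tau p := by
    have hlog : star (Complex.log p) = Complex.log p - 2 * (a * Real.pi) * Complex.I := by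
      apply Complex.ext
      · simp
      · simp [Complex.log_im, ha]; ring
    rw [tau, star_div₀, hlog]
    simp only [star_mul', Complex.star_def, Complex.conj_I, Complex.conj_ofReal, map_ofNat]
    field_simp
    simp
    try ring
  refine PeriodPair.mem_lattice.2 ⟨m + n * a, -n, ?_⟩
  have h2 : star (2 : ℂ) = 2 := map_ofNat (starRingEnd ℂ) 2
  have h3 : star (Real.pi : ℂ) = Real.pi := Complex.conj_ofReal _
  have h4 : ∀ n : ℤ, star (n : ℂ) = n := fun n => map_intCast (starRingEnd ℂ) n
  simp only [periods, star_add, star_mul', htau, h2, h3, h4]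
  push_cast
  ring

/-- Conjugation permutes the terms of the lattice sum. This reality is what makes multiplication by
`multiplier` a symmetric operator. -/
theorem star_wp (p : Set.Ioo (-1 : ℝ) 1) (x : ℝ) : star (wp p x) = wp p x := by
  by_cases h0 : (p : ℝ) = 0
  · rw [wp, dif_pos h0]
    exact Complex.conj_ofReal _
  · rw [wp, dif_neg h0]
    let L := periods p h0 (abs_lt.2 p.2)
    let e : L.lattice ≃ L.lattice :=
      { toFun l := ⟨star l.1, conj_mem_lattice h0 _ l.2⟩
        invFun l := ⟨star l.1, conj_mem_lattice h0 _ l.2⟩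
        left_inv l := Subtype.ext (star_star _)
        right_inv l := Subtype.ext (star_star _) }
    change star (∑' l : L.lattice, (1 / ((x : ℂ) - l) ^ 2 - 1 / (l : ℂ) ^ 2)) =
      ∑' l : L.lattice, (1 / ((x : ℂ) - l) ^ 2 - 1 / (l : ℂ) ^ 2)
    rw [tsum_star, ← e.tsum_eq]
    refine tsum_congr fun l => ?_
    simp [e]

theorem measurable_wp (p : Set.Ioo (-1 : ℝ) 1) : Measurable (wp p) := by
  by_cases h0 : (p : ℝ) = 0
  · have : wp p = fun x => ((1 / (4 * Real.sin (x / 2) ^ 2) - 1 / 12 : ℝ) : ℂ) :=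
      funext fun x => by rw [wp, dif_pos h0]
    rw [this]
    fun_prop
  · let L := periods p h0 (abs_lt.2 p.2)
    have : wp p = fun x : ℝ => L.weierstrassP x := funext fun x => by rw [wp, dif_neg h0]
    rw [this]
    have hm : Measurable L.weierstrassP := by
      classical
      -- The function is continuous off the closed lattice and takes the default value zero on it.
      have hpw : L.weierstrassP = (L.lattice : Set ℂ)ᶜ.piecewise L.weierstrassP fun _ => 0 := by
        funext z
        by_cases hz : z ∈ (L.lattice : Set ℂ)
        · rw [Set.piecewise_eq_of_notMem _ _ _ (Set.notMem_compl_iff.2 hz)]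
          exact L.weierstrassP_coe ⟨z, hz⟩
        · rw [Set.piecewise_eq_of_mem _ _ _ hz]
      rw [hpw]
      exact L.differentiableOn_weierstrassP.continuousOn.measurable_piecewise continuousOn_const
        L.isClosed_lattice.measurableSet.compl
    exact hm.comp Complex.measurable_ofReal

end WeierstrassBounds
end CalogeroMoser

end

noncomputable section
namespace CalogeroMoser
open MeasureTheory

/-! ### Topology, measurability and integration on the torus -/

section TorusAnalysis
variable {ι M V : Type*} [AddCommGroup M] [Module ℝ M]
  [NormedAddCommGroup V] [InnerProductSpace ℝ V]
  (R : RootPairing ι ℝ M V)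

/-- A function on `V` is periodic if it is invariant under the lattice `2πQ^∨`. -/
def IsPeriodic {X : Type*} (f : V → X) : Prop := ∀ x, ∀ l ∈ periodLattice R, f (x + l) = f x

variable {R}
variable [FiniteDimensional ℝ V] [Finite ι] [R.IsRootSystem]

theorem onTorus_comp_mk {f : V → ℂ} (hf : IsPeriodic R f) : onTorus R f ∘ Torus.mk R = f :=
  funext fun h => onTorus_mk R hf h

theorem isPeriodic_comp_mk {X : Type*} (g : Torus R → X) : IsPeriodic R fun h => g (Torus.mk R h) := by
  intro x l hl
  refine congr_arg g ?_
  rw [Torus.mk_eq_iff]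
  simpa using hl

theorem onTorus_comp_mk_apply (g : Torus R → ℂ) (t : Torus R) :
    onTorus R (fun h => g (Torus.mk R h)) t = g t :=
  congr_arg g (Torus.mk_rep R t)

theorem continuous_onTorus {f : V → ℂ} (hf : IsPeriodic R f) (hc : Continuous f) :
    Continuous (onTorus R f) := by
  rw [(Torus.isQuotientMap_mk R).continuous_iff, onTorus_comp_mk hf]
  exact hc

theorem weight_apply_mem_of_mem_periodLattice {w : M} (hw : w ∈ weightLattice R) {l : V}
    (hl : l ∈ periodLattice R) : ∃ n : ℤ, R.toLinearMap w l = n * (2 * Real.pi) := by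
  refine AddSubgroup.closure_induction ?_ ⟨0, by simp⟩ ?_ ?_ hl
  · rintro _ ⟨j, rfl⟩
    obtain ⟨n, hn⟩ := hw j
    refine ⟨n, ?_⟩
    have h : R.toLinearMap w (R.coroot j) = n := hn
    rw [map_smul, h, smul_eq_mul, mul_comm]
  · rintro a b _ _ ⟨m, hm⟩ ⟨n, hn⟩
    exact ⟨m + n, by rw [map_add, hm, hn]; push_cast; ring⟩
  · rintro a _ ⟨m, hm⟩
    exact ⟨-m, by rw [map_neg, hm]; push_cast; ring⟩

theorem root_mem_weightLattice [R.IsCrystallographic] (i : ι) : R.root i ∈ weightLattice R := by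
  intro j
  refine ⟨R.pairingIn ℤ i j, ?_⟩
  have := R.algebraMap_pairingIn ℤ i j
  rw [RootPairing.root_coroot'_eq_pairing, ← this]
  rfl

theorem root'_apply_mem_of_mem_periodLattice [R.IsCrystallographic] (i : ι) {l : V}
    (hl : l ∈ periodLattice R) : ∃ n : ℤ, R.root' i l = n * (2 * Real.pi) :=
  weight_apply_mem_of_mem_periodLattice (root_mem_weightLattice i) hl

theorem sin_sq_half_add_int (x : ℝ) (n : ℤ) :
    Real.sin ((x + n * (2 * Real.pi)) / 2) ^ 2 = Real.sin (x / 2) ^ 2 := by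
  have h : (x + n * (2 * Real.pi)) / 2 = x / 2 + n * Real.pi := by ring
  rw [h, Real.sin_add_int_mul_pi, mul_pow, ← zpow_natCast, ← zpow_mul, mul_comm n, zpow_mul]
  norm_num

section Closed
variable [R.IsCrystallographic]

theorem repr_coroot_int (b : R.Base) (i : b.support) (j : ι) :
    ∃ n : ℤ, b.toCoweightBasis.repr (R.coroot j) i = n := by
  have h := b.coroot_mem_span_int j
  refine Submodule.span_induction (p := fun x _ => ∃ n : ℤ, b.toCoweightBasis.repr x i = n)
    ?_ ⟨0, by simp⟩ ?_ ?_ h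
  · rintro _ ⟨k, hk, rfl⟩
    have := b.toCoweightBasis_repr_coroot ⟨k, hk⟩
    simp only at this
    rw [this]
    classical
    rw [Finsupp.single_apply]
    split_ifs
    · exact ⟨1, by simp⟩
    · exact ⟨0, by simp⟩
  · rintro x y _ _ ⟨m, hm⟩ ⟨n, hn⟩
    exact ⟨m + n, by rw [map_add, Finsupp.add_apply, hm, hn]; push_cast; rfl⟩
  · rintro a x _ ⟨m, hm⟩
    exact ⟨a * m, by rw [map_zsmul, Finsupp.smul_apply, hm]; simp⟩

/-- The fundamental weight of a simple root. -/
def fundamentalWeight (b : R.Base) (i : b.support) : M :=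
  R.toPerfPair.symm (b.toCoweightBasis.coord i)

theorem toLinearMap_fundamentalWeight (b : R.Base) (i : b.support) (v : V) :
    R.toLinearMap (fundamentalWeight b i) v = b.toCoweightBasis.repr v i := by
  have := LinearEquiv.apply_symm_apply R.toPerfPair (b.toCoweightBasis.coord i)
  exact LinearMap.congr_fun this v

theorem fundamentalWeight_mem (b : R.Base) (i : b.support) :
    fundamentalWeight b i ∈ weightLattice R := by
  intro j
  obtain ⟨n, hn⟩ := repr_coroot_int b i j
  exact ⟨n, (toLinearMap_fundamentalWeight b i _).trans hn⟩

/-- The fundamental weights are the coordinates with respect to the simple coroots, so the lattice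
is where they all lie in `2πℤ`. Written with cosines, this is a closed condition; it will also
separate the points of the torus. -/
theorem mem_periodLattice_iff (b : R.Base) (x : V) :
    x ∈ periodLattice R ↔
      ∀ i : b.support, Real.cos (R.toLinearMap (fundamentalWeight b i) x) = 1 := by
  constructor
  · intro hx i
    obtain ⟨n, hn⟩ := weight_apply_mem_of_mem_periodLattice (fundamentalWeight_mem b i) hx
    exact (Real.cos_eq_one_iff _).2 ⟨n, hn.symm⟩
  · intro h
    simp only [Real.cos_eq_one_iff, toLinearMap_fundamentalWeight] at h
    choose n hn using h
    rw [← b.toCoweightBasis.sum_repr x]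
    refine sum_mem fun i _ => ?_
    rw [← hn, b.toCoweightBasis_apply, mul_smul, Int.cast_smul_eq_zsmul]
    exact zsmul_mem (AddSubgroup.subset_closure (Set.mem_range_self _)) _

theorem isClosed_periodLattice (b : R.Base) : IsClosed (periodLattice R : Set V) := by
  have : (periodLattice R : Set V) =
      ⋂ i : b.support, {x | Real.cos (R.toLinearMap (fundamentalWeight b i) x) = 1} := by
    ext x
    simp only [SetLike.mem_coe, mem_periodLattice_iff b, Set.mem_iInter, Set.mem_ofPred_eq]
  rw [this]
  refine isClosed_iInter fun i => isClosed_eq ?_ continuous_const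
  exact Real.continuous_cos.comp (LinearMap.continuous_of_finiteDimensional _)

theorem t2Space_torus (b : R.Base) : T2Space (Torus R) := by
  have := isClosed_periodLattice b
  exact inferInstanceAs (T2Space (V ⧸ periodLattice R))

instance secondCountableTopology_torus : SecondCountableTopology (Torus R) :=
  inferInstanceAs (SecondCountableTopology (V ⧸ periodLattice R))

/-- The representatives `Torus.rep` are not chosen measurably. Instead, the torus is a Hausdorff
second countable continuous image of the Polish space `V`, so a set is Borel as soon as its preimage
in `V` is (`Continuous.map_borel_eq`). -/
theorem measurable_onTorus (b : R.Base) [MeasurableSpace V] [BorelSpace V] {f : V → ℂ}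
    (hf : IsPeriodic R f) (hm : Measurable f) : Measurable (onTorus R f) := by
  have := t2Space_torus b
  have hq := (Torus.isQuotientMap_mk R)
  have h := Continuous.map_borel_eq hq.continuous hq.surjective
  intro s hs
  have h2 : Measurable[borel V] f := by rwa [← BorelSpace.measurable_eq (α := V)]
  have h3 : MeasurableSet[borel V] (Torus.mk R ⁻¹' (onTorus R f ⁻¹' s)) := by
    rw [← Set.preimage_comp, onTorus_comp_mk hf]
    exact h2 hs
  change MeasurableSet[borel (Torus R)] _
  rw [← h]
  exact h3

end Closed

theorem exists_bound_of_continuous_periodic {f : V → ℂ} (hf : IsPeriodic R f) (hc : Continuous f) :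
    ∃ C : ℝ, 0 ≤ C ∧ ∀ x, ‖f x‖ ≤ C := by
  obtain ⟨C, hC⟩ := (isCompact_range (continuous_onTorus hf hc)).isBounded.exists_norm_le
  have hC' : ∀ x, ‖f x‖ ≤ C := fun x => by
    rw [← onTorus_mk R hf x]; exact hC _ ⟨_, rfl⟩
  exact ⟨C, (norm_nonneg _).trans (hC' 0), hC'⟩

theorem integrable_of_continuous_periodic {f : V → ℂ} (hf : IsPeriodic R f) (hc : Continuous f) :
    Integrable (onTorus R f) (haar R) :=
  (continuous_onTorus hf hc).integrable_of_hasCompactSupport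
    (HasCompactSupport.of_compactSpace _)

/-- The integral over `T` of a derivative vanishes. -/
theorem integral_lineDeriv_eq_zero {u D : V → ℂ} {v : V} (hu : IsPeriodic R u)
    (hD : IsPeriodic R D) (huc : Continuous u) (hDc : Continuous D)
    (h : ∀ x, HasLineDerivAt ℝ u (D x) x v) : ∫ t, onTorus R D t ∂haar R = 0 := by
  obtain ⟨C, -, hC⟩ := exists_bound_of_continuous_periodic hD hDc
  let F : ℝ → Torus R → ℂ := fun s t => onTorus R u (t + Torus.mk R (s • v))
  let F' : ℝ → Torus R → ℂ := fun s t => onTorus R D (t + Torus.mk R (s • v))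
  have hcF : ∀ s, Continuous (F s) := fun s =>
    (continuous_onTorus hu huc).comp (continuous_add_const _)
  have hcF' : ∀ s, Continuous (F' s) := fun s =>
    (continuous_onTorus hD hDc).comp (continuous_add_const _)
  -- Translation invariance makes the integral of `u (· + s v)` independent of `s`; differentiating
  -- under the integral sign at `s = 0` gives the integral of `D`.
  have hder := hasDerivAt_integral_of_dominated_loc_of_deriv_le (μ := haar R) (F := F) (F' := F')
    (x₀ := 0) (s := Set.univ) (bound := fun _ => C) Filter.univ_mem
    (Filter.Eventually.of_forall fun s => (hcF s).aestronglyMeasurable)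
    ((hcF 0).integrable_of_hasCompactSupport (HasCompactSupport.of_compactSpace _))
    (hcF' 0).aestronglyMeasurable
    (ae_of_all _ fun t s _ => hC _) (integrable_const C)
    (ae_of_all _ fun t s _ => by
      have hF : (fun s => F s t) = fun s : ℝ => u (Torus.rep R t + s • v) := by
        funext r
        simp only [F]
        nth_rewrite 1 [← Torus.mk_rep R t]
        rw [← map_add, onTorus_mk R hu]
      have hF' : F' s t = D (Torus.rep R t + s • v) := by
        simp only [F']
        nth_rewrite 1 [← Torus.mk_rep R t]
        rw [← map_add, onTorus_mk R hD]
      have h1 : HasDerivAt (fun r : ℝ => u (Torus.rep R t + s • v + r • v))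
        (D (Torus.rep R t + s • v)) 0 := h (Torus.rep R t + s • v)
      rw [hF, hF']
      have h2 : (fun s : ℝ => u (Torus.rep R t + s • v)) =
          fun r : ℝ => (fun r : ℝ => u (Torus.rep R t + s • v + r • v)) (r - s) := by
        funext r
        simp only [sub_smul]
        congr 1
        abel
      rw [h2]
      exact HasDerivAt.comp_sub_const (f := fun r : ℝ => u (Torus.rep R t + s • v + r • v)) s s
        (by rwa [sub_self]))
  have hconst : (fun s => ∫ t, F s t ∂haar R) = fun _ => ∫ t, onTorus R u t ∂haar R := by
    funext s
    exact integral_add_right_eq_self (onTorus R u) (Torus.mk R (s • v))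
  rw [hconst] at hder
  have h0 := hder.2.unique (hasDerivAt_const (0 : ℝ) _)
  simpa [F'] using h0

/-- Translating the wall by `α^∨ / (n + 1)` shifts `α` by `2 / (n + 1) ≤ 2 < 2π`, so these
translates are pairwise disjoint. Infinitely many disjoint sets of equal measure fit into a
probability space only if they are null. -/
theorem haar_sin_eq_zero [R.IsCrystallographic] (i : ι) :
    haar R {t | Real.sin (R.root' i (Torus.rep R t) / 2) = 0} = 0 := by
  set N := {t : Torus R | Real.sin (R.root' i (Torus.rep R t) / 2) = 0}
  let g : V → ℂ := fun h => ((Real.sin (R.root' i h / 2) ^ 2 : ℝ) : ℂ)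
  have hg : IsPeriodic R g := by
    intro x l hl
    obtain ⟨n, hn⟩ := root'_apply_mem_of_mem_periodLattice i hl
    simp only [g, map_add, hn, sin_sq_half_add_int]
  have hgc : Continuous g := by
    have : Continuous (R.root' i) := LinearMap.continuous_of_finiteDimensional _
    fun_prop
  have hN : N = {t | onTorus R g t = 0} := by
    ext t
    simp only [N, onTorus, g, Set.mem_ofPred_eq, Complex.ofReal_eq_zero, pow_eq_zero_iff two_ne_zero]
  have hNm : MeasurableSet N := by
    rw [hN]
    exact (isClosed_eq (continuous_onTorus hg hgc) continuous_const).measurableSet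
  have hmk : ∀ x, Torus.mk R x ∈ N ↔ ∃ n : ℤ, n * (2 * Real.pi) = R.root' i x := by
    intro x
    rw [hN, Set.mem_ofPred_eq, onTorus_mk R hg]
    simp only [g, Complex.ofReal_eq_zero, pow_eq_zero_iff two_ne_zero, Real.sin_eq_zero_iff]
    refine exists_congr fun n => ?_
    constructor <;> intro h <;> linarith
  let c : ℕ → Torus R := fun n => Torus.mk R ((1 / (n + 1 : ℝ)) • R.coroot i)
  let N' : ℕ → Set (Torus R) := fun n => (fun t => t + c n) ⁻¹' N
  have hN' : ∀ n, haar R (N' n) = haar R N := fun n => measure_preimage_add_right _ _ _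
  have hdisj : Pairwise (Function.onFun Disjoint N') := by
    intro m n hmn
    rw [Function.onFun, Set.disjoint_left]
    intro t hm hn
    obtain ⟨x, rfl⟩ := (Torus.isQuotientMap_mk R).surjective t
    simp only [N', c, Set.mem_preimage, ← map_add, hmk] at hm hn
    obtain ⟨a, ha⟩ := hm
    obtain ⟨a', ha'⟩ := hn
    simp only [map_add, map_smul, RootPairing.root'_coroot_eq_pairing, RootPairing.pairing_same,
      smul_eq_mul] at ha ha'
    have hm1 : 0 < 1 / (m + 1 : ℝ) ∧ 1 / (m + 1 : ℝ) ≤ 1 :=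
      ⟨by positivity, by rw [div_le_one (by positivity)]; linarith [m.cast_nonneg (α := ℝ)]⟩
    have hn1 : 0 < 1 / (n + 1 : ℝ) ∧ 1 / (n + 1 : ℝ) ≤ 1 :=
      ⟨by positivity, by rw [div_le_one (by positivity)]; linarith [n.cast_nonneg (α := ℝ)]⟩
    have hpi := Real.pi_gt_three
    have hd : (a - a' : ℝ) * (2 * Real.pi) = (1 / (m + 1 : ℝ) - 1 / (n + 1 : ℝ)) * 2 := by linarith
    have h1 : (a - a' : ℝ) < 1 := by by_contra hh; push Not at hh; nlinarith
    have h2 : (-1 : ℝ) < a - a' := by by_contra hh; push Not at hh; nlinarith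
    have h1' : a - a' < 1 := by exact_mod_cast h1
    have h2' : -1 < a - a' := by exact_mod_cast h2
    have h3 : a = a' := by omega
    rw [h3, sub_self, zero_mul] at hd
    have h4 : 1 / (m + 1 : ℝ) = 1 / (n + 1 : ℝ) := by linarith
    rw [one_div, one_div, inv_inj] at h4
    exact hmn (by exact_mod_cast add_right_cancel h4)
  have hsum : ∑' _ : ℕ, haar R N ≤ 1 := by
    calc ∑' _ : ℕ, haar R N = ∑' n, haar R (N' n) := by simp only [hN']
      _ = haar R (⋃ n, N' n) := (measure_iUnion hdisj fun n =>
          (measurable_add_const (c n)) hNm).symm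
      _ ≤ 1 := prob_le_one
  by_contra hne
  rw [ENNReal.tsum_const_eq_top_of_ne_zero hne] at hsum
  exact absurd hsum (by simp)

theorem ae_regular [R.IsCrystallographic] :
    ∀ᵐ t ∂haar R, ∀ i, Real.sin (R.root' i (Torus.rep R t) / 2) ≠ 0 :=
  ae_all_iff.2 fun i => by
    rw [ae_iff]
    simpa using haar_sin_eq_zero (R := R) i

end TorusAnalysis
end CalogeroMoser

end

noncomputable section
namespace CalogeroMoser
open MeasureTheory

/-! ### Cotangent identities for obtuse angles -/

section Trigonometry

/-- Negating one initial angle and both integers negates exactly one of the two angles at every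
step, alternately the second and the first. Every product of cotangents therefore changes sign,
which reduces negative Cartan integers to positive ones. -/
theorem cotProd_rotStep_flip (l : ℕ) (d : (ℝ × ℝ) × (ℤ × ℤ)) :
    (rotStep^[l] ((d.1.1, -d.1.2), -d.2) =
      (((rotStep^[l] d).1.1, -(rotStep^[l] d).1.2), -(rotStep^[l] d).2)) ∨
    (rotStep^[l] ((d.1.1, -d.1.2), -d.2) =
      ((-(rotStep^[l] d).1.1, (rotStep^[l] d).1.2), -(rotStep^[l] d).2)) := by
  induction l with
  | zero => left; rfl
  | succ l ih =>
    rw [Function.iterate_succ_apply', Function.iterate_succ_apply']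
    rcases ih with h | h
    · right
      rw [h]
      ext <;> simp [rotStep]
      ring
    · left
      rw [h]
      ext <;> simp [rotStep]

theorem sum_cotProd_rotStep {n m : ℤ}
    (hnm : (n, m) ∈ ({(1, 1), (1, 2), (2, 1), (1, 3), (3, 1)} : Set (ℤ × ℤ)) ∨
      (-n, -m) ∈ ({(1, 1), (1, 2), (2, 1), (1, 3), (3, 1)} : Set (ℤ × ℤ))) :
    ∃ K : ℝ, ∀ x y : ℝ,
      (∀ l : ℕ, Real.sin (rotStep^[l] ((x, y), (n, m))).1.1 ≠ 0) →
      ∑ l ∈ Finset.range 12, cotProd (rotStep^[l] ((x, y), (n, m))) = K := by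
  rcases hnm with h | h
  · exact sum_cotProd_rotStep_of_pos h
  · obtain ⟨K, hK⟩ := sum_cotProd_rotStep_of_pos h
    refine ⟨-K, fun x y hxy => ?_⟩
    have hf := fun l => cotProd_rotStep_flip l ((x, y), (n, m))
    rw [← hK x (-y) fun l => ?_, ← Finset.sum_neg_distrib]
    · refine Finset.sum_congr rfl fun l _ => ?_
      have e : (((x, -y), (-n, -m)) : (ℝ × ℝ) × (ℤ × ℤ)) = ((x, -y), -(n, m)) := rfl
      rw [e]
      rcases hf l with h | h <;> simp only at h <;> rw [h] <;> simp [cotProd, cotan_neg]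
    · have e : (((x, -y), (-n, -m)) : (ℝ × ℝ) × (ℤ × ℤ)) = ((x, -y), -(n, m)) := rfl
      rw [e]
      rcases hf l with h | h <;> simp only at h <;> rw [h] <;> simpa using hxy l

theorem mem_or_neg_mem_of_mem {m n : ℤ} (h : (m, n) ∈ ({(0, 0), (1, 1), (-1, -1), (1, 2), (2, 1),
      (-1, -2), (-2, -1), (1, 3), (3, 1), (-1, -3), (-3, -1)} : Set (ℤ × ℤ))) (h0 : m ≠ 0) :
    (n, m) ∈ ({(1, 1), (1, 2), (2, 1), (1, 3), (3, 1)} : Set (ℤ × ℤ)) ∨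
      (-n, -m) ∈ ({(1, 1), (1, 2), (2, 1), (1, 3), (3, 1)} : Set (ℤ × ℤ)) := by
  simp only [Set.mem_insert_iff, Set.mem_singleton_iff, Prod.mk.injEq] at h
  rcases h with ⟨rfl, rfl⟩ | ⟨rfl, rfl⟩ | ⟨rfl, rfl⟩ | ⟨rfl, rfl⟩ | ⟨rfl, rfl⟩ | ⟨rfl, rfl⟩ |
    ⟨rfl, rfl⟩ | ⟨rfl, rfl⟩ | ⟨rfl, rfl⟩ | ⟨rfl, rfl⟩ | ⟨rfl, rfl⟩ <;> simp at h0 ⊢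

end Trigonometry

/-! ### Roots as vectors, and their Gram matrix -/

section RootVectors
variable {ι M V : Type*} [AddCommGroup M] [Module ℝ M]
  [NormedAddCommGroup V] [InnerProductSpace ℝ V]
  (R : RootPairing ι ℝ M V)

/-- The vector representing a root through the inner product. -/
def rootVec (i : ι) : V := (2 / ‖R.coroot i‖ ^ 2) • R.coroot i

/-- The inner product of two roots. -/
def gram (i j : ι) : ℝ := inner ℝ (rootVec R i) (rootVec R j)

theorem gram_comm (i j : ι) : gram R i j = gram R j i := real_inner_comm _ _

theorem coroot_norm_sq_pos (i : ι) : 0 < ‖R.coroot i‖ ^ 2 := by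
  have := norm_pos_iff.2 (R.flip.ne_zero i)
  exact pow_pos this 2

theorem root_reflectionPerm_self (i : ι) : R.root (R.reflectionPerm i i) = -R.root i := by
  rw [R.root_reflectionPerm, R.reflection_apply_self]

theorem root'_reflectionPerm_self (i : ι) (h : V) :
    R.root' (R.reflectionPerm i i) h = -R.root' i h := by
  have : R.root (R.reflectionPerm i i) = -R.root i := root_reflectionPerm_self R i
  simp [RootPairing.root', this]

theorem root'_reflectionPerm_eq (i j : ι) (h : V) :
    R.root' (R.reflectionPerm i j) h = R.root' j h - R.pairing j i * R.root' i h := by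
  have : R.root (R.reflectionPerm i j) = R.root j - R.pairing j i • R.root i := by
    rw [R.root_reflectionPerm, R.reflection_apply_root]
  simp [RootPairing.root', this]

variable [IsWeylInvariantInner R]

theorem inner_coreflection_left (i : ι) (x y : V) :
    inner ℝ (R.coreflection i x) y = inner ℝ x (R.coreflection i y) := by
  rw [← IsWeylInvariantInner.inner_coreflection (R := R) i x, R.coreflection_same]

/-- An isometric involution is self-adjoint. Moving the reflection off its own coroot gives `-⟪α^∨,
x⟫ = ⟪α^∨, x⟫ - α(x) ‖α^∨‖²`, which is then solved for `α(x)`. -/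
theorem root'_eq_inner (i : ι) (x : V) : R.root' i x = inner ℝ (rootVec R i) x := by
  have h := inner_coreflection_left R i (R.coroot i) x
  rw [R.coreflection_apply_self, R.coreflection_apply, inner_neg_left, inner_sub_right,
    inner_smul_right, real_inner_self_eq_norm_sq] at h
  have hp := coroot_norm_sq_pos R i
  rw [rootVec, inner_smul_left]
  simp only [conj_trivial]
  rw [div_mul_eq_mul_div, eq_div_iff hp.ne']
  linarith

theorem rootVec_reflectionPerm (i j : ι) :
    rootVec R (R.reflectionPerm i j) = R.coreflection i (rootVec R j) := by
  refine ext_inner_right ℝ fun x => ?_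
  have h : R.root' (R.reflectionPerm i j) x = R.root' j (R.coreflection i x) :=
    LinearMap.congr_fun (R.flip.coroot'_reflectionPerm (i := i) (j := j)) x
  rw [← root'_eq_inner, h, root'_eq_inner, inner_coreflection_left]

theorem rootVec_reflectionPerm_self (i : ι) :
    rootVec R (R.reflectionPerm i i) = -rootVec R i := by
  refine ext_inner_right ℝ fun x => ?_
  rw [← root'_eq_inner, root'_reflectionPerm_self, root'_eq_inner, inner_neg_left]

theorem gram_eq_root' (i j : ι) : gram R i j = R.root' i (rootVec R j) :=
  (root'_eq_inner R i _).symm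

theorem gram_eq_pairing (i j : ι) : gram R i j = 2 / ‖R.coroot j‖ ^ 2 * R.pairing i j := by
  rw [gram_eq_root', rootVec, map_smul, RootPairing.root'_coroot_eq_pairing, smul_eq_mul]

theorem gram_reflectionPerm_left (i j : ι) : gram R (R.reflectionPerm i j) i = -gram R j i := by
  rw [gram, rootVec_reflectionPerm, inner_coreflection_left, ← rootVec_reflectionPerm,
    rootVec_reflectionPerm_self, inner_neg_right, gram]

theorem gram_neg_left (i j : ι) : gram R (R.reflectionPerm i i) j = -gram R i j := by
  rw [gram, rootVec_reflectionPerm_self, inner_neg_left, gram]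

theorem sum_root'_mul_root' {κ : Type*} [Fintype κ] (e : OrthonormalBasis κ ℝ V) (i j : ι) :
    ∑ v, R.root' i (e v) * R.root' j (e v) = gram R i j := by
  simp only [root'_eq_inner, gram]
  rw [← e.sum_inner_mul_inner]
  exact Finset.sum_congr rfl fun v _ => by rw [real_inner_comm (rootVec R j)]

theorem rootNormSq_eq_gram [FiniteDimensional ℝ V] [Finite ι] (i : ι) : rootNormSq R i = gram R i i := by
  have h : LinearMap.toContinuousLinearMap (R.root' i) = innerSL ℝ (rootVec R i) := by
    ext x
    exact root'_eq_inner R i x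
  rw [rootNormSq, h, innerSL_apply_norm, gram, real_inner_self_eq_norm_sq]

end RootVectors

/-! ### The double sum of cotangents over pairs of roots -/

section CotangentSum
variable {ι M V : Type*} [AddCommGroup M] [Module ℝ M]
  [NormedAddCommGroup V] [InnerProductSpace ℝ V]
  (R : RootPairing ι ℝ M V) [IsWeylInvariantInner R] [R.IsCrystallographic] [R.IsReduced]

/-- The permutation `(α, β) ↦ (-s_α β, α)` of the pairs of roots. -/
def rotPair (q : ι × ι) : ι × ι :=
  (R.reflectionPerm (R.reflectionPerm q.1 q.2) (R.reflectionPerm q.1 q.2), q.1)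

/-- The angles and Cartan integers of a pair of roots. -/
def rotData (h : V) (q : ι × ι) : (ℝ × ℝ) × (ℤ × ℤ) :=
  ((R.root' q.1 h / 2, R.root' q.2 h / 2), (R.pairingIn ℤ q.2 q.1, R.pairingIn ℤ q.1 q.2))

theorem rotPair_injective : Function.Injective (rotPair R) := by
  let := R.indexNeg
  rintro ⟨i, j⟩ ⟨i', j'⟩ h
  simp only [rotPair, Prod.mk.injEq] at h
  obtain ⟨h, rfl⟩ := h
  have h1 : -(R.reflectionPerm i j) = -(R.reflectionPerm i j') := h
  rw [neg_inj] at h1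
  rw [(R.reflectionPerm i).injective h1]

theorem rotData_rotPair (h : V) (q : ι × ι) :
    rotData R h (rotPair R q) = rotStep (rotData R h q) := by
  have hp : R.pairing q.2 q.1 = (R.pairingIn ℤ q.2 q.1 : ℝ) :=
    (R.algebraMap_pairingIn ℤ q.2 q.1).symm
  ext
  · simp only [rotData, rotPair, rotStep, root'_reflectionPerm_self, root'_reflectionPerm_eq, hp]
    ring
  · rfl
  · simp only [rotData, rotPair, rotStep]
    rw [R.pairingIn_reflectionPerm_self_right, R.pairingIn_reflectionPerm,
      R.pairingIn_reflectionPerm_self_left, neg_neg]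
  · simp only [rotData, rotPair, rotStep]
    rw [R.pairingIn_reflectionPerm_self_left, ← R.pairingIn_reflectionPerm,
      R.pairingIn_reflectionPerm_self_right, neg_neg]

theorem rotData_iterate (h : V) (q : ι × ι) (l : ℕ) :
    rotData R h ((rotPair R)^[l] q) = rotStep^[l] (rotData R h q) := by
  induction l with
  | zero => rfl
  | succ l ih => rw [Function.iterate_succ_apply', rotData_rotPair, ih, Function.iterate_succ_apply']

variable {R} {k : ι → ℝ} (hk : ∀ i j, k (R.reflectionPerm i j) = k j)

-- The reflection is an isometry and negates `α`, so `(-s_α β, α) = (β, α)`; the multiplicities are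
-- invariant by hypothesis.
include hk in
theorem weight_rotPair (q : ι × ι) :
    k (rotPair R q).1 * k (rotPair R q).2 * gram R (rotPair R q).1 (rotPair R q).2 =
      k q.1 * k q.2 * gram R q.1 q.2 := by
  simp only [rotPair, hk, gram_neg_left, gram_reflectionPerm_left, neg_neg]
  rw [gram_comm, mul_comm (k q.2)]

variable [Fintype ι]

-- `rotPair` permutes the pairs of roots and preserves their weights, so each of the 12 iterates
-- contributes the same total. Averaging replaces every single product by a sum along an orbit of
-- `rotStep`.
include hk in
theorem twelve_mul_sum_cotan (h : V) :
    12 * ∑ q : ι × ι, k q.1 * k q.2 * gram R q.1 q.2 *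
        (cotan (R.root' q.1 h / 2) * cotan (R.root' q.2 h / 2)) =
      ∑ q : ι × ι, k q.1 * k q.2 * gram R q.1 q.2 *
        ∑ l ∈ Finset.range 12, cotProd (rotStep^[l] (rotData R h q)) := by
  let F : ι × ι → ℝ := fun q => k q.1 * k q.2 * gram R q.1 q.2 * cotProd (rotData R h q)
  have hbij : Function.Bijective (rotPair R) :=
    (Finite.injective_iff_bijective).1 (rotPair_injective R)
  have hw : ∀ l q, k q.1 * k q.2 * gram R q.1 q.2 * cotProd (rotStep^[l] (rotData R h q)) =
      F ((rotPair R)^[l] q) := by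
    intro l q
    simp only [F, rotData_iterate]
    congr 1
    induction l with
    | zero => rfl
    | succ l ih => rw [Function.iterate_succ_apply', weight_rotPair hk, ih]
  have hsum : ∀ l, ∑ q, F ((rotPair R)^[l] q) = ∑ q, F q := fun l =>
    (hbij.iterate l).sum_comp F
  simp only [Finset.mul_sum, hw]
  rw [Finset.sum_comm]
  simp only [hsum, Finset.sum_const, Finset.card_range, nsmul_eq_mul, ← Finset.mul_sum]
  norm_num
  rfl

include hk in
/-- The sum over all pairs of roots of `k_α k_β ⟨α, β⟩ cot (α/2) cot (β/2)` is constant, up to the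
contribution of the pairs of proportional roots. -/
theorem exists_sum_cotan_eq :
    ∃ K : ℝ, ∀ h : V, (∀ i, Real.sin (R.root' i h / 2) ≠ 0) →
      ∑ q : ι × ι, k q.1 * k q.2 * gram R q.1 q.2 *
        (cotan (R.root' q.1 h / 2) * cotan (R.root' q.2 h / 2)) =
      K + ∑ i, 2 * k i ^ 2 * gram R i i / Real.sin (R.root' i h / 2) ^ 2 := by
  classical
  have key : ∀ q : ι × ι, ∃ K : ℝ, ∀ h : V, (∀ i, Real.sin (R.root' i h / 2) ≠ 0) →
      k q.1 * k q.2 * gram R q.1 q.2 *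
        ∑ l ∈ Finset.range 12, cotProd (rotStep^[l] (rotData R h q)) =
      K + if q.2 = q.1 ∨ q.2 = R.reflectionPerm q.1 q.1 then
        12 * (k q.1 ^ 2 * gram R q.1 q.1 / Real.sin (R.root' q.1 h / 2) ^ 2) else 0 := by
    rintro ⟨i, j⟩
    let := R.indexNeg
    have hnegneg : R.reflectionPerm (R.reflectionPerm i i) (R.reflectionPerm i i) = i := neg_neg i
    have hcot : ∀ h : V, Real.sin (R.root' i h / 2) ≠ 0 → cotan (R.root' i h / 2) ^ 2 =
        1 / Real.sin (R.root' i h / 2) ^ 2 - 1 := by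
      intro h hs
      rw [cotan, div_pow, Real.cos_sq']
      field_simp
    -- Proportional pairs: `(α, α)` is fixed by `rotPair`, and `(α, -α)` is exchanged with `(-α,
    -- α)`. The products are `±cot² = ±(1/sin² - 1)`, and the sign cancels against that of `gram`,
    -- so both kinds give the same constant and the same singular term.
    by_cases hij : j = i
    · subst hij
      refine ⟨-12 * (k j ^ 2 * gram R j j), fun h hreg => ?_⟩
      have hfix : rotPair R (j, j) = (j, j) := by
        simp only [rotPair, hnegneg]
      have : ∀ l, cotProd (rotStep^[l] (rotData R h (j, j))) = cotan (R.root' j h / 2) ^ 2 := by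
        intro l
        rw [← rotData_iterate, Function.iterate_fixed hfix, sq]
        rfl
      simp only [this, Finset.sum_const, Finset.card_range, nsmul_eq_mul, hcot h (hreg j), true_or,
        if_true]
      push_cast
      ring
    by_cases hij' : j = R.reflectionPerm i i
    · subst hij'
      refine ⟨-12 * (k i ^ 2 * gram R i i), fun h hreg => ?_⟩
      have hfix : rotPair R (i, R.reflectionPerm i i) = (R.reflectionPerm i i, i) := by
        simp only [rotPair, R.reflectionPerm_self]
      have hfix' : rotPair R (R.reflectionPerm i i, i) = (i, R.reflectionPerm i i) := by
        let ν := fun i => R.reflectionPerm i i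
        have h1 : R.reflectionPerm (ν i) i = ν i := by
          apply R.root.injective
          rw [R.root_reflectionPerm, R.reflection_apply_root, root_reflectionPerm_self R,
            R.pairing_reflectionPerm_self_right, R.pairing_same]
          module
        change (ν (R.reflectionPerm (ν i) i), ν i) = (i, ν i)
        rw [h1]
        exact Prod.ext hnegneg rfl
      have : ∀ l, cotProd (rotStep^[l] (rotData R h (i, R.reflectionPerm i i))) =
          -cotan (R.root' i h / 2) ^ 2 := by
        intro l
        rw [← rotData_iterate]
        have hor : (rotPair R)^[l] (i, R.reflectionPerm i i) = (i, R.reflectionPerm i i) ∨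
            (rotPair R)^[l] (i, R.reflectionPerm i i) = (R.reflectionPerm i i, i) := by
          induction l with
          | zero => left; rfl
          | succ l ih =>
            rw [Function.iterate_succ_apply']
            rcases ih with h | h <;> rw [h]
            · right; exact hfix
            · left; exact hfix'
        rcases hor with h | h <;> rw [h] <;>
          simp only [cotProd, rotData, root'_reflectionPerm_self, neg_div, cotan_neg] <;> ring
      have hg : gram R i (R.reflectionPerm i i) = -gram R i i := by
        rw [gram_comm, gram_neg_left]
      simp only [this, Finset.sum_const, Finset.card_range, nsmul_eq_mul, hcot h (hreg i), or_true,
        if_true, hk, hg]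
      push_cast
      ring
    · have hroot : R.root i ≠ -R.root j := by
        intro h
        apply hij'
        apply R.root.injective
        rw [root_reflectionPerm_self R, h, neg_neg]
      have hmem := R.pairingIn_pairingIn_mem_set_of_isCrystal_of_isRed' i j
        (fun h => hij (R.root.injective h.symm)) hroot
      have hreg' : ∀ h : V, (∀ i, Real.sin (R.root' i h / 2) ≠ 0) → ∀ l,
          Real.sin (rotStep^[l] (rotData R h (i, j))).1.1 ≠ 0 := by
        intro h hreg l
        rw [← rotData_iterate]
        exact hreg _
      simp only [hij, hij', or_self, if_false, add_zero]
      -- Orthogonal roots have weight zero. For the other pairs the sum along the orbit is constant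
      -- by the rank-two identities.
      by_cases h0 : R.pairingIn ℤ i j = 0
      · refine ⟨0, fun h _ => ?_⟩
        have : R.pairing i j = 0 := by rw [← R.algebraMap_pairingIn ℤ i j, h0, map_zero]
        rw [gram_eq_pairing, this]
        simp
      · obtain ⟨K, hK⟩ := sum_cotProd_rotStep (n := R.pairingIn ℤ j i) (m := R.pairingIn ℤ i j)
          (mem_or_neg_mem_of_mem hmem h0)
        refine ⟨k i * k j * gram R i j * K, fun h hreg => ?_⟩
        exact congr_arg (fun z => k i * k j * gram R i j * z)
          (hK (R.root' i h / 2) (R.root' j h / 2) (hreg' h hreg))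
  choose K hK using key
  refine ⟨(∑ q, K q) / 12, fun h hreg => ?_⟩
  have h12 := twelve_mul_sum_cotan hk h
  simp only [hK _ h hreg, Finset.sum_add_distrib] at h12
  have hprop : ∑ q : ι × ι, (if q.2 = q.1 ∨ q.2 = R.reflectionPerm q.1 q.1 then
        12 * (k q.1 ^ 2 * gram R q.1 q.1 / Real.sin (R.root' q.1 h / 2) ^ 2) else 0) =
      12 * ∑ i, 2 * k i ^ 2 * gram R i i / Real.sin (R.root' i h / 2) ^ 2 := by
    rw [Fintype.sum_prod_type, Finset.mul_sum]
    refine Finset.sum_congr rfl fun i _ => ?_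
    have hne : i ≠ R.reflectionPerm i i := by
      intro h
      have h1 := congr_arg (fun j => R.pairing j i) h
      simp only [R.pairing_reflectionPerm_self_left, R.pairing_same] at h1
      norm_num at h1
    rw [← Finset.sum_filter]
    have : (Finset.univ.filter fun j => j = i ∨ j = R.reflectionPerm i i) =
        {i, R.reflectionPerm i i} := by ext; simp
    simp only [this, Finset.sum_pair hne]
    ring
  rw [hprop] at h12
  linarith

end CotangentSum
end CalogeroMoser

end

noncomputable section
namespace CalogeroMoser
open MeasureTheory Laplacian

/-! ### Directional derivatives and the Laplacian -/

section LineDerivatives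
variable {V : Type*} [NormedAddCommGroup V] [InnerProductSpace ℝ V] {x v : V}

theorem hasLineDerivAt_mul {A : Type*} [NormedCommRing A] [NormedAlgebra ℝ A] {f g : V → A}
    {f' g' : A} (hf : HasLineDerivAt ℝ f f' x v) (hg : HasLineDerivAt ℝ g g' x v) :
    HasLineDerivAt ℝ (fun y => f y * g y) (f' * g x + f x * g') x v := by
  have h := HasDerivAt.mul hf hg
  simp only [zero_smul, add_zero] at h
  exact h

theorem hasLineDerivAt_sub {A : Type*} [NormedCommRing A] [NormedAlgebra ℝ A] {f g : V → A}
    {f' g' : A} (hf : HasLineDerivAt ℝ f f' x v) (hg : HasLineDerivAt ℝ g g' x v) :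
    HasLineDerivAt ℝ (fun y => f y - g y) (f' - g') x v := HasDerivAt.sub hf hg

theorem hasLineDerivAt_add {A : Type*} [NormedCommRing A] [NormedAlgebra ℝ A] {f g : V → A}
    {f' g' : A} (hf : HasLineDerivAt ℝ f f' x v) (hg : HasLineDerivAt ℝ g g' x v) :
    HasLineDerivAt ℝ (fun y => f y + g y) (f' + g') x v := HasDerivAt.add hf hg

theorem hasLineDerivAt_ofReal {f : V → ℝ} {f' : ℝ} (hf : HasLineDerivAt ℝ f f' x v) :
    HasLineDerivAt ℝ (fun y => (f y : ℂ)) (f' : ℂ) x v := HasDerivAt.ofReal_comp hf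

/-- The derivative of a product of functions, in terms of their logarithmic derivatives. -/
theorem hasLineDerivAt_prod {κ : Type*} (s : Finset κ) {f : κ → V → ℝ} {g : κ → ℝ}
    (h : ∀ i, HasLineDerivAt ℝ (f i) (f i x * g i) x v) :
    HasLineDerivAt ℝ (fun y => ∏ i ∈ s, f i y) ((∏ i ∈ s, f i x) * ∑ i ∈ s, g i) x v := by
  classical
  induction s using Finset.induction_on with
  | empty =>
    simp only [Finset.prod_empty, Finset.sum_empty, mul_zero]
    exact hasDerivAt_const (0 : ℝ) (1 : ℝ)
  | insert i s hi ih =>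
    simp only [Finset.prod_insert hi, Finset.sum_insert hi]
    exact HasDerivAt.congr_deriv (hasLineDerivAt_mul (h i) ih) (by ring)

theorem ContDiff.hasLineDerivAt_fderiv {f : V → ℂ} (hf : ContDiff ℝ 1 f) (x v : V) :
    HasLineDerivAt ℝ f (fderiv ℝ f x v) x v :=
  ((hf.differentiable one_ne_zero) x).hasFDerivAt.hasLineDerivAt v

theorem ContDiff.fderiv_apply_const {f : V → ℂ} (hf : ContDiff ℝ 2 f) (v : V) :
    ContDiff ℝ 1 fun x => fderiv ℝ f x v :=
  (hf.fderiv_right (m := 1) (by norm_num)).clm_apply contDiff_const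

/-- The second derivative in the direction `v`. -/
def secondDeriv (f : V → ℂ) (v x : V) : ℂ := fderiv ℝ (fun y => fderiv ℝ f y v) x v

theorem ContDiff.continuous_secondDeriv {f : V → ℂ} (hf : ContDiff ℝ 2 f) (v : V) :
    Continuous (secondDeriv f v) :=
  ((ContDiff.fderiv_apply_const hf v).continuous_fderiv one_ne_zero).clm_apply continuous_const

theorem laplacian_eq_sum_secondDeriv [FiniteDimensional ℝ V] {κ : Type*} [Fintype κ]
    (e : OrthonormalBasis κ ℝ V) {f : V → ℂ} (hf : ContDiff ℝ 2 f) (x : V) :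
    laplacian f x = ∑ v, secondDeriv f (e v) x := by
  rw [InnerProductSpace.laplacian_eq_iteratedFDeriv_orthonormalBasis _ e]
  refine Finset.sum_congr rfl fun v _ => ?_
  have hd : DifferentiableAt ℝ (fderiv ℝ f) x :=
    ((hf.fderiv_right (m := 1) (by norm_num)).differentiable one_ne_zero) x
  rw [iteratedFDeriv_two_apply, secondDeriv, fderiv_clm_apply hd (differentiableAt_const _)]
  simp

end LineDerivatives

/-! ### The regularized ground state and its logarithmic derivative -/

section RegularizedGroundState
variable {ι M V : Type*} [AddCommGroup M] [Module ℝ M]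
  [NormedAddCommGroup V] [InnerProductSpace ℝ V]
  (R : RootPairing ι ℝ M V) (k : ι → ℝ)

/-- The function `sin (⟨α, h⟩ / 2)`. -/
def sinRoot (i : ι) (h : V) : ℝ := Real.sin (R.root' i h / 2)

/-- The function `cos (⟨α, h⟩ / 2)`. -/
def cosRoot (i : ι) (h : V) : ℝ := Real.cos (R.root' i h / 2)

/-- The function `(sin² + ε) ^ (k / 4)`. -/
def sinPow (ε : ℝ) (i : ι) (h : V) : ℝ := (sinRoot R i h ^ 2 + ε) ^ (k i / 4)

/-- A regularization of the function `∏_α |sin (⟨α, h⟩ / 2)| ^ (k_α / 2)`, which is its value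
at `ε = 0`. -/
def phiReg [Fintype ι] (ε : ℝ) (h : V) : ℝ := ∏ i, sinPow R k ε i h

/-- A regularization of `cot (⟨α, h⟩ / 2)`. -/
def cotReg (ε : ℝ) (i : ι) (h : V) : ℝ := sinRoot R i h * cosRoot R i h / (sinRoot R i h ^ 2 + ε)

/-- The derivative of `cotReg` with respect to `⟨α, h⟩ / 2`. -/
def cotRegDeriv (ε : ℝ) (i : ι) (h : V) : ℝ :=
  ((cosRoot R i h ^ 2 - sinRoot R i h ^ 2) * (sinRoot R i h ^ 2 + ε) -
    2 * sinRoot R i h ^ 2 * cosRoot R i h ^ 2) / (sinRoot R i h ^ 2 + ε) ^ 2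

variable {R k}

theorem hasLineDerivAt_root' (i : ι) (h v : V) :
    HasDerivAt (fun t : ℝ => R.root' i (h + t • v) / 2) (R.root' i v / 2) 0 := by
  simp only [map_add, map_smul, smul_eq_mul]
  simpa using (((hasDerivAt_id (0 : ℝ)).mul_const (R.root' i v)).const_add (R.root' i h)).div_const 2

theorem hasLineDerivAt_sinRoot (i : ι) (h v : V) :
    HasLineDerivAt ℝ (sinRoot R i) (cosRoot R i h * (R.root' i v / 2)) h v := by
  have := (hasLineDerivAt_root' (R := R) i h v).sin
  simp only [zero_smul, add_zero] at this
  exact this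

theorem hasLineDerivAt_cosRoot (i : ι) (h v : V) :
    HasLineDerivAt ℝ (cosRoot R i) (-sinRoot R i h * (R.root' i v / 2)) h v := by
  have := (hasLineDerivAt_root' (R := R) i h v).cos
  simp only [zero_smul, add_zero] at this
  exact this

theorem sinRoot_sq_add_pos {ε : ℝ} (hε : 0 < ε) (i : ι) (h : V) : 0 < sinRoot R i h ^ 2 + ε := by
  positivity

theorem hasLineDerivAt_sinPow {ε : ℝ} (hε : 0 < ε) (i : ι) (h v : V) :
    HasLineDerivAt ℝ (sinPow R k ε i)
      (sinPow R k ε i h * (k i / 4 * R.root' i v * cotReg R ε i h)) h v := by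
  have hs : HasDerivAt (fun t : ℝ => sinRoot R i (h + t • v)) _ 0 := hasLineDerivAt_sinRoot i h v
  have hp := sinRoot_sq_add_pos (R := R) hε i h
  have h1 := ((hs.pow 2).add_const ε).rpow_const (p := k i / 4) (Or.inl (by
    simpa using hp.ne'))
  simp only [zero_smul, add_zero, Pi.pow_apply] at h1
  refine HasDerivAt.congr_deriv h1 ?_
  rw [sinPow, cotReg, Real.rpow_sub_one hp.ne']
  field_simp
  try ring

theorem hasLineDerivAt_cotReg {ε : ℝ} (hε : 0 < ε) (i : ι) (h v : V) :
    HasLineDerivAt ℝ (cotReg R ε i) (R.root' i v / 2 * cotRegDeriv R ε i h) h v := by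
  have hs : HasDerivAt (fun t : ℝ => sinRoot R i (h + t • v)) _ 0 := hasLineDerivAt_sinRoot i h v
  have hc : HasDerivAt (fun t : ℝ => cosRoot R i (h + t • v)) _ 0 := hasLineDerivAt_cosRoot i h v
  have hp := sinRoot_sq_add_pos (R := R) hε i h
  have h1 := (hs.mul hc).div ((hs.pow 2).add_const ε) (by simpa using hp.ne')
  simp only [zero_smul, add_zero, Pi.pow_apply, Pi.mul_apply] at h1
  refine HasDerivAt.congr_deriv h1 ?_
  rw [cotRegDeriv]
  field_simp
  try ring

theorem sinRoot_sq_le_one (i : ι) (h : V) : sinRoot R i h ^ 2 ≤ 1 := Real.sin_sq_le_one _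

theorem sinRoot_sq_add_cosRoot_sq (i : ι) (h : V) : sinRoot R i h ^ 2 + cosRoot R i h ^ 2 = 1 :=
  Real.sin_sq_add_cos_sq _

/-- Uniformity in `ε` is the point: together with `sinRoot_sq_mul_abs_cotRegDeriv_le` this supplies
the dominating functions for the limit `ε → 0`. -/
theorem abs_sinRoot_mul_cotReg_le {ε : ℝ} (hε : 0 ≤ ε) (i : ι) (h : V) :
    |sinRoot R i h * cotReg R ε i h| ≤ 1 := by
  have h1 : sinRoot R i h * cotReg R ε i h =
      cosRoot R i h * (sinRoot R i h ^ 2 / (sinRoot R i h ^ 2 + ε)) := by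
    rw [cotReg]; ring
  have h2 : sinRoot R i h ^ 2 / (sinRoot R i h ^ 2 + ε) ≤ 1 := div_le_one_of_le₀ (by linarith)
    (by positivity)
  rw [h1, abs_mul]
  refine mul_le_one₀ (Real.abs_cos_le_one _) (abs_nonneg _) ?_
  rwa [abs_of_nonneg (by positivity)]

theorem sinRoot_sq_mul_abs_cotRegDeriv_le {ε : ℝ} (hε : 0 < ε) (i : ι) (h : V) :
    sinRoot R i h ^ 2 * |cotRegDeriv R ε i h| ≤ 3 := by
  have hp := sinRoot_sq_add_pos (R := R) hε i h
  have hsc := sinRoot_sq_add_cosRoot_sq (R := R) i h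
  rw [cotRegDeriv, abs_div, abs_of_pos (pow_pos hp 2), ← mul_div_assoc,
    div_le_iff₀ (pow_pos hp 2)]
  set s := sinRoot R i h ^ 2
  set c := cosRoot R i h ^ 2
  have hs : 0 ≤ s := sq_nonneg _
  have hc : 0 ≤ c := sq_nonneg _
  have h1 : |(c - s) * (s + ε) - 2 * s * c| ≤ 3 * (s + ε) := by
    rw [abs_le]
    constructor <;> nlinarith [mul_nonneg hs hc, mul_nonneg hs hε.le, mul_nonneg hc hε.le]
  calc s * |(c - s) * (s + ε) - 2 * s * c| ≤ (s + ε) * (3 * (s + ε)) :=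
        mul_le_mul (by linarith) h1 (abs_nonneg _) hp.le
    _ = 3 * (s + ε) ^ 2 := by ring

theorem cotReg_zero {i : ι} {h : V} (hs : sinRoot R i h ≠ 0) :
    cotReg R 0 i h = cotan (R.root' i h / 2) := by
  have h1 : cotan (R.root' i h / 2) = cosRoot R i h / sinRoot R i h := rfl
  rw [cotReg, h1, add_zero, sq, mul_div_mul_left _ _ hs]

theorem cotRegDeriv_zero {i : ι} {h : V} (hs : sinRoot R i h ≠ 0) :
    cotRegDeriv R 0 i h = -1 / sinRoot R i h ^ 2 := by
  have h1 := sinRoot_sq_add_cosRoot_sq (R := R) i h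
  rw [cotRegDeriv]
  field_simp
  have h2 : cosRoot R i h ^ 2 = 1 - sinRoot R i h ^ 2 := by linarith
  rw [h2]
  ring

theorem tendsto_cotReg {i : ι} {h : V} (hs : sinRoot R i h ≠ 0) {l : Filter ℕ} {ε : ℕ → ℝ}
    (hε : Filter.Tendsto ε l (nhds 0)) :
    Filter.Tendsto (fun n => cotReg R (ε n) i h) l (nhds (cotReg R 0 i h)) :=
  tendsto_const_nhds.div (tendsto_const_nhds.add hε) (by simpa using hs)

theorem tendsto_cotRegDeriv {i : ι} {h : V} (hs : sinRoot R i h ≠ 0) {l : Filter ℕ} {ε : ℕ → ℝ}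
    (hε : Filter.Tendsto ε l (nhds 0)) :
    Filter.Tendsto (fun n => cotRegDeriv R (ε n) i h) l (nhds (cotRegDeriv R 0 i h)) := by
  have h1 := (tendsto_const_nhds (x := sinRoot R i h ^ 2)).add hε
  exact ((tendsto_const_nhds.mul h1).sub tendsto_const_nhds).div (h1.pow 2) (by simpa using hs)

variable [FiniteDimensional ℝ V]

theorem continuous_root' (i : ι) : Continuous (R.root' i) :=
  LinearMap.continuous_of_finiteDimensional _

theorem continuous_sinRoot (i : ι) : Continuous (sinRoot R i) :=
  Real.continuous_sin.comp ((continuous_root' i).div_const 2)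

theorem continuous_cosRoot (i : ι) : Continuous (cosRoot R i) :=
  Real.continuous_cos.comp ((continuous_root' i).div_const 2)

theorem continuous_cotReg {ε : ℝ} (hε : 0 < ε) (i : ι) : Continuous (cotReg R ε i) :=
  ((continuous_sinRoot i).mul (continuous_cosRoot i)).div
    (((continuous_sinRoot i).pow 2).add_const ε) fun h => (sinRoot_sq_add_pos hε i h).ne'

theorem continuous_cotRegDeriv {ε : ℝ} (hε : 0 < ε) (i : ι) : Continuous (cotRegDeriv R ε i) := by
  have hs := continuous_sinRoot (R := R) i
  have hc := continuous_cosRoot (R := R) i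
  refine Continuous.div (by fun_prop) (by fun_prop) fun h =>
    pow_ne_zero 2 (sinRoot_sq_add_pos hε i h).ne'

section Periodic
variable [R.IsCrystallographic] [Finite ι] [R.IsRootSystem]

theorem isPeriodic_sinRoot_sq (i : ι) : IsPeriodic R fun h => sinRoot R i h ^ 2 := by
  intro x l hl
  obtain ⟨n, hn⟩ := root'_apply_mem_of_mem_periodLattice i hl
  simp only [sinRoot, map_add, hn, sin_sq_half_add_int]

theorem isPeriodic_cosRoot_sq (i : ι) : IsPeriodic R fun h => cosRoot R i h ^ 2 := by
  intro x l hl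
  have h := isPeriodic_sinRoot_sq (R := R) i x l hl
  have h1 := sinRoot_sq_add_cosRoot_sq (R := R) i x
  have h2 := sinRoot_sq_add_cosRoot_sq (R := R) i (x + l)
  simp only at h ⊢
  linarith

theorem isPeriodic_sin_mul_cos (i : ι) :
    IsPeriodic R fun h => sinRoot R i h * cosRoot R i h := by
  intro x l hl
  obtain ⟨n, hn⟩ := root'_apply_mem_of_mem_periodLattice i hl
  have h : ∀ h, sinRoot R i h * cosRoot R i h = Real.sin (R.root' i h) / 2 := by
    intro h
    have := Real.sin_two_mul (R.root' i h / 2)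
    rw [mul_div_cancel₀ _ (two_ne_zero' ℝ)] at this
    rw [this, sinRoot, cosRoot]
    ring
  simp only [h, map_add, hn, Real.sin_add_int_mul_two_pi]

theorem isPeriodic_cotReg (ε : ℝ) (i : ι) : IsPeriodic R (cotReg R ε i) := by
  intro x l hl
  have h1 := isPeriodic_sinRoot_sq (R := R) i x l hl
  have h2 := isPeriodic_sin_mul_cos (R := R) i x l hl
  simp only at h1 h2
  simp only [cotReg, h1, h2]

theorem isPeriodic_cotRegDeriv (ε : ℝ) (i : ι) : IsPeriodic R (cotRegDeriv R ε i) := by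
  intro x l hl
  have h1 := isPeriodic_sinRoot_sq (R := R) i x l hl
  have h2 := isPeriodic_cosRoot_sq (R := R) i x l hl
  simp only at h1 h2
  simp only [cotRegDeriv, h1, h2]

end Periodic

variable [Fintype ι]

theorem isPeriodic_phiReg [R.IsCrystallographic] [R.IsRootSystem] (ε : ℝ) :
    IsPeriodic R (phiReg R k ε) := by
  intro x l hl
  refine Finset.prod_congr rfl fun i _ => ?_
  have h1 := isPeriodic_sinRoot_sq (R := R) i x l hl
  simp only at h1
  simp only [sinPow, h1]

theorem continuous_phiReg (hk0 : ∀ i, 0 ≤ k i) (ε : ℝ) : Continuous (phiReg R k ε) := by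
  refine continuous_finsetProd _ fun i _ => ?_
  have hs := continuous_sinRoot (R := R) i
  refine Continuous.rpow_const (by fun_prop) fun h => Or.inr ?_
  linarith [hk0 i]

theorem phiReg_nonneg {ε : ℝ} (hε : 0 ≤ ε) (h : V) : 0 ≤ phiReg R k ε h :=
  Finset.prod_nonneg fun i _ => Real.rpow_nonneg (by positivity) _

theorem phiReg_le (hk0 : ∀ i, 0 ≤ k i) {ε : ℝ} (hε : 0 ≤ ε) (hε1 : ε ≤ 1) (h : V) :
    phiReg R k ε h ≤ ∏ i, (2 : ℝ) ^ (k i / 4) :=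
  Finset.prod_le_prod (fun i _ => Real.rpow_nonneg (by positivity) _) fun i _ =>
    Real.rpow_le_rpow (by positivity) (by linarith [sinRoot_sq_le_one (R := R) i h])
      (by linarith [hk0 i])

theorem tendsto_phiReg (hk0 : ∀ i, 0 ≤ k i) (h : V) {l : Filter ℕ} {ε : ℕ → ℝ}
    (hε : Filter.Tendsto ε l (nhds 0)) :
    Filter.Tendsto (fun n => phiReg R k (ε n) h) l (nhds (phiReg R k 0 h)) := by
  refine tendsto_finsetProd _ fun i _ => ?_
  refine Filter.Tendsto.rpow_const (tendsto_const_nhds.add hε) (Or.inr ?_)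
  linarith [hk0 i]

/-- The logarithmic derivative of `phiReg` in the direction `v`. -/
def logDerivPhi (R : RootPairing ι ℝ M V) (k : ι → ℝ) (ε : ℝ) (v h : V) : ℝ :=
  ∑ i, k i / 4 * R.root' i v * cotReg R ε i h

theorem hasLineDerivAt_phiReg {ε : ℝ} (hε : 0 < ε) (h v : V) :
    HasLineDerivAt ℝ (phiReg R k ε) (phiReg R k ε h * logDerivPhi R k ε v h) h v :=
  hasLineDerivAt_prod Finset.univ fun i => hasLineDerivAt_sinPow hε i h v

theorem hasLineDerivAt_logDerivPhi {ε : ℝ} (hε : 0 < ε) (h v : V) :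
    HasLineDerivAt ℝ (logDerivPhi R k ε v)
      (∑ i, k i / 8 * (R.root' i v * R.root' i v) * cotRegDeriv R ε i h) h v := by
  have h1 : HasDerivAt (fun t : ℝ => ∑ i, k i / 4 * R.root' i v * cotReg R ε i (h + t • v))
      (∑ i, k i / 4 * R.root' i v * (R.root' i v / 2 * cotRegDeriv R ε i h)) 0 :=
    HasDerivAt.fun_sum fun i _ => HasDerivAt.const_mul _ (hasLineDerivAt_cotReg hε i h v)
  refine HasDerivAt.congr_deriv h1 (Finset.sum_congr rfl fun i _ => ?_)
  ring

end RegularizedGroundState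
end CalogeroMoser

end

noncomputable section
namespace CalogeroMoser
open MeasureTheory Laplacian

/-! ### Integration by parts with the regularized ground state -/

section Green
variable {ι M V : Type*} [AddCommGroup M] [Module ℝ M]
  [NormedAddCommGroup V] [InnerProductSpace ℝ V] [FiniteDimensional ℝ V]
  [Fintype ι] {R : RootPairing ι ℝ M V} {k : ι → ℝ}

variable (R k) in
/-- The first-order term of the Laplacian conjugated by `phiReg`. -/
def driftReg (ε : ℝ) (F : V → ℂ) (h : V) : ℂ :=
  ∑ i, ((k i / 4 * cotReg R ε i h : ℝ) : ℂ) * fderiv ℝ F h (rootVec R i)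

variable (R k) in
/-- The zeroth-order term of the Laplacian conjugated by `phiReg`. -/
def quadReg (ε : ℝ) (h : V) : ℝ :=
  1 / 16 * (∑ q : ι × ι, k q.1 * k q.2 * gram R q.1 q.2 * (cotReg R ε q.1 h * cotReg R ε q.2 h)) +
    ∑ i, k i / 8 * gram R i i * cotRegDeriv R ε i h

section Periodic
variable [R.IsRootSystem]

theorem IsPeriodic.fderiv_apply {f : V → ℂ} (hf : IsPeriodic R f) (v : V) :
    IsPeriodic R fun x => fderiv ℝ f x v := by
  intro x l hl
  have h : (fun y => f (y + l)) = f := funext fun y => hf y l hl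
  have h2 := fderiv_comp_add_right (𝕜 := ℝ) (f := f) (x := x) l
  rw [h] at h2
  exact congr_arg (fun L : V →L[ℝ] ℂ => L v) h2.symm

theorem IsPeriodic.secondDeriv {f : V → ℂ} (hf : IsPeriodic R f) (v : V) :
    IsPeriodic R (secondDeriv f v) := (hf.fderiv_apply v).fderiv_apply v

theorem IsPeriodic.laplacian {f : V → ℂ} (hf : IsPeriodic R f) : IsPeriodic R (laplacian f) := by
  intro x l hl
  rw [← laplacian_add_right]
  exact congr_fun (congr_arg _ (funext fun y => hf y l hl)) x

theorem IsPeriodic.mul {A : Type*} [Mul A] {f g : V → A} (hf : IsPeriodic R f)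
    (hg : IsPeriodic R g) : IsPeriodic R fun x => f x * g x :=
  fun x l hl => congr_arg₂ _ (hf x l hl) (hg x l hl)

theorem IsPeriodic.add {f g : V → ℂ} (hf : IsPeriodic R f) (hg : IsPeriodic R g) :
    IsPeriodic R fun x => f x + g x :=
  fun x l hl => congr_arg₂ _ (hf x l hl) (hg x l hl)

theorem IsPeriodic.sub {f g : V → ℂ} (hf : IsPeriodic R f) (hg : IsPeriodic R g) :
    IsPeriodic R fun x => f x - g x :=
  fun x l hl => congr_arg₂ _ (hf x l hl) (hg x l hl)

theorem IsPeriodic.ofReal {f : V → ℝ} (hf : IsPeriodic R f) : IsPeriodic R fun x => (f x : ℂ) :=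
  fun x l hl => congr_arg _ (hf x l hl)

theorem IsPeriodic.finset_sum {κ A : Type*} [AddCommMonoid A] {s : Finset κ} {f : κ → V → A}
    (hf : ∀ i, IsPeriodic R (f i)) : IsPeriodic R fun x => ∑ i ∈ s, f i x :=
  fun x l hl => Finset.sum_congr rfl fun i _ => hf i x l hl

theorem IsPeriodic.const_mul {A : Type*} [Mul A] {f : V → A} (c : A) (hf : IsPeriodic R f) :
    IsPeriodic R fun x => c * f x :=
  fun x l hl => congr_arg _ (hf x l hl)

end Periodic

section Sums
variable [IsWeylInvariantInner R] {κ : Type*} [Fintype κ] (e : OrthonormalBasis κ ℝ V)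

theorem sum_root'_smul (i : ι) : ∑ v, R.root' i (e v) • e v = rootVec R i := by
  rw [← e.sum_repr' (rootVec R i)]
  refine Finset.sum_congr rfl fun v _ => ?_
  rw [root'_eq_inner, real_inner_comm]

theorem sum_logDerivPhi_mul_fderiv (ε : ℝ) (F : V → ℂ) (h : V) :
    ∑ v, (logDerivPhi R k ε (e v) h : ℂ) * fderiv ℝ F h (e v) = driftReg R k ε F h := by
  simp only [logDerivPhi, Complex.ofReal_sum, Finset.sum_mul]
  rw [Finset.sum_comm]
  refine Finset.sum_congr rfl fun i _ => ?_
  rw [← sum_root'_smul e i, map_sum, Finset.mul_sum]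
  refine Finset.sum_congr rfl fun v _ => ?_
  rw [map_smul, Complex.real_smul]
  push_cast
  ring

/-- With `ℓ` the logarithmic derivative of `φ` in a direction, the second derivative of `φ` divided
by `φ` is `ℓ² + ℓ'`. Summed over an orthonormal basis this is `Δφ/φ`, the squares producing the Gram
matrix of the roots. -/
theorem sum_logDerivPhi_sq_add (ε : ℝ) (h : V) :
    ∑ v, (logDerivPhi R k ε (e v) h ^ 2 +
      ∑ i, k i / 8 * (R.root' i (e v) * R.root' i (e v)) * cotRegDeriv R ε i h) =
      quadReg R k ε h := by
  rw [Finset.sum_add_distrib, quadReg]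
  congr 1
  · simp only [logDerivPhi, sq, Finset.sum_mul_sum]
    rw [Fintype.sum_prod_type, Finset.sum_comm, Finset.mul_sum]
    refine Finset.sum_congr rfl fun i _ => ?_
    rw [Finset.sum_comm, Finset.mul_sum]
    refine Finset.sum_congr rfl fun j _ => ?_
    rw [← sum_root'_mul_root' R e i j, Finset.mul_sum, Finset.sum_mul, Finset.mul_sum]
    refine Finset.sum_congr rfl fun v _ => ?_
    ring
  · rw [Finset.sum_comm]
    refine Finset.sum_congr rfl fun i _ => ?_
    rw [← sum_root'_mul_root' R e i i, Finset.mul_sum, Finset.sum_mul]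

end Sums

section Identities
variable [R.IsRootSystem] [R.IsCrystallographic] [IsWeylInvariantInner R]

theorem continuous_driftReg {ε : ℝ} (hε : 0 < ε) {F : V → ℂ} (hF : ContDiff ℝ 2 F) :
    Continuous (driftReg R k ε F) := by
  refine continuous_finsetSum _ fun i _ => ?_
  have h1 := (ContDiff.fderiv_apply_const hF (rootVec R i)).continuous
  have h2 := continuous_cotReg (R := R) hε i
  fun_prop

theorem continuous_quadReg {ε : ℝ} (hε : 0 < ε) : Continuous (quadReg R k ε) := by
  have h2 := fun i => continuous_cotReg (R := R) hε i
  have h3 := fun i => continuous_cotRegDeriv (R := R) hε i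
  unfold quadReg
  fun_prop

theorem isPeriodic_driftReg (ε : ℝ) {F : V → ℂ} (hF : IsPeriodic R F) :
    IsPeriodic R (driftReg R k ε F) :=
  IsPeriodic.finset_sum fun i =>
    ((isPeriodic_cotReg ε i).const_mul _).ofReal.mul (hF.fderiv_apply _)

theorem isPeriodic_quadReg (ε : ℝ) : IsPeriodic R (quadReg R k ε) := by
  intro x l hl
  have h1 := fun i => isPeriodic_cotReg (R := R) ε i x l hl
  have h2 := fun i => isPeriodic_cotRegDeriv (R := R) ε i x l hl
  simp only [quadReg, h1, h2]

theorem integral_onTorus_sub {f g : V → ℂ} (hf : IsPeriodic R f) (hfc : Continuous f)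
    (hg : IsPeriodic R g) (hgc : Continuous g) :
    ∫ t, onTorus R (fun x => f x - g x) t ∂haar R =
      ∫ t, onTorus R f t ∂haar R - ∫ t, onTorus R g t ∂haar R :=
  integral_sub (integrable_of_continuous_periodic hf hfc) (integrable_of_continuous_periodic hg hgc)

/-- The difference of the two integrands is the divergence of `Fφ ∇f - f ∇(Fφ)`, where `φ` is the
regularized ground state. For `ε > 0` this field is periodic and differentiable across the walls, so
each directional derivative integrates to zero. -/
theorem green_reg (hk0 : ∀ i, 0 ≤ k i) {ε : ℝ} (hε : 0 < ε) {F f : V → ℂ} (hF : ContDiff ℝ 2 F)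
    (hFp : IsPeriodic R F) (hf : ContDiff ℝ 2 f) (hfp : IsPeriodic R f) :
    ∫ t, onTorus R (fun h => F h * phiReg R k ε h * laplacian f h) t ∂haar R =
      ∫ t, onTorus R (fun h => f h * (phiReg R k ε h *
        (laplacian F h + 2 * driftReg R k ε F h + F h * quadReg R k ε h))) t ∂haar R := by
  let e := stdOrthonormalBasis ℝ V
  have hφc : Continuous fun h => (phiReg R k ε h : ℂ) :=
    Complex.continuous_ofReal.comp (continuous_phiReg hk0 ε)
  have hφp : IsPeriodic R fun h => (phiReg R k ε h : ℂ) := (isPeriodic_phiReg ε).ofReal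
  have hcot := fun i => continuous_cotReg (R := R) hε i
  have hcot' := fun i => continuous_cotRegDeriv (R := R) hε i
  have hlc : ∀ v, Continuous (logDerivPhi R k ε v) := by
    intro v
    unfold logDerivPhi
    fun_prop
  have hlp : ∀ v, IsPeriodic R (logDerivPhi R k ε v) := fun v =>
    IsPeriodic.finset_sum fun i => (isPeriodic_cotReg ε i).const_mul _
  let ξ' : V → V → ℝ := fun v h =>
    ∑ i, k i / 8 * (R.root' i v * R.root' i v) * cotRegDeriv R ε i h
  have hξc : ∀ v, Continuous (ξ' v) := by
    intro v
    simp only [ξ']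
    fun_prop
  have hξp : ∀ v, IsPeriodic R (ξ' v) := fun v =>
    IsPeriodic.finset_sum fun i => (isPeriodic_cotRegDeriv ε i).const_mul _
  let A : V → V → ℂ := fun v h => F h * phiReg R k ε h * secondDeriv f v h
  let B : V → V → ℂ := fun v h => f h * (phiReg R k ε h * (secondDeriv F v h +
    2 * (logDerivPhi R k ε v h * fderiv ℝ F h v) +
      F h * ((logDerivPhi R k ε v h ^ 2 + ξ' v h : ℝ) : ℂ)))
  have hFc := hF.continuous
  have hfc := hf.continuous
  have hF1 := fun v => (ContDiff.fderiv_apply_const hF v).continuous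
  have hf1 := fun v => (ContDiff.fderiv_apply_const hf v).continuous
  have hF2 := fun v => ContDiff.continuous_secondDeriv hF v
  have hf2 := fun v => ContDiff.continuous_secondDeriv hf v
  have hAc : ∀ v, Continuous (A v) := fun v => by simp only [A]; fun_prop
  have hBc : ∀ v, Continuous (B v) := fun v => by simp only [B]; fun_prop
  have hAp : ∀ v, IsPeriodic R (A v) := fun v => (hFp.mul hφp).mul (hfp.secondDeriv v)
  have hBp : ∀ v, IsPeriodic R (B v) := by
    intro v x l hl
    have h1 := hFp x l hl
    have h2 := hfp x l hl
    have h3 := hφp x l hl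
    have h4 := hlp v x l hl
    have h5 := hξp v x l hl
    have h6 := hFp.secondDeriv v x l hl
    have h7 := hFp.fderiv_apply v x l hl
    simp only at h3 h7
    simp only [B, h1, h2, h3, h4, h5, h6, h7]
  have hv : ∀ v, ∫ t, onTorus R (A v) t ∂haar R = ∫ t, onTorus R (B v) t ∂haar R := by
    intro v
    rw [← sub_eq_zero, ← integral_onTorus_sub (hAp v) (hAc v) (hBp v) (hBc v)]
    refine integral_lineDeriv_eq_zero (v := v)
      (u := fun h => F h * phiReg R k ε h * fderiv ℝ f h v -
        f h * (fderiv ℝ F h v * phiReg R k ε h + F h * (phiReg R k ε h * logDerivPhi R k ε v h)))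
      ?_ ((hAp v).sub (hBp v)) (by fun_prop) ((hAc v).sub (hBc v)) fun x => ?_
    · exact ((hFp.mul hφp).mul (hfp.fderiv_apply v)).sub (hfp.mul (((hFp.fderiv_apply v).mul hφp).add
        (hFp.mul (hφp.mul (hlp v).ofReal))))
    · have d1 := ContDiff.hasLineDerivAt_fderiv (hF.of_le one_le_two) x v
      have d2 := ContDiff.hasLineDerivAt_fderiv (hf.of_le one_le_two) x v
      have d3 := ContDiff.hasLineDerivAt_fderiv (ContDiff.fderiv_apply_const hF v) x v
      have d4 := ContDiff.hasLineDerivAt_fderiv (ContDiff.fderiv_apply_const hf v) x v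
      have d5 := hasLineDerivAt_ofReal (hasLineDerivAt_phiReg (R := R) (k := k) hε x v)
      have d6 := hasLineDerivAt_ofReal (hasLineDerivAt_logDerivPhi (R := R) (k := k) hε x v)
      refine HasDerivAt.congr_deriv (hasLineDerivAt_sub
        (hasLineDerivAt_mul (hasLineDerivAt_mul d1 d5) d4)
        (hasLineDerivAt_mul d2 (hasLineDerivAt_add (hasLineDerivAt_mul d3 d5)
          (hasLineDerivAt_mul d1 (hasLineDerivAt_mul d5 d6))))) ?_
      simp only [A, B, secondDeriv, ξ']
      push_cast
      ring
  have hsum := Finset.sum_congr (rfl : (Finset.univ : Finset (Fin (Module.finrank ℝ V))) = _)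
    fun v _ => hv (e v)
  rw [← integral_finsetSum _ fun v _ => integrable_of_continuous_periodic (hAp _) (hAc _),
    ← integral_finsetSum _ fun v _ => integrable_of_continuous_periodic (hBp _) (hBc _)] at hsum
  refine Eq.trans ?_ (hsum.trans ?_)
  · refine integral_congr_ae (ae_of_all _ fun t => ?_)
    simp only [onTorus, A]
    rw [laplacian_eq_sum_secondDeriv e hf, Finset.mul_sum]
  · refine integral_congr_ae (ae_of_all _ fun t => ?_)
    simp only [onTorus, B]
    rw [laplacian_eq_sum_secondDeriv e hF, ← sum_logDerivPhi_mul_fderiv e,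
      ← sum_logDerivPhi_sq_add e, ← Finset.mul_sum, ← Finset.mul_sum, Finset.sum_add_distrib,
      Finset.sum_add_distrib, Finset.mul_sum, Complex.ofReal_sum, Finset.mul_sum]

/-- This is the vanishing of the integral of the divergence of `G φ² ∇F`: the derivative of `φ²`
produces the drift term, that of `G` the Dirichlet form. -/
theorem symm_reg (hk0 : ∀ i, 0 ≤ k i) {ε : ℝ} (hε : 0 < ε) {F G : V → ℂ} (hF : ContDiff ℝ 2 F)
    (hFp : IsPeriodic R F) (hG : ContDiff ℝ 2 G) (hGp : IsPeriodic R G)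
    {κ : Type*} [Fintype κ] (e : OrthonormalBasis κ ℝ V) :
    ∫ t, onTorus R (fun h => G h * phiReg R k ε h ^ 2 *
      (laplacian F h + 2 * driftReg R k ε F h)) t ∂haar R =
      -∫ t, onTorus R (fun h => phiReg R k ε h ^ 2 *
        ∑ v, fderiv ℝ F h (e v) * fderiv ℝ G h (e v)) t ∂haar R := by
  have hφc : Continuous fun h => (phiReg R k ε h : ℂ) :=
    Complex.continuous_ofReal.comp (continuous_phiReg hk0 ε)
  have hφp : IsPeriodic R fun h => (phiReg R k ε h : ℂ) := (isPeriodic_phiReg ε).ofReal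
  have hcot := fun i => continuous_cotReg (R := R) hε i
  have hlc : ∀ v, Continuous (logDerivPhi R k ε v) := by
    intro v
    unfold logDerivPhi
    fun_prop
  have hlp : ∀ v, IsPeriodic R (logDerivPhi R k ε v) := fun v =>
    IsPeriodic.finset_sum fun i => (isPeriodic_cotReg ε i).const_mul _
  let A : V → V → ℂ := fun v h => G h * phiReg R k ε h ^ 2 *
    (secondDeriv F v h + 2 * (logDerivPhi R k ε v h * fderiv ℝ F h v)) +
      phiReg R k ε h ^ 2 * (fderiv ℝ F h v * fderiv ℝ G h v)
  have hFc := hF.continuous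
  have hGc := hG.continuous
  have hF1 := fun v => (ContDiff.fderiv_apply_const hF v).continuous
  have hG1 := fun v => (ContDiff.fderiv_apply_const hG v).continuous
  have hF2 := fun v => ContDiff.continuous_secondDeriv hF v
  have hAc : ∀ v, Continuous (A v) := fun v => by simp only [A]; fun_prop
  have hAp : ∀ v, IsPeriodic R (A v) := by
    intro v x l hl
    have h1 := hFp.fderiv_apply v x l hl
    have h2 := hGp x l hl
    have h3 := hφp x l hl
    have h4 := hlp v x l hl
    have h6 := hFp.secondDeriv v x l hl
    have h7 := hGp.fderiv_apply v x l hl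
    simp only at h1 h3 h7
    simp only [A, h1, h2, h3, h4, h6, h7]
  have hv : ∀ v, ∫ t, onTorus R (A v) t ∂haar R = 0 := by
    intro v
    refine integral_lineDeriv_eq_zero (v := v)
      (u := fun h => G h * (phiReg R k ε h * phiReg R k ε h) * fderiv ℝ F h v)
      ((hGp.mul (hφp.mul hφp)).mul (hFp.fderiv_apply v)) (hAp v) (by fun_prop) (hAc v) fun x => ?_
    have d2 := ContDiff.hasLineDerivAt_fderiv (hG.of_le one_le_two) x v
    have d3 := ContDiff.hasLineDerivAt_fderiv (ContDiff.fderiv_apply_const hF v) x v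
    have d5 := hasLineDerivAt_ofReal (hasLineDerivAt_phiReg (R := R) (k := k) hε x v)
    refine HasDerivAt.congr_deriv (hasLineDerivAt_mul (hasLineDerivAt_mul d2
      (hasLineDerivAt_mul d5 d5)) d3) ?_
    simp only [A, secondDeriv]
    push_cast
    ring
  have hsum : ∑ v, ∫ t, onTorus R (A (e v)) t ∂haar R = 0 := Finset.sum_eq_zero fun v _ => hv _
  rw [← integral_finsetSum _ fun v _ => integrable_of_continuous_periodic (hAp _) (hAc _)] at hsum
  have hdc := continuous_driftReg (R := R) (k := k) hε hF
  have hLc := CalogeroMoser.continuous_laplacian hF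
  have hdp := isPeriodic_driftReg (k := k) ε hFp
  have hLp := hFp.laplacian
  rw [eq_neg_iff_add_eq_zero, ← hsum, ← integral_add]
  · refine integral_congr_ae (ae_of_all _ fun t => ?_)
    simp only [onTorus, A]
    rw [laplacian_eq_sum_secondDeriv e hF, ← sum_logDerivPhi_mul_fderiv e, Finset.sum_add_distrib,
      ← Finset.mul_sum, ← Finset.mul_sum, Finset.sum_add_distrib, Finset.mul_sum]
  · refine integrable_of_continuous_periodic ?_ (by fun_prop)
    intro x l hl
    have h2 := hGp x l hl
    have h3 := hφp x l hl
    have h4 := hdp x l hl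
    have h5 := hLp x l hl
    simp only at h3
    simp only [h2, h3, h4, h5]
  · refine integrable_of_continuous_periodic ?_ (by fun_prop)
    intro x l hl
    have h2 := fun v => hGp.fderiv_apply v x l hl
    have h3 := hφp x l hl
    have h4 := fun v => hFp.fderiv_apply v x l hl
    simp only at h2 h3 h4
    simp only [h2, h3, h4]

end Identities
end Green
end CalogeroMoser

end

noncomputable section
namespace CalogeroMoser
open MeasureTheory Laplacian

/-! ### Removal of the regularization -/

section GreenLimit
variable {ι M V : Type*} [AddCommGroup M] [Module ℝ M]
  [NormedAddCommGroup V] [InnerProductSpace ℝ V] [FiniteDimensional ℝ V]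
  [Fintype ι] {R : RootPairing ι ℝ M V} {k : ι → ℝ}

theorem tendsto_driftReg {h : V} (hs : ∀ i, sinRoot R i h ≠ 0) (F : V → ℂ) {ε : ℕ → ℝ}
    (hε : Filter.Tendsto ε Filter.atTop (nhds 0)) :
    Filter.Tendsto (fun n => driftReg R k (ε n) F h) Filter.atTop (nhds (driftReg R k 0 F h)) :=
  tendsto_finsetSum _ fun i _ => (((Complex.continuous_ofReal.tendsto _).comp
    ((tendsto_cotReg (hs i) hε).const_mul _))).mul_const _

theorem tendsto_quadReg {h : V} (hs : ∀ i, sinRoot R i h ≠ 0) {ε : ℕ → ℝ}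
    (hε : Filter.Tendsto ε Filter.atTop (nhds 0)) :
    Filter.Tendsto (fun n => quadReg R k (ε n) h) Filter.atTop (nhds (quadReg R k 0 h)) :=
  ((tendsto_finsetSum _ fun q _ => ((tendsto_cotReg (hs q.1) hε).mul
    (tendsto_cotReg (hs q.2) hε)).const_mul _).const_mul _).add
    (tendsto_finsetSum _ fun i _ => (tendsto_cotRegDeriv (hs i) hε).const_mul _)

theorem mul_abs_cotReg_le {C a ε : ℝ} (hε : 0 < ε) (hC : 0 ≤ C) {i : ι} {h : V}
    (ha : a ≤ C * |sinRoot R i h|) : a * |cotReg R ε i h| ≤ C := by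
  calc a * |cotReg R ε i h| ≤ C * |sinRoot R i h| * |cotReg R ε i h| :=
        mul_le_mul_of_nonneg_right ha (abs_nonneg _)
    _ = C * |sinRoot R i h * cotReg R ε i h| := by rw [abs_mul]; ring
    _ ≤ C * 1 := mul_le_mul_of_nonneg_left (abs_sinRoot_mul_cotReg_le hε.le i h) hC
    _ = C := mul_one C

theorem mul_norm_driftReg_le (hk0 : ∀ i, 0 ≤ k i) {C C' a ε : ℝ} (hε : 0 < ε) (hC : 0 ≤ C)
    {F : V → ℂ} {h : V} (ha : 0 ≤ a)
    (hb : ∀ i, k i ≠ 0 → a ≤ C * |sinRoot R i h|)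
    (hF : ∀ i, ‖fderiv ℝ F h (rootVec R i)‖ ≤ C') :
    a * ‖driftReg R k ε F h‖ ≤ ∑ i, k i / 4 * C * C' := by
  refine (mul_le_mul_of_nonneg_left (norm_sum_le _ _) ha).trans ?_
  rw [Finset.mul_sum]
  refine Finset.sum_le_sum fun i _ => ?_
  rw [norm_mul, Complex.norm_real, Real.norm_eq_abs, abs_mul, abs_of_nonneg (by linarith [hk0 i])]
  rcases eq_or_ne (k i) 0 with h0 | h0
  · simp [h0]
  · calc a * (k i / 4 * |cotReg R ε i h| * ‖fderiv ℝ F h (rootVec R i)‖) =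
        k i / 4 * (a * |cotReg R ε i h|) * ‖fderiv ℝ F h (rootVec R i)‖ := by ring
      _ ≤ k i / 4 * C * C' := by
        have h1 := mul_abs_cotReg_le hε hC (hb i h0)
        have h2 := hk0 i
        have h3 := hF i
        gcongr

/-- Here the pole of the cotangent is offset by the vanishing of the normal derivative of `F` on the
wall, not by a factor in front as in `mul_norm_driftReg_le`. -/
theorem norm_driftReg_le (hk0 : ∀ i, 0 ≤ k i) {C ε : ℝ} (hε : 0 < ε) (hC : 0 ≤ C)
    {F : V → ℂ} {h : V}
    (hb : ∀ i, k i ≠ 0 → ‖fderiv ℝ F h (rootVec R i)‖ ≤ C * |sinRoot R i h|) :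
    ‖driftReg R k ε F h‖ ≤ ∑ i, k i / 4 * C := by
  refine (norm_sum_le _ _).trans (Finset.sum_le_sum fun i _ => ?_)
  rw [norm_mul, Complex.norm_real, Real.norm_eq_abs, abs_mul, abs_of_nonneg (by linarith [hk0 i])]
  rcases eq_or_ne (k i) 0 with h0 | h0
  · simp [h0]
  · have h1 := mul_abs_cotReg_le hε hC (hb i h0)
    rw [mul_assoc, mul_comm |_|]
    exact mul_le_mul_of_nonneg_left h1 (by linarith [hk0 i])

theorem mul_abs_quadReg_le (hk0 : ∀ i, 0 ≤ k i) {C a ε : ℝ} (hε : 0 < ε) (hC : 0 ≤ C)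
    {h : V} (ha : 0 ≤ a) (hb : ∀ i, k i ≠ 0 → a ≤ C * sinRoot R i h ^ 2) :
    a * |quadReg R k ε h| ≤
      1 / 16 * (∑ q : ι × ι, k q.1 * k q.2 * |gram R q.1 q.2| * C) +
        ∑ i, k i / 8 * |gram R i i| * (3 * C) := by
  refine (mul_le_mul_of_nonneg_left (abs_add_le _ _) ha).trans ?_
  rw [mul_add]
  refine add_le_add ?_ ?_
  · rw [abs_mul, abs_of_pos (by norm_num : (0 : ℝ) < 1 / 16), mul_left_comm]
    refine mul_le_mul_of_nonneg_left ?_ (by norm_num)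
    refine (mul_le_mul_of_nonneg_left (Finset.abs_sum_le_sum_abs _ _) ha).trans ?_
    rw [Finset.mul_sum]
    refine Finset.sum_le_sum fun q _ => ?_
    have h1 := hk0 q.1
    have h2 := hk0 q.2
    rcases eq_or_ne (k q.1) 0 with h0 | h0
    · simp [h0]
    rcases eq_or_ne (k q.2) 0 with h0' | h0'
    · simp [h0']
    have b1 := hb _ h0
    have b2 := hb _ h0'
    -- A product of cotangents of two different roots has two simple poles; the geometric mean of
    -- the two quadratic bounds provides one factor for each.
    have hle : a ≤ C * |sinRoot R q.2 h| * |sinRoot R q.1 h| := by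
      refine abs_le_of_sq_le_sq' ?_ (by positivity) |>.2
      calc a ^ 2 = a * a := sq a
        _ ≤ C * sinRoot R q.1 h ^ 2 * (C * sinRoot R q.2 h ^ 2) :=
            mul_le_mul b1 b2 ha (by positivity)
        _ = _ := by rw [mul_pow, mul_pow, sq_abs, sq_abs]; ring
    have h3 := mul_abs_cotReg_le hε (by positivity) hle
    have h4 := mul_abs_cotReg_le hε hC h3
    rw [abs_mul, abs_mul, abs_mul, abs_mul, abs_of_nonneg h1, abs_of_nonneg h2]
    calc a * (k q.1 * k q.2 * |gram R q.1 q.2| * (|cotReg R ε q.1 h| * |cotReg R ε q.2 h|)) =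
        k q.1 * k q.2 * |gram R q.1 q.2| * (a * |cotReg R ε q.1 h| * |cotReg R ε q.2 h|) := by ring
      _ ≤ _ := mul_le_mul_of_nonneg_left h4 (by positivity)
  · refine (mul_le_mul_of_nonneg_left (Finset.abs_sum_le_sum_abs _ _) ha).trans ?_
    rw [Finset.mul_sum]
    refine Finset.sum_le_sum fun i _ => ?_
    have h1 := hk0 i
    rcases eq_or_ne (k i) 0 with h0 | h0
    · simp [h0]
    have b1 := hb _ h0
    have h3 := sinRoot_sq_mul_abs_cotRegDeriv_le (R := R) hε i h
    have h4 : a * |cotRegDeriv R ε i h| ≤ 3 * C := by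
      calc a * |cotRegDeriv R ε i h| ≤ C * sinRoot R i h ^ 2 * |cotRegDeriv R ε i h| :=
            mul_le_mul_of_nonneg_right b1 (abs_nonneg _)
        _ = C * (sinRoot R i h ^ 2 * |cotRegDeriv R ε i h|) := by ring
        _ ≤ C * 3 := mul_le_mul_of_nonneg_left h3 hC
        _ = 3 * C := mul_comm _ _
    rw [abs_mul, abs_mul, abs_of_nonneg (by positivity : 0 ≤ k i / 8)]
    calc a * (k i / 8 * |gram R i i| * |cotRegDeriv R ε i h|) =
        k i / 8 * |gram R i i| * (a * |cotRegDeriv R ε i h|) := by ring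
      _ ≤ _ := mul_le_mul_of_nonneg_left h4 (by positivity)

variable [R.IsRootSystem] [R.IsCrystallographic] [IsWeylInvariantInner R]

theorem tendsto_one_div_succ : Filter.Tendsto (fun n : ℕ => 1 / ((n : ℝ) + 1)) Filter.atTop (nhds 0) :=
  tendsto_one_div_add_atTop_nhds_zero_nat

/-- Green's formula for a twice differentiable function that vanishes to second order on the walls,
and a smooth function times the ground state. -/
theorem green (hk0 : ∀ i, 0 ≤ k i) {F f : V → ℂ} (hF : ContDiff ℝ 2 F)
    (hFp : IsPeriodic R F) (hf : ContDiff ℝ 2 f) (hfp : IsPeriodic R f) {C : ℝ} (hC : 0 ≤ C)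
    (hb : ∀ i, k i ≠ 0 → ∀ h, ‖f h‖ ≤ C * sinRoot R i h ^ 2) :
    ∫ t, onTorus R (fun h => F h * phiReg R k 0 h * laplacian f h) t ∂haar R =
      ∫ t, onTorus R (fun h => f h * (phiReg R k 0 h *
        (laplacian F h + 2 * driftReg R k 0 F h + F h * quadReg R k 0 h))) t ∂haar R := by
  let ε : ℕ → ℝ := fun n => 1 / ((n : ℝ) + 1)
  have hε0 : ∀ n, 0 < ε n := fun n => by positivity
  have hε1 : ∀ n, ε n ≤ 1 := fun n => by
    simp only [ε]
    rw [div_le_one (by positivity)]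
    linarith [n.cast_nonneg (α := ℝ)]
  have hε : Filter.Tendsto ε Filter.atTop (nhds 0) := tendsto_one_div_succ
  set Bφ := ∏ i, (2 : ℝ) ^ (k i / 4)
  have hBφ : 0 ≤ Bφ := (phiReg_nonneg (R := R) (k := k) (hε0 0).le 0).trans
    (phiReg_le hk0 (hε0 0).le (hε1 0) 0)
  have hφ : ∀ n h, ‖(phiReg R k (ε n) h : ℂ)‖ ≤ Bφ := fun n h => by
    rw [Complex.norm_real, Real.norm_eq_abs, abs_of_nonneg (phiReg_nonneg (hε0 n).le h)]
    exact phiReg_le hk0 (hε0 n).le (hε1 n) h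
  obtain ⟨CF, hCF0, hCF⟩ := exists_bound_of_continuous_periodic hFp hF.continuous
  obtain ⟨Cf, hCf0, hCf⟩ := exists_bound_of_continuous_periodic hfp hf.continuous
  obtain ⟨CF2, hCF20, hCF2⟩ := exists_bound_of_continuous_periodic hFp.laplacian
    (CalogeroMoser.continuous_laplacian hF)
  obtain ⟨Cf2, hCf20, hCf2⟩ := exists_bound_of_continuous_periodic hfp.laplacian
    (CalogeroMoser.continuous_laplacian hf)
  have hD : ∀ i, ∃ C, 0 ≤ C ∧ ∀ h, ‖fderiv ℝ F h (rootVec R i)‖ ≤ C := fun i =>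
    exists_bound_of_continuous_periodic (hFp.fderiv_apply _)
      (ContDiff.fderiv_apply_const hF _).continuous
  choose CD hCD0 hCD using hD
  have hCD' : ∀ h i, ‖fderiv ℝ F h (rootVec R i)‖ ≤ ∑ j, CD j := fun h i =>
    (hCD i h).trans (Finset.single_le_sum (fun j _ => hCD0 j) (Finset.mem_univ i))
  set Cdrift := ∑ i, k i / 4 * C * ∑ j, CD j
  set Cquad := 1 / 16 * (∑ q : ι × ι, k q.1 * k q.2 * |gram R q.1 q.2| * C) +
        ∑ i, k i / 8 * |gram R i i| * (3 * C)
  have hdrift : ∀ n h, ‖f h‖ * ‖driftReg R k (ε n) F h‖ ≤ Cdrift := fun n h =>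
    mul_norm_driftReg_le hk0 (hε0 n) hC (norm_nonneg _) (fun i hi => (hb i hi h).trans (by
      rw [← sq_abs]
      have : |sinRoot R i h| ≤ 1 := Real.abs_sin_le_one _
      exact mul_le_mul_of_nonneg_left (by nlinarith [abs_nonneg (sinRoot R i h)]) hC)) (hCD' h)
  have hquad : ∀ n h, ‖f h‖ * |quadReg R k (ε n) h| ≤ Cquad := fun n h =>
    mul_abs_quadReg_le hk0 (hε0 n) hC (norm_nonneg _) fun i hi => hb i hi h
  have hφc : ∀ n, Continuous fun h => (phiReg R k (ε n) h : ℂ) := fun n =>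
    Complex.continuous_ofReal.comp (continuous_phiReg hk0 _)
  have hφp : ∀ n, IsPeriodic R fun h => (phiReg R k (ε n) h : ℂ) := fun n =>
    (isPeriodic_phiReg _).ofReal
  have hFc := hF.continuous
  have hfc := hf.continuous
  have hF2c := CalogeroMoser.continuous_laplacian hF
  have hf2c := CalogeroMoser.continuous_laplacian hf
  have hdc := fun n => continuous_driftReg (R := R) (k := k) (hε0 n) hF
  have hqc := fun n => continuous_quadReg (R := R) (k := k) (hε0 n)
  have hφt : ∀ h, Filter.Tendsto (fun n => (phiReg R k (ε n) h : ℂ)) Filter.atTop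
      (nhds (phiReg R k 0 h : ℂ)) := fun h =>
    (Complex.continuous_ofReal.tendsto _).comp (tendsto_phiReg hk0 h hε)
  -- Dominated convergence is applied to both sides of `green_reg`. Since `|f| ≤ C sin²`, the
  -- products of `f` with the drift and with the zeroth-order term are bounded uniformly in `ε`, and
  -- the integrands converge off the null set of the walls.
  have hL := tendsto_integral_of_dominated_convergence (μ := haar R)
    (F := fun n => onTorus R fun h => F h * phiReg R k (ε n) h * laplacian f h)
    (f := onTorus R fun h => F h * phiReg R k 0 h * laplacian f h)
    (fun _ => CF * Bφ * Cf2)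
    (fun n => (continuous_onTorus ((hFp.mul (hφp n)).mul hfp.laplacian)
      (by have := hφc n; fun_prop)).aestronglyMeasurable) (integrable_const _)
    (fun n => ae_of_all _ fun t => by
      simp only [onTorus, norm_mul]
      exact mul_le_mul (mul_le_mul (hCF _) (hφ n _) (norm_nonneg _) hCF0) (hCf2 _) (norm_nonneg _)
        (by positivity))
    (ae_of_all _ fun t => ((hφt _).const_mul _).mul_const _)
  have hRHS := tendsto_integral_of_dominated_convergence (μ := haar R)
    (F := fun n => onTorus R fun h => f h * (phiReg R k (ε n) h *
        (laplacian F h + 2 * driftReg R k (ε n) F h + F h * quadReg R k (ε n) h)))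
    (f := onTorus R fun h => f h * (phiReg R k 0 h *
        (laplacian F h + 2 * driftReg R k 0 F h + F h * quadReg R k 0 h)))
    (fun _ => Bφ * (Cf * CF2 + 2 * Cdrift + CF * Cquad))
    (fun n => (continuous_onTorus (by
      intro x l hl
      have h1 := hFp x l hl
      have h2 := hfp x l hl
      have h3 := hφp n x l hl
      have h4 := isPeriodic_driftReg (k := k) (ε n) hFp x l hl
      have h5 := isPeriodic_quadReg (R := R) (k := k) (ε n) x l hl
      have h6 := hFp.laplacian x l hl
      simp only at h3
      simp only [h1, h2, h3, h4, h5, h6])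
      (by have h1 := hφc n; have h2 := hdc n; have h3 := hqc n; fun_prop)).aestronglyMeasurable)
    (integrable_const _)
    (fun n => ae_of_all _ fun t => by
      simp only [onTorus]
      set h := Torus.rep R t
      have e1 : ‖f h * (phiReg R k (ε n) h *
          (laplacian F h + 2 * driftReg R k (ε n) F h + F h * quadReg R k (ε n) h))‖ =
          ‖(phiReg R k (ε n) h : ℂ)‖ * ‖f h * laplacian F h + 2 * (f h * driftReg R k (ε n) F h) +
            F h * (f h * quadReg R k (ε n) h)‖ := by
        rw [← norm_mul]
        congr 1
        ring
      rw [e1]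
      refine mul_le_mul (hφ n h) ?_ (norm_nonneg _) hBφ
      refine (norm_add_le _ _).trans (add_le_add ((norm_add_le _ _).trans (add_le_add ?_ ?_)) ?_)
      · rw [norm_mul]
        exact mul_le_mul (hCf h) (hCF2 h) (norm_nonneg _) hCf0
      · rw [norm_mul, norm_mul]
        have := hdrift n h
        simp only [Complex.norm_ofNat]
        linarith
      · rw [norm_mul, norm_mul, Complex.norm_real, Real.norm_eq_abs]
        exact mul_le_mul (hCF h) (hquad n h) (by positivity) hCF0)
    (by
      filter_upwards [ae_regular (R := R)] with t ht
      exact ((hφt _).mul ((tendsto_const_nhds.add ((tendsto_driftReg ht F hε).const_mul _)).add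
        (((Complex.continuous_ofReal.tendsto _).comp (tendsto_quadReg ht hε)).const_mul _))).const_mul _)
  refine tendsto_nhds_unique hL ?_
  simp only [green_reg hk0 (hε0 _) hF hFp hf hfp]
  exact hRHS

/-- Integration by parts with the square of the ground state as a weight. -/
theorem integral_conjugated_laplacian (hk0 : ∀ i, 0 ≤ k i) {F G : V → ℂ} (hF : ContDiff ℝ 2 F)
    (hFp : IsPeriodic R F) (hG : ContDiff ℝ 2 G) (hGp : IsPeriodic R G) {C : ℝ} (hC : 0 ≤ C)
    (hb : ∀ i, k i ≠ 0 → ∀ h, ‖fderiv ℝ F h (rootVec R i)‖ ≤ C * |sinRoot R i h|)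
    {κ : Type*} [Fintype κ] (e : OrthonormalBasis κ ℝ V) :
    ∫ t, onTorus R (fun h => G h * phiReg R k 0 h ^ 2 *
      (laplacian F h + 2 * driftReg R k 0 F h)) t ∂haar R =
      -∫ t, onTorus R (fun h => phiReg R k 0 h ^ 2 *
        ∑ v, fderiv ℝ F h (e v) * fderiv ℝ G h (e v)) t ∂haar R := by
  let ε : ℕ → ℝ := fun n => 1 / ((n : ℝ) + 1)
  have hε0 : ∀ n, 0 < ε n := fun n => by positivity
  have hε1 : ∀ n, ε n ≤ 1 := fun n => by
    simp only [ε]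
    rw [div_le_one (by positivity)]
    linarith [n.cast_nonneg (α := ℝ)]
  have hε : Filter.Tendsto ε Filter.atTop (nhds 0) := tendsto_one_div_succ
  set Bφ := ∏ i, (2 : ℝ) ^ (k i / 4)
  have hBφ : 0 ≤ Bφ := (phiReg_nonneg (R := R) (k := k) (hε0 0).le 0).trans
    (phiReg_le hk0 (hε0 0).le (hε1 0) 0)
  have hφ : ∀ n h, ‖(phiReg R k (ε n) h : ℂ)‖ ≤ Bφ := fun n h => by
    rw [Complex.norm_real, Real.norm_eq_abs, abs_of_nonneg (phiReg_nonneg (hε0 n).le h)]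
    exact phiReg_le hk0 (hε0 n).le (hε1 n) h
  have hφ2 : ∀ n h, ‖(phiReg R k (ε n) h : ℂ) ^ 2‖ ≤ Bφ ^ 2 := fun n h => by
    rw [norm_pow]
    exact pow_le_pow_left₀ (norm_nonneg _) (hφ n h) 2
  obtain ⟨CG, hCG0, hCG⟩ := exists_bound_of_continuous_periodic hGp hG.continuous
  obtain ⟨CF2, hCF20, hCF2⟩ := exists_bound_of_continuous_periodic hFp.laplacian
    (CalogeroMoser.continuous_laplacian hF)
  have hF1 := fun v => (ContDiff.fderiv_apply_const hF v).continuous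
  have hG1 := fun v => (ContDiff.fderiv_apply_const hG v).continuous
  let S : V → ℂ := fun h => ∑ v, fderiv ℝ F h (e v) * fderiv ℝ G h (e v)
  have hSp : IsPeriodic R S := IsPeriodic.finset_sum fun v =>
    (hFp.fderiv_apply _).mul (hGp.fderiv_apply _)
  have hSc : Continuous S := by simp only [S]; fun_prop
  obtain ⟨CS, hCS0, hCS⟩ := exists_bound_of_continuous_periodic hSp hSc
  -- The function `G` need not vanish anywhere, so the domination rests on the hypothesis about the
  -- derivatives of `F`.
  have hdrift : ∀ n h, ‖driftReg R k (ε n) F h‖ ≤ ∑ i, k i / 4 * C := fun n h =>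
    norm_driftReg_le hk0 (hε0 n) hC fun i hi => hb i hi h
  have hφc : ∀ n, Continuous fun h => (phiReg R k (ε n) h : ℂ) := fun n =>
    Complex.continuous_ofReal.comp (continuous_phiReg hk0 _)
  have hφp : ∀ n, IsPeriodic R fun h => (phiReg R k (ε n) h : ℂ) := fun n =>
    (isPeriodic_phiReg _).ofReal
  have hFc := hF.continuous
  have hGc := hG.continuous
  have hF2c := CalogeroMoser.continuous_laplacian hF
  have hdc := fun n => continuous_driftReg (R := R) (k := k) (hε0 n) hF
  have hφt : ∀ h, Filter.Tendsto (fun n => (phiReg R k (ε n) h : ℂ)) Filter.atTop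
      (nhds (phiReg R k 0 h : ℂ)) := fun h =>
    (Complex.continuous_ofReal.tendsto _).comp (tendsto_phiReg hk0 h hε)
  have hL := tendsto_integral_of_dominated_convergence (μ := haar R)
    (F := fun n => onTorus R fun h => G h * phiReg R k (ε n) h ^ 2 *
      (laplacian F h + 2 * driftReg R k (ε n) F h))
    (f := onTorus R fun h => G h * phiReg R k 0 h ^ 2 *
      (laplacian F h + 2 * driftReg R k 0 F h))
    (fun _ => CG * Bφ ^ 2 * (CF2 + 2 * ∑ i, k i / 4 * C))
    (fun n => (continuous_onTorus (by
      intro x l hl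
      have h1 := hGp x l hl
      have h3 := hφp n x l hl
      have h4 := isPeriodic_driftReg (k := k) (ε n) hFp x l hl
      have h6 := hFp.laplacian x l hl
      simp only at h3
      simp only [h1, h3, h4, h6])
      (by have h1 := hφc n; have h2 := hdc n; fun_prop)).aestronglyMeasurable)
    (integrable_const _)
    (fun n => ae_of_all _ fun t => by
      simp only [onTorus]
      set h := Torus.rep R t
      rw [norm_mul, norm_mul]
      refine mul_le_mul (mul_le_mul (hCG h) (hφ2 n h) (norm_nonneg _) hCG0) ?_ (norm_nonneg _)
        (by positivity)
      refine (norm_add_le _ _).trans (add_le_add (hCF2 h) ?_)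
      rw [norm_mul, Complex.norm_ofNat]
      exact mul_le_mul_of_nonneg_left (hdrift n h) two_pos.le)
    (by
      filter_upwards [ae_regular (R := R)] with t ht
      exact (((hφt _).pow 2).const_mul _).mul
        (tendsto_const_nhds.add ((tendsto_driftReg ht F hε).const_mul _)))
  have hRHS := tendsto_integral_of_dominated_convergence (μ := haar R)
    (F := fun n => onTorus R fun h => phiReg R k (ε n) h ^ 2 * S h)
    (f := onTorus R fun h => phiReg R k 0 h ^ 2 * S h)
    (fun _ => Bφ ^ 2 * CS)
    (fun n => (continuous_onTorus (by
      intro x l hl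
      have h1 := hSp x l hl
      have h3 := hφp n x l hl
      simp only at h3
      simp only [h1, h3])
      (by have h1 := hφc n; fun_prop)).aestronglyMeasurable)
    (integrable_const _)
    (fun n => ae_of_all _ fun t => by
      simp only [onTorus]
      rw [norm_mul]
      exact mul_le_mul (hφ2 n _) (hCS _) (norm_nonneg _) (by positivity))
    (ae_of_all _ fun t => ((hφt _).pow 2).mul_const _)
  refine tendsto_nhds_unique hL ?_
  simp only [symm_reg hk0 (hε0 _) hF hFp hG hGp e]
  exact hRHS.neg

end GreenLimit
end CalogeroMoser

end

noncomputable section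
namespace CalogeroMoser
open MeasureTheory Laplacian

/-! ### The potential compared with the Laplacian of the ground state -/

section Multiplier
variable {ι M V : Type*} [AddCommGroup M] [Module ℝ M]
  [NormedAddCommGroup V] [InnerProductSpace ℝ V] [FiniteDimensional ℝ V]
  [Fintype ι] {R : RootPairing ι ℝ M V} {k : ι → ℝ}

theorem sinRoot_reflectionPerm_self (i : ι) (h : V) :
    sinRoot R (R.reflectionPerm i i) h = -sinRoot R i h := by
  rw [sinRoot, root'_reflectionPerm_self, neg_div, Real.sin_neg, sinRoot]

open Classical in
theorem prod_eq_prod_pos_sq (b : R.Base) (F : ι → ℝ)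
    (hF : ∀ i, F (R.reflectionPerm i i) = F i) : ∏ i, F i = (∏ i with b.IsPos i, F i) ^ 2 := by
  let := R.indexNeg
  rw [← Finset.prod_filter_mul_prod_filter_not Finset.univ b.IsPos, sq]
  congr 1
  refine Finset.prod_nbij' (fun i => R.reflectionPerm i i) (fun i => R.reflectionPerm i i)
    ?_ ?_ ?_ ?_ ?_
  · intro i hi
    simp only [Finset.mem_filter, Finset.mem_univ, true_and] at hi ⊢
    exact (RootPairing.Base.IsPos.or_neg b i).resolve_left hi
  · intro i hi
    simp only [Finset.mem_filter, Finset.mem_univ, true_and] at hi ⊢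
    intro h
    exact (RootPairing.Base.IsPos.neg_iff_not b i).1 h hi
  · intro i _
    exact neg_neg i
  · intro i _
    exact neg_neg i
  · intro i _
    exact (hF i).symm

/-- Opposite roots contribute equal factors, and `(sin²) ^ (k/4) = |sin| ^ (k/2)`, so passing to
positive roots doubles the exponent to `k`. -/
theorem groundState_eq_phiReg (b : R.Base) (hk : ∀ i j, k (R.reflectionPerm i j) = k j) (h : V) :
    groundState R b k h = phiReg R k 0 h := by
  classical
  have hpow : ∀ i, |sinRoot R i h| ^ k i = (sinPow R k 0 i h) ^ 2 := by
    intro i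
    rw [sinPow, add_zero, ← sq_abs (sinRoot R i h), ← Real.rpow_natCast _ 2,
      ← Real.rpow_natCast _ 2, ← Real.rpow_mul (abs_nonneg _), ← Real.rpow_mul (abs_nonneg _),
      sinRoot]
    congr 1
    push_cast
    ring
  rw [phiReg, prod_eq_prod_pos_sq b _ fun i => by
    rw [sinPow, sinPow, sinRoot_reflectionPerm_self, neg_sq, hk], ← Finset.prod_pow, groundState]
  exact Finset.prod_congr rfl fun i _ => hpow i

theorem phiReg_zero_ne_zero {h : V} (hs : ∀ i, sinRoot R i h ≠ 0) : phiReg R k 0 h ≠ 0 := by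
  refine Finset.prod_ne_zero_iff.2 fun i _ => ?_
  have : 0 < sinRoot R i h ^ 2 + 0 := by
    rw [add_zero]
    exact sq_pos_of_ne_zero (hs i)
  exact (Real.rpow_pos_of_pos this _).ne'

theorem phiReg_coreflection (hk : ∀ i j, k (R.reflectionPerm i j) = k j) (ε : ℝ) (i : ι) (h : V) :
    phiReg R k ε (R.coreflection i h) = phiReg R k ε h := by
  have : ∀ j, sinPow R k ε j (R.coreflection i h) = sinPow R k ε (R.reflectionPerm i j) h := by
    intro j
    rw [sinPow, sinPow, sinRoot, sinRoot, root'_reflectionPerm, hk]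
  rw [phiReg, phiReg]
  simp only [this]
  exact Equiv.prod_comp (R.reflectionPerm i) fun j => sinPow R k ε j h

/-- The coefficient of `℘(⟨α, h⟩)` in the potential. -/
def potentialCoeff (R : RootPairing ι ℝ M V) (k : ι → ℝ) (i : ι) : ℝ :=
  k i * (k i - 1) * rootNormSq R i

section
variable [IsWeylInvariantInner R]

theorem potentialCoeff_reflectionPerm (hk : ∀ i j, k (R.reflectionPerm i j) = k j) (i j : ι) :
    potentialCoeff R k (R.reflectionPerm i j) = potentialCoeff R k j := by
  rw [potentialCoeff, hk, rootNormSq_reflectionPerm, potentialCoeff]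

theorem potential_eq_sum (b : R.Base) (hk : ∀ i j, k (R.reflectionPerm i j) = k j)
    (p : Set.Ioo (-1 : ℝ) 1) (h : V) :
    potential R b k p h = 1 / 2 * ∑ i, (potentialCoeff R k i : ℂ) * wp p (R.root' i h) := by
  rw [sum_eq_two_mul_sum_pos R b _ fun i => by
    rw [potentialCoeff_reflectionPerm hk, root'_reflectionPerm_self, wp_neg], potential]
  simp only [potentialCoeff]
  ring

variable [R.IsCrystallographic] [R.IsReduced]

/-- The Laplacian of the ground state, divided by the ground state. -/
theorem exists_quadReg_zero_eq (hk : ∀ i j, k (R.reflectionPerm i j) = k j) :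
    ∃ K : ℝ, ∀ h : V, (∀ i, sinRoot R i h ≠ 0) →
      quadReg R k 0 h = K + 1 / 2 * ∑ i, potentialCoeff R k i * (1 / (4 * sinRoot R i h ^ 2)) := by
  obtain ⟨K, hK⟩ := exists_sum_cotan_eq (R := R) hk
  refine ⟨1 / 16 * K, fun h hs => ?_⟩
  have h1 : ∑ q : ι × ι, k q.1 * k q.2 * gram R q.1 q.2 * (cotReg R 0 q.1 h * cotReg R 0 q.2 h) =
      K + ∑ i, 2 * k i ^ 2 * gram R i i / sinRoot R i h ^ 2 := by
    refine Eq.trans ?_ (hK h hs)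
    exact Finset.sum_congr rfl fun q _ => by rw [cotReg_zero (hs q.1), cotReg_zero (hs q.2)]
  rw [quadReg, h1, mul_add, add_assoc, Finset.mul_sum, Finset.mul_sum, ← Finset.sum_add_distrib]
  congr 1
  refine Finset.sum_congr rfl fun i _ => ?_
  -- The coefficients match because `2k²/16 - k/8 = k(k - 1)/8`.
  rw [cotRegDeriv_zero (hs i), potentialCoeff, rootNormSq_eq_gram]
  have := hs i
  field_simp
  ring

/-- The value of the constant in the formula for the Laplacian of the ground state. -/
def quadConst (hk : ∀ i j, k (R.reflectionPerm i j) = k j) : ℝ :=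
  (exists_quadReg_zero_eq (R := R) hk).choose

/-- The bounded difference between the potential and the Laplacian of the ground state divided by
the ground state. -/
def multiplier (hk : ∀ i j, k (R.reflectionPerm i j) = k j) (p : Set.Ioo (-1 : ℝ) 1) (h : V) : ℂ :=
  1 / 2 * ∑ i, (potentialCoeff R k i : ℂ) *
    (wp p (R.root' i h) - ((1 / (4 * Real.sin (R.root' i h / 2) ^ 2) : ℝ) : ℂ)) -
      (quadConst (R := R) hk : ℂ)

variable (hk : ∀ i j, k (R.reflectionPerm i j) = k j) (p : Set.Ioo (-1 : ℝ) 1)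

theorem multiplier_eq (b : R.Base) {h : V} (hs : ∀ i, sinRoot R i h ≠ 0) :
    multiplier hk p h = potential R b k p h - quadReg R k 0 h := by
  rw [(exists_quadReg_zero_eq (R := R) hk).choose_spec h hs, potential_eq_sum b hk, multiplier,
    quadConst]
  simp only [mul_sub, Finset.sum_sub_distrib, sinRoot]
  push_cast
  ring

theorem exists_bound_multiplier : ∃ C : ℝ, ∀ h : V, ‖multiplier (R := R) hk p h‖ ≤ C := by
  obtain ⟨C, hC⟩ := exists_bound_wp_sub p
  refine ⟨1 / 2 * ∑ i, |potentialCoeff R k i| * C + |quadConst (R := R) hk|, fun h => ?_⟩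
  refine (norm_sub_le _ _).trans (add_le_add ?_ (by simp))
  rw [norm_mul]
  refine mul_le_mul (by simp) ((norm_sum_le _ _).trans (Finset.sum_le_sum fun i _ => ?_))
    (norm_nonneg _) (by norm_num)
  rw [norm_mul, Complex.norm_real, Real.norm_eq_abs]
  exact mul_le_mul_of_nonneg_left (hC _) (abs_nonneg _)

theorem star_multiplier (h : V) : star (multiplier (R := R) hk p h) = multiplier hk p h := by
  have hr : ∀ r : ℝ, star (r : ℂ) = r := Complex.conj_ofReal
  have h2 : star (1 / 2 : ℂ) = 1 / 2 := by simp
  simp only [multiplier, star_sub, star_mul', star_sum, star_wp, hr, h2]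

theorem measurable_multiplier [MeasurableSpace V] [BorelSpace V] :
    Measurable (multiplier (R := R) hk p) := by
  have h1 : ∀ i, Measurable fun h => wp p (R.root' i h) := fun i =>
    (measurable_wp p).comp (continuous_root' i).measurable
  have h2 : ∀ i, Measurable fun h => R.root' i h := fun i => (continuous_root' i).measurable
  unfold multiplier
  fun_prop

theorem isPeriodic_multiplier [R.IsRootSystem] : IsPeriodic R (multiplier (R := R) hk p) := by
  intro x l hl
  have h1 : ∀ i, Real.sin (R.root' i (x + l) / 2) ^ 2 = Real.sin (R.root' i x / 2) ^ 2 := fun i =>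
    isPeriodic_sinRoot_sq i x l hl
  simp only [multiplier, wp_periodic R p _ x l hl, h1]

theorem multiplier_coreflection (i : ι) (h : V) :
    multiplier hk p (R.coreflection i h) = multiplier hk p h := by
  simp only [multiplier]
  congr 2
  rw [← Equiv.sum_comp (R.reflectionPerm i)]
  refine Finset.sum_congr rfl fun j _ => ?_
  have h1 := root'_reflectionPerm R i j (R.coreflection i h)
  rw [R.coreflection_same] at h1
  rw [potentialCoeff_reflectionPerm hk, h1]

end

end Multiplier

/-! ### Bounded multiplication operators on the invariant functions -/

section MultiplicationOperator
variable {ι M V : Type*} [AddCommGroup M] [Module ℝ M]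
  [NormedAddCommGroup V] [InnerProductSpace ℝ V] [FiniteDimensional ℝ V]
  [Finite ι] {R : RootPairing ι ℝ M V} [R.IsRootSystem]

theorem memLp_bdd_mul {g f : Torus R → ℂ} (hg : AEStronglyMeasurable g (haar R)) {C : ℝ}
    (hC : ∀ t, ‖g t‖ ≤ C) (hf : MemLp f 2 (haar R)) : MemLp (fun t => g t * f t) 2 (haar R) :=
  hf.of_le_mul (c := C) (hg.mul hf.1) (ae_of_all _ fun t => by
    rw [norm_mul]
    exact mul_le_mul_of_nonneg_right (hC t) (norm_nonneg _))

theorem toLp_mem_invariantSubmodule {f : Torus R → ℂ} (hf : MemLp f 2 (haar R))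
    (hinv : ∀ i, (fun t => f (reflT R i t)) =ᵐ[haar R] f) :
    hf.toLp f ∈ invariantSubmodule R := by
  rw [mem_invariantSubmodule_iff]
  intro i
  have h := hf.coeFn_toLp
  have h1 := (measurePreserving_reflT R i).quasiMeasurePreserving.ae_eq_comp h
  exact h1.trans ((hinv i).trans h.symm)

/-- The class in `L²(T, dμ)^W` of an invariant square-integrable function. -/
def toL2W (f : Torus R → ℂ) (hf : MemLp f 2 (haar R))
    (hinv : ∀ i, (fun t => f (reflT R i t)) =ᵐ[haar R] f) : L2W R :=
  ⟨hf.toLp f, toLp_mem_invariantSubmodule hf hinv⟩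

theorem coeFn_toL2W (f : Torus R → ℂ) (hf : MemLp f 2 (haar R))
    (hinv : ∀ i, (fun t => f (reflT R i t)) =ᵐ[haar R] f) :
    ((toL2W f hf hinv : L2W R) : Lp ℂ 2 (haar R)) =ᵐ[haar R] f := hf.coeFn_toLp

theorem L2W_ext {u v : L2W R}
    (h : (u : Lp ℂ 2 (haar R)) =ᵐ[haar R] (v : Lp ℂ 2 (haar R))) : u = v :=
  Subtype.ext (Lp.ext h)

theorem onTorus_reflT {f : V → ℂ} (hf : IsPeriodic R f)
    (hinv : ∀ i x, f (R.coreflection i x) = f x) (i : ι) (t : Torus R) :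
    onTorus R f (reflT R i t) = onTorus R f t := by
  obtain ⟨x, rfl⟩ := (Torus.isQuotientMap_mk R).surjective t
  rw [reflT_mk, onTorus_mk R hf, onTorus_mk R hf, hinv]

theorem exists_multiplication_operator {g : Torus R → ℂ} (hg : AEStronglyMeasurable g (haar R))
    {C : ℝ} (hC : ∀ t, ‖g t‖ ≤ C) (hinv : ∀ i t, g (reflT R i t) = g t) :
    ∃ A : L2W R →L[ℂ] L2W R, ∀ u : L2W R,
      (A u : Lp ℂ 2 (haar R)) =ᵐ[haar R] fun t => g t * (u : Lp ℂ 2 (haar R)) t := by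
  have hm : ∀ u : L2W R, MemLp (fun t => g t * (u : Lp ℂ 2 (haar R)) t) 2 (haar R) := fun u =>
    memLp_bdd_mul hg hC (Lp.memLp _)
  have hi : ∀ (u : L2W R) i, (fun t => g (reflT R i t) * (u : Lp ℂ 2 (haar R)) (reflT R i t))
      =ᵐ[haar R] fun t => g t * (u : Lp ℂ 2 (haar R)) t := by
    intro u i
    filter_upwards [(mem_invariantSubmodule_iff R).1 u.2 i] with t ht
    rw [ht, hinv]
  let L : L2W R →ₗ[ℂ] L2W R :=
    { toFun u := toL2W _ (hm u) (hi u)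
      map_add' u v := by
        apply L2W_ext
        filter_upwards [coeFn_toL2W _ (hm (u + v)) (hi (u + v)), coeFn_toL2W _ (hm u) (hi u),
          coeFn_toL2W _ (hm v) (hi v), Lp.coeFn_add (u : Lp ℂ 2 (haar R)) v,
          Lp.coeFn_add ((toL2W _ (hm u) (hi u) : L2W R) : Lp ℂ 2 (haar R)) (toL2W _ (hm v) (hi v))]
          with t h1 h2 h3 h4 h5
        rw [h1]
        refine Eq.trans ?_ h5.symm
        rw [Pi.add_apply, h2, h3, ← mul_add]
        exact congr_arg _ h4
      map_smul' c u := by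
        apply L2W_ext
        filter_upwards [coeFn_toL2W _ (hm (c • u)) (hi (c • u)), coeFn_toL2W _ (hm u) (hi u),
          Lp.coeFn_smul c (u : Lp ℂ 2 (haar R)),
          Lp.coeFn_smul c ((toL2W _ (hm u) (hi u) : L2W R) : Lp ℂ 2 (haar R))]
          with t h1 h2 h4 h5
        rw [h1]
        refine Eq.trans ?_ h5.symm
        rw [Pi.smul_apply, h2, smul_eq_mul, mul_left_comm]
        exact congr_arg _ h4 }
  refine ⟨L.mkContinuous C fun u => ?_, fun u => coeFn_toL2W _ (hm u) (hi u)⟩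
  refine Lp.norm_le_mul_norm_of_ae_le_mul (f := ((L u : L2W R) : Lp ℂ 2 (haar R)))
    (g := (u : Lp ℂ 2 (haar R))) ?_
  filter_upwards [coeFn_toL2W _ (hm u) (hi u)] with t ht
  refine (congr_arg norm ht).le.trans ?_
  rw [norm_mul]
  exact mul_le_mul_of_nonneg_right (hC t) (norm_nonneg _)

theorem inner_L2W (u v : L2W R) : inner ℂ u v = ∫ t, (v : Lp ℂ 2 (haar R)) t *
    star ((u : Lp ℂ 2 (haar R)) t) ∂haar R := rfl

end MultiplicationOperator
end CalogeroMoser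

end

noncomputable section
namespace CalogeroMoser
open MeasureTheory Laplacian

/-! ### Exponentials of weights -/

section Exponentials
variable {ι M V : Type*} [AddCommGroup M] [Module ℝ M]
  [NormedAddCommGroup V] [InnerProductSpace ℝ V] [FiniteDimensional ℝ V]
  [Finite ι] {R : RootPairing ι ℝ M V} [R.IsRootSystem]

theorem contDiff_expWeight (w : M) {n : WithTop ℕ∞} : ContDiff ℝ n (expWeight R w) := by
  have h : ContDiff ℝ n fun h : V => R.toLinearMap w h :=
    (LinearMap.toContinuousLinearMap (R.toLinearMap w)).contDiff
  have h2 : ContDiff ℝ n fun h : V => ((R.toLinearMap w h : ℝ) : ℂ) :=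
    Complex.ofRealCLM.contDiff.comp h
  exact (contDiff_const.mul h2).cexp

theorem fderiv_expWeight (w : M) (h v : V) :
    fderiv ℝ (expWeight R w) h v = Complex.I * (R.toLinearMap w v : ℝ) * expWeight R w h := by
  have h1 : HasFDerivAt (fun h : V => ((R.toLinearMap w h : ℝ) : ℂ))
      (Complex.ofRealCLM.comp (LinearMap.toContinuousLinearMap (R.toLinearMap w))) h :=
    (Complex.ofRealCLM.comp (LinearMap.toContinuousLinearMap (R.toLinearMap w))).hasFDerivAt
  have h2 : HasFDerivAt (expWeight R w) _ h := (h1.const_mul Complex.I).cexp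
  rw [h2.fderiv]
  simp [expWeight]
  ring

theorem expWeight_add (w w' : M) (h : V) :
    expWeight R (w + w') h = expWeight R w h * expWeight R w' h := by
  rw [expWeight, expWeight, expWeight, ← Complex.exp_add]
  simp
  ring_nf

theorem expWeight_zero (h : V) : expWeight R (0 : M) h = 1 := by
  simp [expWeight]

theorem star_expWeight (w : M) (h : V) : star (expWeight R w h) = expWeight R (-w) h := by
  rw [expWeight, expWeight, Complex.star_def, ← Complex.exp_conj]
  simp

theorem expWeight_coreflection (w : M) (i : ι) (h : V) :
    expWeight R w (R.coreflection i h) = expWeight R (R.reflection i w) h := by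
  have : R.toLinearMap w (R.coreflection i h) = R.toLinearMap (R.reflection i w) h := by
    have h1 : R.toLinearMap w (R.coroot i) = R.coroot' i w := rfl
    have h2 : R.toLinearMap (R.root i) h = R.root' i h := rfl
    rw [R.coreflection_apply, R.reflection_apply, map_sub, map_smul, map_sub, map_smul,
      LinearMap.sub_apply, LinearMap.smul_apply, h1, h2, smul_eq_mul, smul_eq_mul, mul_comm]
  rw [expWeight, expWeight, this]

theorem isPeriodic_expWeight {w : M} (hw : w ∈ weightLattice R) : IsPeriodic R (expWeight R w) := by
  intro x l hl
  obtain ⟨n, hn⟩ := weight_apply_mem_of_mem_periodLattice hw hl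
  rw [expWeight, expWeight, map_add, hn]
  refine Complex.exp_eq_exp_iff_exists_int.2 ⟨n, ?_⟩
  push_cast
  ring

theorem coroot'_apply_reflection (i j : ι) (w : M) :
    R.coroot' j (R.reflection i w) = R.coroot' (R.reflectionPerm i j) w :=
  (LinearMap.congr_fun (R.coroot'_reflectionPerm (i := i) (j := j)) w).symm

theorem reflection_mem_weightLattice {w : M} (hw : w ∈ weightLattice R) (i : ι) :
    R.reflection i w ∈ weightLattice R := by
  intro j
  rw [coroot'_apply_reflection]
  exact hw _

end Exponentials

/-! ### Finite saturated sets of weights -/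

section WeightBox
variable {ι M V : Type*} [AddCommGroup M] [Module ℝ M]
  [NormedAddCommGroup V] [InnerProductSpace ℝ V] [FiniteDimensional ℝ V]
  [Finite ι] (R : RootPairing ι ℝ M V) [R.IsRootSystem]

/-- The weights whose values on the coroots are at most `N` in absolute value. -/
def weightBox (N : ℕ) : Set M := {w | w ∈ weightLattice R ∧ ∀ i, |R.coroot' i w| ≤ N}

variable {R}

theorem coroot'_injective : Function.Injective fun (w : M) i => R.coroot' i w := by
  intro v w h
  apply R.toPerfPair.injective
  refine LinearMap.ext_on (RootPairing.IsRootSystem.span_coroot_eq_top (P := R)) ?_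
  rintro _ ⟨i, rfl⟩
  exact congr_fun h i

theorem finite_weightBox (N : ℕ) : (weightBox R N).Finite := by
  have := Fintype.ofFinite ι
  classical
  have hfin : (Set.univ.pi fun _ : ι => ((fun n : ℤ => (n : ℝ)) '' Set.Icc (-N : ℤ) N)).Finite :=
    Set.Finite.pi fun _ => (Set.finite_Icc _ _).image _
  refine Set.Finite.of_finite_image (f := fun (w : M) i => R.coroot' i w) (hfin.subset ?_)
    (coroot'_injective.injOn)
  rintro _ ⟨w, ⟨hw, hN⟩, rfl⟩
  refine Set.mem_univ_pi.2 fun i => ?_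
  obtain ⟨n, hn⟩ := hw i
  refine ⟨n, ?_, hn.symm⟩
  have := hN i
  rw [hn, abs_le] at this
  exact ⟨by exact_mod_cast this.1, by exact_mod_cast this.2⟩

theorem reflection_mem_weightBox {N : ℕ} {w : M} (hw : w ∈ weightBox R N) (i : ι) :
    R.reflection i w ∈ weightBox R N := by
  refine ⟨reflection_mem_weightLattice hw.1 i, fun j => ?_⟩
  rw [coroot'_apply_reflection]
  exact hw.2 _

theorem weightBox_mono {N N' : ℕ} (h : N ≤ N') : weightBox R N ⊆ weightBox R N' :=
  fun _ hw => ⟨hw.1, fun i => (hw.2 i).trans (by exact_mod_cast h)⟩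

theorem exists_mem_weightBox {w : M} (hw : w ∈ weightLattice R) :
    ∃ N, w ∈ weightBox R N := by
  have := Fintype.ofFinite ι
  obtain ⟨N, hN⟩ := exists_nat_ge (∑ i, |R.coroot' i w|)
  exact ⟨N, hw, fun i => (Finset.single_le_sum (f := fun i => |R.coroot' i w|)
    (fun _ _ => abs_nonneg _) (Finset.mem_univ i)).trans hN⟩

/-- Each pairing of `w - jα` with a coroot is affine in `j`, so it lies between its values at `w`
(for `j = 0`) and at `s_α w` (for `j = n`), both of which are in the box. This saturation is why
dividing by `1 - e^{-iα}` does not enlarge the set of weights. -/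
theorem sub_nsmul_root_mem_weightBox [R.IsCrystallographic] {N : ℕ} {w : M}
    (hw : w ∈ weightBox R N) {i : ι} {n j : ℕ} (hn : R.coroot' i w = n) (hj : j ≤ n) :
    w - j • R.root i ∈ weightBox R N := by
  refine ⟨sub_mem hw.1 (nsmul_mem (root_mem_weightLattice i) j), fun l => ?_⟩
  rcases Nat.eq_zero_or_pos n with rfl | hn0
  · obtain rfl : j = 0 := by omega
    simpa using hw.2 l
  have h1 := abs_le.1 (hw.2 l)
  have h2 := abs_le.1 ((reflection_mem_weightBox hw i).2 l)
  have hn0' : (0 : ℝ) < n := by exact_mod_cast hn0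
  have hj' : (j : ℝ) ≤ n := by exact_mod_cast hj
  rw [R.reflection_apply, map_sub, map_smul, hn, smul_eq_mul] at h2
  set x := R.coroot' l w
  set y := R.coroot' l (R.root i)
  have hj0 : (0 : ℝ) ≤ j := j.cast_nonneg
  rw [map_sub, map_nsmul, nsmul_eq_mul, abs_le]
  constructor
  · by_contra hc
    push Not at hc
    nlinarith
  · by_contra hc
    push Not at hc
    nlinarith

end WeightBox

/-! ### Trigonometric polynomials -/

section Polynomials
variable {ι M V : Type*} [AddCommGroup M] [Module ℝ M]
  [NormedAddCommGroup V] [InnerProductSpace ℝ V] [FiniteDimensional ℝ V]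
  [Finite ι] (R : RootPairing ι ℝ M V) [R.IsRootSystem]

/-- The trigonometric polynomials with weights in `weightBox R N`. -/
def polyBox (N : ℕ) : Submodule ℂ (V → ℂ) := Submodule.span ℂ (expWeight R '' weightBox R N)

instance finiteDimensional_polyBox (N : ℕ) :
    FiniteDimensional ℂ (polyBox R N) :=
  FiniteDimensional.span_of_finite ℂ ((finite_weightBox N).image _)

variable {R}

theorem expWeight_mem_polyBox {N : ℕ} {w : M} (hw : w ∈ weightBox R N) :
    expWeight R w ∈ polyBox R N := Submodule.subset_span ⟨w, hw, rfl⟩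

theorem polyBox_mono {N N' : ℕ} (h : N ≤ N') : polyBox R N ≤ polyBox R N' :=
  Submodule.span_mono (Set.image_mono (weightBox_mono h))

theorem polyBox_le (N : ℕ) : polyBox R N ≤ Submodule.span ℂ (expWeight R '' weightLattice R) :=
  Submodule.span_mono (Set.image_mono fun _ hw => hw.1)

theorem exists_mem_polyBox {F : V → ℂ}
    (hF : F ∈ Submodule.span ℂ (expWeight R '' weightLattice R)) : ∃ N, F ∈ polyBox R N := by
  refine Submodule.span_induction (p := fun F _ => ∃ N, F ∈ polyBox R N) ?_ ⟨0, zero_mem _⟩ ?_ ?_ hF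
  · rintro _ ⟨w, hw, rfl⟩
    obtain ⟨N, hN⟩ := exists_mem_weightBox hw
    exact ⟨N, expWeight_mem_polyBox hN⟩
  · rintro F G _ _ ⟨N, hN⟩ ⟨N', hN'⟩
    exact ⟨max N N', add_mem (polyBox_mono (le_max_left _ _) hN) (polyBox_mono (le_max_right _ _) hN')⟩
  · rintro c F _ ⟨N, hN⟩
    exact ⟨N, Submodule.smul_mem _ c hN⟩


theorem contDiff_of_mem_span {F : V → ℂ}
    (hF : F ∈ Submodule.span ℂ (expWeight R '' weightLattice R)) {n : WithTop ℕ∞} :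
    ContDiff ℝ n F := by
  refine Submodule.span_induction (p := fun F _ => ContDiff ℝ n F) ?_ contDiff_const ?_ ?_ hF
  · rintro _ ⟨w, hw, rfl⟩
    exact contDiff_expWeight w
  · exact fun F G _ _ hF hG => hF.add hG
  · exact fun c F _ hF => hF.const_smul c

theorem isPeriodic_of_mem_span {F : V → ℂ}
    (hF : F ∈ Submodule.span ℂ (expWeight R '' weightLattice R)) : IsPeriodic R F := by
  refine Submodule.span_induction (p := fun F _ => IsPeriodic R F) ?_ (fun _ _ _ => rfl) ?_ ?_ hF
  · rintro _ ⟨w, hw, rfl⟩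
    exact isPeriodic_expWeight hw
  · exact fun F G _ _ hF hG x l hl => congr_arg₂ (· + ·) (hF x l hl) (hG x l hl)
  · exact fun c F _ hF x l hl => congr_arg (c * ·) (hF x l hl)

theorem fderiv_mem_polyBox {N : ℕ} {F : V → ℂ} (hF : F ∈ polyBox R N) (v : V) :
    (fun h => fderiv ℝ F h v) ∈ polyBox R N := by
  have hd : ∀ F ∈ polyBox R N, ∀ h, DifferentiableAt ℝ F h := fun F hF h =>
    ((contDiff_of_mem_span (n := 1) (polyBox_le N hF)).differentiable one_ne_zero) h
  refine Submodule.span_induction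
    (p := fun F _ => (fun h => fderiv ℝ F h v) ∈ polyBox R N) ?_ ?_ ?_ ?_ hF
  · rintro _ ⟨w, hw, rfl⟩
    have : (fun h => fderiv ℝ (expWeight R w) h v) =
        (Complex.I * (R.toLinearMap w v : ℝ)) • expWeight R w := by
      funext h
      rw [fderiv_expWeight]
      rfl
    rw [this]
    exact Submodule.smul_mem _ _ (expWeight_mem_polyBox hw)
  · have : (fun h => fderiv ℝ (0 : V → ℂ) h v) = 0 := by
      funext h
      simp
    rw [this]
    exact zero_mem _
  · intro F G hF hG h1 h2
    have : (fun h => fderiv ℝ (F + G) h v) = (fun h => fderiv ℝ F h v) + fun h => fderiv ℝ G h v := by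
      funext h
      rw [fderiv_add (hd F hF h) (hd G hG h)]
      rfl
    rw [this]
    exact add_mem h1 h2
  · intro c F hF h1
    have : (fun h => fderiv ℝ (c • F) h v) = c • fun h => fderiv ℝ F h v := by
      funext h
      rw [fderiv_const_smul (hd F hF h)]
      rfl
    rw [this]
    exact Submodule.smul_mem _ _ h1

theorem laplacian_mem_polyBox {N : ℕ} {F : V → ℂ} (hF : F ∈ polyBox R N) :
    laplacian F ∈ polyBox R N := by
  have : laplacian F = ∑ v, secondDeriv F (stdOrthonormalBasis ℝ V v) := by
    funext h
    rw [laplacian_eq_sum_secondDeriv (stdOrthonormalBasis ℝ V)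
      (contDiff_of_mem_span (polyBox_le N hF)), Finset.sum_apply]
  rw [this]
  exact sum_mem fun v _ => fderiv_mem_polyBox (fderiv_mem_polyBox hF _) _

theorem star_mem_span {F : V → ℂ}
    (hF : F ∈ Submodule.span ℂ (expWeight R '' weightLattice R)) :
    (fun h => star (F h)) ∈ Submodule.span ℂ (expWeight R '' weightLattice R) := by
  refine Submodule.span_induction
    (p := fun F _ => (fun h => star (F h)) ∈ Submodule.span ℂ (expWeight R '' weightLattice R))
    ?_ ?_ ?_ ?_ hF
  · rintro _ ⟨w, hw, rfl⟩
    simp only [star_expWeight]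
    exact Submodule.subset_span ⟨-w, neg_mem hw, rfl⟩
  · simp only [Pi.zero_apply, star_zero]
    exact zero_mem _
  · intro F G _ _ h1 h2
    simp only [Pi.add_apply, star_add]
    exact add_mem h1 h2
  · intro c F _ h1
    simp only [Pi.smul_apply, smul_eq_mul, star_mul']
    exact Submodule.smul_mem _ (star c) h1

theorem star_mem_invariantPolynomials {F : V → ℂ} (hF : F ∈ invariantPolynomials R) :
    (fun h => star (F h)) ∈ invariantPolynomials R :=
  ⟨star_mem_span hF.1, fun i h => congr_arg star (hF.2 i h)⟩

/-- This is `cot (x/2) (1 - e^{-ix}) = i (1 + e^{-ix})` cleared of its denominator. -/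
theorem cos_mul_one_sub_exp (x : ℝ) :
    (Real.cos (x / 2) : ℂ) * (1 - Complex.exp (-(Complex.I * x))) =
      Complex.I * (1 + Complex.exp (-(Complex.I * x))) * Real.sin (x / 2) := by
  have h1 : Complex.exp (-(Complex.I * x)) = Complex.exp (-((x / 2 : ℂ) * Complex.I)) *
      Complex.exp (-((x / 2 : ℂ) * Complex.I)) := by
    rw [← Complex.exp_add]
    ring_nf
  rw [h1, Complex.ofReal_cos, Complex.ofReal_sin, Complex.ofReal_div, Complex.ofReal_ofNat,
    ← neg_mul, Complex.exp_mul_I, Complex.cos_neg, Complex.sin_neg]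
  set c := Complex.cos (x / 2 : ℂ)
  set s := Complex.sin (x / 2 : ℂ)
  have h2 : s ^ 2 + c ^ 2 = 1 := Complex.sin_sq_add_cos_sq _
  have h3 := Complex.I_sq
  linear_combination (c - Complex.I * s) * s ^ 2 * h3 - (c - Complex.I * s) * h2

/-- With `z = e^{-iα}` and `n = ⟨w, α^∨⟩ ≥ 0`, the difference `e^w - e^{s_α w}` is `e^w (1 - z)(1 +
z + ... + z^{n-1})`, and the factor `1 - z` cancels the pole of `cot (α/2)`. The weights of the
quotient lie on the string from `w` to `s_α w`. For `n < 0` the weights `w` and `s_α w` are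
exchanged. -/
theorem exists_cos_mul_sub_eq_exp [R.IsCrystallographic] {N : ℕ} {w : M}
    (hw : w ∈ weightBox R N) (i : ι) :
    ∃ G ∈ polyBox R N, ∀ h, G h * sinRoot R i h =
      cosRoot R i h * (expWeight R w h - expWeight R w (R.coreflection i h)) := by
  have key : ∀ w ∈ weightBox R N, ∀ n : ℕ, R.coroot' i w = n → ∃ G ∈ polyBox R N, ∀ h,
      G h * sinRoot R i h =
        cosRoot R i h * (expWeight R w h - expWeight R w (R.coreflection i h)) := by
    intro w hw n hn
    refine ⟨∑ j ∈ Finset.range n, Complex.I •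
      (expWeight R (w - j • R.root i) + expWeight R (w - (j + 1) • R.root i)),
      sum_mem fun j hj => Submodule.smul_mem _ _ (add_mem
        (expWeight_mem_polyBox (sub_nsmul_root_mem_weightBox hw hn (Finset.mem_range.1 hj).le))
        (expWeight_mem_polyBox (sub_nsmul_root_mem_weightBox hw hn (Finset.mem_range.1 hj)))),
      fun h => ?_⟩
    set z := Complex.exp (-(Complex.I * (R.root' i h : ℝ))) with hz
    have he : ∀ j : ℕ, expWeight R (w - j • R.root i) h = expWeight R w h * z ^ j := by
      intro j
      rw [sub_eq_add_neg, expWeight_add, hz, ← Complex.exp_nat_mul]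
      congr 1
      have : R.toLinearMap (R.root i) h = R.root' i h := rfl
      rw [expWeight, map_neg, map_nsmul, LinearMap.neg_apply, LinearMap.smul_apply, this,
        nsmul_eq_mul]
      push_cast
      ring_nf
    have hr : expWeight R w (R.coreflection i h) = expWeight R w h * z ^ n := by
      rw [expWeight_coreflection, R.reflection_apply, hn, ← he, Nat.cast_smul_eq_nsmul]
    have hgeom := mul_neg_geom_sum z n
    have hc := cos_mul_one_sub_exp (R.root' i h)
    rw [← hz] at hc
    rw [Finset.sum_apply, hr]
    simp only [Pi.smul_apply, Pi.add_apply, he, smul_eq_mul, pow_succ]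
    have : ∑ j ∈ Finset.range n, Complex.I * (expWeight R w h * z ^ j + expWeight R w h * (z ^ j * z))
        = Complex.I * (1 + z) * expWeight R w h * ∑ j ∈ Finset.range n, z ^ j := by
      rw [Finset.mul_sum]
      exact Finset.sum_congr rfl fun j _ => by ring
    rw [this, sinRoot, cosRoot]
    linear_combination (Real.cos (R.root' i h / 2) : ℂ) * expWeight R w h * hgeom -
      expWeight R w h * (∑ j ∈ Finset.range n, z ^ j) * hc
  obtain ⟨n, hn⟩ := hw.1 i
  rcases Int.eq_nat_or_neg n with ⟨m, rfl | rfl⟩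
  · exact key w hw m (by exact_mod_cast hn)
  · obtain ⟨G, hG, h1⟩ := key (R.reflection i w) (reflection_mem_weightBox hw i) m (by
      rw [coroot'_apply_reflection]
      have : R.coroot' (R.reflectionPerm i i) w = -R.coroot' i w := by
        simp [RootPairing.coroot']
      rw [this, hn]
      simp)
    refine ⟨-G, neg_mem hG, fun h => ?_⟩
    have := h1 h
    rw [← expWeight_coreflection, ← expWeight_coreflection, R.coreflection_same] at this
    rw [Pi.neg_apply]
    linear_combination -this

theorem exists_cos_mul_sub_eq [R.IsCrystallographic] {N : ℕ} {F : V → ℂ} (hF : F ∈ polyBox R N)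
    (i : ι) : ∃ G ∈ polyBox R N, ∀ h,
      G h * sinRoot R i h = cosRoot R i h * (F h - F (R.coreflection i h)) := by
  refine Submodule.span_induction (p := fun F _ => ∃ G ∈ polyBox R N, ∀ h,
      G h * sinRoot R i h = cosRoot R i h * (F h - F (R.coreflection i h))) ?_ ?_ ?_ ?_ hF
  · rintro _ ⟨w, hw, rfl⟩
    exact exists_cos_mul_sub_eq_exp hw i
  · exact ⟨0, zero_mem _, fun h => by simp⟩
  · rintro F G _ _ ⟨F', h1, h2⟩ ⟨G', h3, h4⟩
    refine ⟨F' + G', add_mem h1 h3, fun h => ?_⟩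
    simp only [Pi.add_apply]
    linear_combination h2 h + h4 h
  · rintro c F _ ⟨F', h1, h2⟩
    refine ⟨c • F', Submodule.smul_mem _ c h1, fun h => ?_⟩
    simp only [Pi.smul_apply, smul_eq_mul]
    linear_combination c * h2 h

end Polynomials
end CalogeroMoser

end

noncomputable section
namespace CalogeroMoser
open MeasureTheory Laplacian

/-! ### The conjugated Laplacian on invariant polynomials -/

section ConjugatedLaplacian
variable {ι M V : Type*} [AddCommGroup M] [Module ℝ M]
  [NormedAddCommGroup V] [InnerProductSpace ℝ V] [FiniteDimensional ℝ V]
  [Fintype ι] {R : RootPairing ι ℝ M V} [R.IsRootSystem] {k : ι → ℝ}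

theorem fderiv_coreflection {F : V → ℂ} (hF : Differentiable ℝ F) {i : ι}
    (hinv : ∀ h, F (R.coreflection i h) = F h) (h v : V) :
    fderiv ℝ F (R.coreflection i h) (R.coreflection i v) = fderiv ℝ F h v := by
  let L : V →L[ℝ] V := LinearMap.toContinuousLinearMap (R.coreflection i : V →ₗ[ℝ] V)
  have h1 : HasFDerivAt (F ∘ L) ((fderiv ℝ F (L h)).comp L) h :=
    (hF (L h)).hasFDerivAt.comp h L.hasFDerivAt
  have h2 : F ∘ L = F := funext hinv
  rw [h2] at h1
  rw [h1.fderiv]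
  rfl

/-- The walls are null and Haar measure charges every nonempty open set, so equality almost
everywhere of continuous functions is equality. -/
theorem eq_of_eq_on_regular [R.IsCrystallographic] {f g : V → ℂ} (hf : IsPeriodic R f)
    (hg : IsPeriodic R g) (hfc : Continuous f) (hgc : Continuous g)
    (h : ∀ x, (∀ i, sinRoot R i x ≠ 0) → f x = g x) : f = g := by
  have h1 : onTorus R f = onTorus R g := by
    refine ((continuous_onTorus hf hfc).ae_eq_iff_eq (haar R) (continuous_onTorus hg hgc)).1 ?_
    filter_upwards [ae_regular (R := R)] with t ht
    exact h _ ht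
  rw [← onTorus_comp_mk hf, ← onTorus_comp_mk hg, h1]

variable [IsWeylInvariantInner R]

theorem laplacian_coreflection {F : V → ℂ} (hF : ContDiff ℝ 2 F) {i : ι}
    (hinv : ∀ h, F (R.coreflection i h) = F h) (h : V) :
    laplacian F (R.coreflection i h) = laplacian F h := by
  let e : V ≃ₗᵢ[ℝ] V := (R.coreflection i).isometryOfInner
    (IsWeylInvariantInner.inner_coreflection i)
  have h1 := laplacian_comp_isometry e hF h
  have h2 : (fun y => F (e y)) = F := funext hinv
  rw [h2] at h1
  exact h1.symm

theorem driftReg_coreflection (hk : ∀ i j, k (R.reflectionPerm i j) = k j) (ε : ℝ) {F : V → ℂ}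
    (hF : Differentiable ℝ F) {j : ι} (hinv : ∀ h, F (R.coreflection j h) = F h) (h : V) :
    driftReg R k ε F (R.coreflection j h) = driftReg R k ε F h := by
  rw [driftReg, driftReg, ← Equiv.sum_comp (R.reflectionPerm j)]
  refine Finset.sum_congr rfl fun i _ => ?_
  have h1 : R.root' (R.reflectionPerm j i) (R.coreflection j h) = R.root' i h := by
    rw [root'_reflectionPerm, R.coreflection_same]
  have h2 : cotReg R ε (R.reflectionPerm j i) (R.coreflection j h) = cotReg R ε i h := by
    rw [cotReg, cotReg, sinRoot, sinRoot, cosRoot, cosRoot, h1]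
  rw [h2, hk, rootVec_reflectionPerm, fderiv_coreflection hF hinv]

theorem fderiv_rootVec_coreflection {F : V → ℂ} (hF : Differentiable ℝ F) {i : ι}
    (hinv : ∀ h, F (R.coreflection i h) = F h) (h : V) :
    fderiv ℝ F (R.coreflection i h) (rootVec R i) = -fderiv ℝ F h (rootVec R i) := by
  have h1 := fderiv_coreflection hF hinv h (rootVec R i)
  rw [← rootVec_reflectionPerm, rootVec_reflectionPerm_self, map_neg] at h1
  rw [← h1, neg_neg]

variable [R.IsCrystallographic]

/-- The derivative of an invariant function along `α` is odd under `s_α`. It is thus half of its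
antisymmetrization, to which `exists_cos_mul_sub_eq` applies. -/
theorem exists_cos_mul_fderiv_eq {N : ℕ} {F : V → ℂ} (hF : F ∈ polyBox R N) {i : ι}
    (hinv : ∀ h, F (R.coreflection i h) = F h) :
    ∃ G ∈ polyBox R N, ∀ h,
      G h * sinRoot R i h = cosRoot R i h * fderiv ℝ F h (rootVec R i) := by
  obtain ⟨G, hG, h1⟩ := exists_cos_mul_sub_eq (fderiv_mem_polyBox hF (rootVec R i)) i
  refine ⟨(1 / 2 : ℂ) • G, Submodule.smul_mem _ _ hG, fun h => ?_⟩
  have h2 := h1 h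
  rw [fderiv_rootVec_coreflection ((contDiff_of_mem_span (n := 1)
    (polyBox_le N hF)).differentiable one_ne_zero) hinv] at h2
  rw [Pi.smul_apply, smul_eq_mul]
  linear_combination (1 / 2 : ℂ) * h2

/-- The radial derivative of an invariant polynomial vanishes on the walls. -/
theorem exists_norm_fderiv_le {N : ℕ} {F : V → ℂ} (hF : F ∈ polyBox R N)
    (hinv : ∀ i h, F (R.coreflection i h) = F h) :
    ∃ C : ℝ, 0 ≤ C ∧ ∀ i h, ‖fderiv ℝ F h (rootVec R i)‖ ≤ C * |sinRoot R i h| := by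
  have h0 : ∀ i, ∃ C : ℝ, 0 ≤ C ∧ ∀ h, ‖fderiv ℝ F h (rootVec R i)‖ ≤ C * |sinRoot R i h| := by
    intro i
    obtain ⟨G, hG, h1⟩ := exists_cos_mul_fderiv_eq hF (hinv i)
    have hd := fderiv_mem_polyBox hF (rootVec R i)
    obtain ⟨C, hC, hGb⟩ := exists_bound_of_continuous_periodic
      (isPeriodic_of_mem_span (polyBox_le N hG))
      (contDiff_of_mem_span (n := 0) (polyBox_le N hG)).continuous
    obtain ⟨C', hC', hDb⟩ := exists_bound_of_continuous_periodic
      (isPeriodic_of_mem_span (polyBox_le N hd))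
      (contDiff_of_mem_span (n := 0) (polyBox_le N hd)).continuous
    refine ⟨C + C', by positivity, fun h => ?_⟩
    set D := fderiv ℝ F h (rootVec R i)
    -- Write `D = cos · (cos D) + sin · (sin D)`. The first bracket equals `G sin`, so both terms
    -- carry a factor `sin`.
    have e : D = cosRoot R i h * (G h * sinRoot R i h) + sinRoot R i h * (sinRoot R i h * D) := by
      have h3 : ((sinRoot R i h : ℂ)) ^ 2 + (cosRoot R i h : ℂ) ^ 2 = 1 := by
        exact_mod_cast sinRoot_sq_add_cosRoot_sq (R := R) i h
      rw [h1 h]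
      linear_combination -D * h3
    have hc : |cosRoot R i h| ≤ 1 := Real.abs_cos_le_one _
    have hs : |sinRoot R i h| ≤ 1 := Real.abs_sin_le_one _
    rw [e]
    refine (norm_add_le _ _).trans ?_
    simp only [norm_mul, Complex.norm_real, Real.norm_eq_abs]
    have e1 : |cosRoot R i h| * (‖G h‖ * |sinRoot R i h|) ≤ 1 * (C * |sinRoot R i h|) :=
      mul_le_mul hc (mul_le_mul_of_nonneg_right (hGb h) (abs_nonneg _)) (by positivity) zero_le_one
    have e2 : |sinRoot R i h| * ‖D‖ ≤ 1 * C' := mul_le_mul hs (hDb h) (norm_nonneg _) zero_le_one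
    have e3 := mul_le_mul_of_nonneg_left e2 (abs_nonneg (sinRoot R i h))
    linarith
  choose C hC hb using h0
  refine ⟨∑ i, C i, Finset.sum_nonneg fun i _ => hC i, fun i h => (hb i h).trans ?_⟩
  exact mul_le_mul_of_nonneg_right (Finset.single_le_sum (fun i _ => hC i) (Finset.mem_univ i))
    (abs_nonneg _)

/-- The Laplacian conjugated by the ground state maps invariant polynomials to invariant
polynomials and does not enlarge the set of weights. -/
theorem exists_conjugated_laplacian_eq (hk : ∀ i j, k (R.reflectionPerm i j) = k j) {N : ℕ}
    {F : V → ℂ} (hF : F ∈ polyBox R N) (hinv : ∀ i h, F (R.coreflection i h) = F h) :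
    ∃ G ∈ polyBox R N, (∀ i h, G (R.coreflection i h) = G h) ∧
      ∀ h, (∀ i, sinRoot R i h ≠ 0) → G h = laplacian F h + 2 * driftReg R k 0 F h := by
  choose G hG h1 using fun i => exists_cos_mul_fderiv_eq hF (hinv i)
  have hFs := polyBox_le N hF
  -- On regular points `G i` is `cot (α/2) ∂_α F`, and twice the drift coefficient `k/4` gives
  -- `k/2`.
  have hreg : ∀ h, (∀ i, sinRoot R i h ≠ 0) →
      (laplacian F + ∑ i, ((k i / 2 : ℝ) : ℂ) • G i) h =
        laplacian F h + 2 * driftReg R k 0 F h := by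
    intro h hs
    rw [Pi.add_apply, Finset.sum_apply, driftReg, Finset.mul_sum]
    congr 1
    refine Finset.sum_congr rfl fun i _ => ?_
    have hs' : (sinRoot R i h : ℂ) ≠ 0 := by exact_mod_cast hs i
    have h2 := h1 i h
    have h3 : cotReg R 0 i h = cosRoot R i h / sinRoot R i h := by
      have := hs i
      rw [cotReg, add_zero]
      field_simp
    rw [Pi.smul_apply, smul_eq_mul, h3]
    push_cast
    field_simp
    linear_combination 4 * (k i : ℂ) * h2
  have hmem : laplacian F + ∑ i, ((k i / 2 : ℝ) : ℂ) • G i ∈ polyBox R N :=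
    add_mem (laplacian_mem_polyBox hF) (sum_mem fun i _ => Submodule.smul_mem _ _ (hG i))
  refine ⟨_, hmem, fun i => ?_, hreg⟩
  have hms := polyBox_le N hmem
  have hP := isPeriodic_of_mem_span hms
  have hC := (contDiff_of_mem_span (n := 0) hms).continuous
  refine congr_fun (eq_of_eq_on_regular (R := R) (fun x l hl => ?_) hP
    (hC.comp (LinearMap.continuous_of_finiteDimensional (R.coreflection i : V →ₗ[ℝ] V))) hC
    fun h hs => ?_)
  · rw [map_add]
    exact hP _ _ (coreflection_mem_periodLattice R i hl)
  · rw [hreg h hs, hreg _ fun j => ?_, laplacian_coreflection (contDiff_of_mem_span hFs) (hinv i),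
      driftReg_coreflection hk 0 ((contDiff_of_mem_span (n := 1) hFs).differentiable one_ne_zero)
        (hinv i)]
    rw [sinRoot, ← root'_reflectionPerm]
    exact hs _

end ConjugatedLaplacian

/-! ### Invariant polynomials times a fixed function -/

section PolyMap
variable {ι M V : Type*} [AddCommGroup M] [Module ℝ M]
  [NormedAddCommGroup V] [InnerProductSpace ℝ V] [FiniteDimensional ℝ V]
  [Fintype ι] {R : RootPairing ι ℝ M V} [R.IsRootSystem] {k : ι → ℝ}

/-- The class in `L²(T, dμ)^W` of an invariant continuous function. -/
def classOfContinuous (f : V → ℂ) (hf : IsPeriodic R f) (hc : Continuous f)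
    (hinv : ∀ i x, f (R.coreflection i x) = f x) : L2W R :=
  toL2W (onTorus R f) (memLp_of_continuous (continuous_onTorus hf hc))
    fun i => ae_of_all _ fun t => onTorus_reflT hf hinv i t

theorem coeFn_classOfContinuous (f : V → ℂ) (hf : IsPeriodic R f) (hc : Continuous f)
    (hinv : ∀ i x, f (R.coreflection i x) = f x) :
    ((classOfContinuous f hf hc hinv : L2W R) : Lp ℂ 2 (haar R)) =ᵐ[haar R] onTorus R f :=
  coeFn_toL2W _ _ _

/-- Multiplication of invariant polynomials by an invariant continuous function. -/
def polyMap (φ : V → ℂ) (hφ : IsPeriodic R φ) (hc : Continuous φ)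
    (hinv : ∀ i x, φ (R.coreflection i x) = φ x) : invariantPolynomials R →ₗ[ℂ] L2W R where
  toFun F := classOfContinuous (fun h => F.1 h * φ h)
    ((isPeriodic_of_mem_span F.2.1).mul hφ)
    ((contDiff_of_mem_span (n := 0) F.2.1).continuous.mul hc)
    fun i x => by rw [F.2.2, hinv]
  map_add' F G := by
    apply L2W_ext
    refine (coeFn_classOfContinuous _ _ _ _).trans (Filter.EventuallyEq.trans ?_
      (Lp.coeFn_add _ _).symm)
    refine Filter.EventuallyEq.trans (ae_of_all _ fun t => ?_)
      ((coeFn_classOfContinuous _ _ _ _).add (coeFn_classOfContinuous _ _ _ _)).symm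
    simp [onTorus, add_mul]
  map_smul' c F := by
    apply L2W_ext
    refine (coeFn_classOfContinuous _ _ _ _).trans (Filter.EventuallyEq.trans ?_
      (Lp.coeFn_smul _ _).symm)
    refine Filter.EventuallyEq.trans (ae_of_all _ fun t => ?_)
      ((coeFn_classOfContinuous _ _ _ _).const_smul c).symm
    simp [onTorus, mul_assoc]

theorem coeFn_polyMap (φ : V → ℂ) (hφ : IsPeriodic R φ) (hc : Continuous φ)
    (hinv : ∀ i x, φ (R.coreflection i x) = φ x) (F : invariantPolynomials R) :
    ((polyMap φ hφ hc hinv F : L2W R) : Lp ℂ 2 (haar R)) =ᵐ[haar R]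
      onTorus R fun h => F.1 h * φ h :=
  coeFn_classOfContinuous _ ((isPeriodic_of_mem_span F.2.1).mul hφ)
    ((contDiff_of_mem_span (n := 0) F.2.1).continuous.mul hc)
    fun i x => by rw [F.2.2, hinv]

theorem finiteDimensional_map_polyMap (N : ℕ) (A : invariantPolynomials R →ₗ[ℂ] L2W R) :
    FiniteDimensional ℂ
      (((polyBox R N).comap (invariantPolynomials R).subtype).map A) := by
  have : FiniteDimensional ℂ ((polyBox R N).comap (invariantPolynomials R).subtype) :=
    Module.Finite.of_injective
      (((invariantPolynomials R).subtype).restrict (p := (polyBox R N).comap (invariantPolynomials R).subtype)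
        (q := polyBox R N) fun _ h => h)
      fun x y h => Subtype.ext (Subtype.ext (congr_arg (fun z : polyBox R N => (z : V → ℂ)) h))
  infer_instance

end PolyMap
end CalogeroMoser

end

noncomputable section
namespace CalogeroMoser
open MeasureTheory Laplacian

/-! ### Completeness of the characters of the torus -/

section Characters
variable {ι M V : Type*} [AddCommGroup M] [Module ℝ M]
  [NormedAddCommGroup V] [InnerProductSpace ℝ V] [FiniteDimensional ℝ V]
  [Finite ι] (R : RootPairing ι ℝ M V) [R.IsRootSystem]

/-- The character of the torus given by a weight. -/
def torusCharacter (w : weightLattice R) : C(Torus R, ℂ) :=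
  ⟨onTorus R (expWeight R w), continuous_onTorus (isPeriodic_expWeight w.2)
    (contDiff_expWeight (n := 0) (w : M)).continuous⟩

variable {R} in
theorem torusCharacter_mk (w : weightLattice R) (x : V) :
    torusCharacter R w (Torus.mk R x) = expWeight R w x := onTorus_mk R (isPeriodic_expWeight w.2) x

/-- The star subalgebra of `C(T)` generated by the characters. -/
def characterSubalgebra : StarSubalgebra ℂ C(Torus R, ℂ) where
  toSubalgebra := Algebra.adjoin ℂ (Set.range (torusCharacter R))
  star_mem' := by
    change Algebra.adjoin ℂ (Set.range (torusCharacter R)) ≤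
      star (Algebra.adjoin ℂ (Set.range (torusCharacter R)))
    refine Algebra.adjoin_le ?_
    rintro - ⟨w, rfl⟩
    exact Algebra.subset_adjoin ⟨-w, ContinuousMap.ext fun t => (star_expWeight _ _).symm⟩

/-- The characters are closed under multiplication, so the algebra they generate is just their
linear span. -/
theorem toSubmodule_characterSubalgebra :
    Subalgebra.toSubmodule (characterSubalgebra R).toSubalgebra =
      Submodule.span ℂ (Set.range (torusCharacter R)) := by
  apply Algebra.adjoin_eq_span_of_subset
  refine Set.Subset.trans ?_ Submodule.subset_span
  intro x hx
  refine Submonoid.closure_induction (fun _ => id) ⟨0, ?_⟩ ?_ hx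
  · ext1 t
    exact expWeight_zero _
  · rintro - - - - ⟨m, rfl⟩ ⟨n, rfl⟩
    refine ⟨m + n, ?_⟩
    ext1 t
    exact expWeight_add _ _ _

variable {R} [R.IsCrystallographic]

/-- The fundamental weights already suffice, since their exponentials cut out the period lattice. -/
theorem characterSubalgebra_separatesPoints (b : R.Base) :
    (characterSubalgebra R).SeparatesPoints := by
  intro s t hst
  obtain ⟨x, rfl⟩ := (Torus.isQuotientMap_mk R).surjective s
  obtain ⟨y, rfl⟩ := (Torus.isQuotientMap_mk R).surjective t
  rw [ne_eq, Torus.mk_eq_iff, mem_periodLattice_iff b] at hst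
  push Not at hst
  obtain ⟨i, hi⟩ := hst
  refine ⟨_, ⟨torusCharacter R ⟨_, fundamentalWeight_mem b i⟩, Algebra.subset_adjoin ⟨_, rfl⟩, rfl⟩,
    fun h => hi ?_⟩
  replace h := ((torusCharacter_mk _ x).symm.trans h).trans (torusCharacter_mk _ y)
  have h1 : expWeight R (fundamentalWeight b i) (-x + y) = 1 := by
    have e : expWeight R (fundamentalWeight b i) (-x + y) =
        (expWeight R (fundamentalWeight b i) x)⁻¹ * expWeight R (fundamentalWeight b i) y := by
      rw [expWeight, expWeight, expWeight, ← Complex.exp_neg, ← Complex.exp_add, map_add, map_neg]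
      push_cast
      ring_nf
    rw [e]
    rw [← show expWeight R (fundamentalWeight b i) x = _ from h]
    exact inv_mul_cancel₀ (Complex.exp_ne_zero _)
  have h2 := congr_arg Complex.re h1
  rw [expWeight, mul_comm, Complex.exp_ofReal_mul_I_re, Complex.one_re] at h2
  exact h2

theorem span_torusCharacter_closure_eq_top (b : R.Base) :
    (Submodule.span ℂ (Set.range (torusCharacter R))).topologicalClosure = ⊤ := by
  rw [← toSubmodule_characterSubalgebra]
  exact congr_arg (Subalgebra.toSubmodule <| StarSubalgebra.toSubalgebra ·)
    (ContinuousMap.starSubalgebra_topologicalClosure_eq_top_of_separatesPoints _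
      (characterSubalgebra_separatesPoints b))

theorem span_torusCharacter_toLp_closure_eq_top (b : R.Base) :
    (Submodule.span ℂ (Set.range fun w => ContinuousMap.toLp 2 (haar R) ℂ
      (torusCharacter R w))).topologicalClosure = ⊤ := by
  have := t2Space_torus b
  convert! (ContinuousMap.toLp_denseRange ℂ (haar R) ℂ
    ENNReal.ofNat_ne_top).topologicalClosure_map_submodule (span_torusCharacter_closure_eq_top b)
  rw [Submodule.map_span]
  rw [Set.range_comp']
  rfl

/-- A square-integrable function orthogonal to all characters vanishes. -/
theorem ae_eq_zero_of_forall_integral_character_eq_zero (b : R.Base) {ψ : Torus R → ℂ}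
    (hψ : MemLp ψ 2 (haar R))
    (h : ∀ w ∈ weightLattice R, ∫ t, ψ t * star (onTorus R (expWeight R w) t) ∂haar R = 0) :
    ψ =ᵐ[haar R] 0 := by
  have h1 : hψ.toLp ψ ∈ (Submodule.span ℂ (Set.range fun w => ContinuousMap.toLp 2 (haar R) ℂ
      (torusCharacter R w)))ᗮ := by
    rw [Submodule.mem_orthogonal]
    intro u hu
    refine Submodule.span_induction (p := fun u _ => inner ℂ u (hψ.toLp ψ) = 0) ?_
      (inner_zero_left _) ?_ ?_ hu
    · rintro _ ⟨w, rfl⟩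
      rw [L2.inner_def, ← h w w.2]
      refine integral_congr_ae ?_
      filter_upwards [hψ.coeFn_toLp, ContinuousMap.coeFn_toLp (p := 2) (𝕜 := ℂ) (haar R)
        (torusCharacter R w)] with t h1 h2
      rw [h1, h2]
      rfl
    · intro u v _ _ h1 h2
      rw [inner_add_left, h1, h2, add_zero]
    · intro c u _ h1
      rw [inner_smul_left, h1, mul_zero]
  rw [(Submodule.topologicalClosure_eq_top_iff).1 (span_torusCharacter_toLp_closure_eq_top b),
    Submodule.mem_bot] at h1
  have h2 := hψ.coeFn_toLp
  rw [h1] at h2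
  exact h2.symm.trans (Lp.coeFn_zero _ _ _)

end Characters

/-! ### Density in the space of invariant functions -/

section Density
variable {ι M V : Type*} [AddCommGroup M] [Module ℝ M]
  [NormedAddCommGroup V] [InnerProductSpace ℝ V] [FiniteDimensional ℝ V]
  [Fintype ι] {R : RootPairing ι ℝ M V} [R.IsRootSystem]

variable (R) in
/-- The orbit of a weight under the Weyl group. -/
def weightOrbit (w : M) : Set M := {w' | Relation.ReflTransGen (fun x y => ∃ i, y = R.reflection i x) w w'}

theorem weightOrbit_subset {N : ℕ} {w : M} (hw : w ∈ weightBox R N) :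
    weightOrbit R w ⊆ weightBox R N := by
  intro w' h
  induction h with
  | refl => exact hw
  | tail _ h ih =>
    obtain ⟨i, rfl⟩ := h
    exact reflection_mem_weightBox ih i

theorem finite_weightOrbit {w : M} (hw : w ∈ weightLattice R) : (weightOrbit R w).Finite := by
  obtain ⟨N, hN⟩ := exists_mem_weightBox hw
  exact (finite_weightBox N).subset (weightOrbit_subset hN)

theorem reflection_mem_weightOrbit {w w' : M} (h : w' ∈ weightOrbit R w) (i : ι) :
    R.reflection i w' ∈ weightOrbit R w := Relation.ReflTransGen.tail h ⟨i, rfl⟩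

/-- The sum of the exponentials over an orbit of the Weyl group. -/
def orbitSum {w : M} (hw : w ∈ weightLattice R) : V → ℂ :=
  ∑ w' ∈ (finite_weightOrbit hw).toFinset, expWeight R w'

theorem orbitSum_mem {w : M} (hw : w ∈ weightLattice R) : orbitSum hw ∈ invariantPolynomials R := by
  obtain ⟨N, hN⟩ := exists_mem_weightBox hw
  refine ⟨sum_mem fun w' h => Submodule.subset_span ⟨w', ?_, rfl⟩, fun i h => ?_⟩
  · exact (weightOrbit_subset hN ((finite_weightOrbit hw).mem_toFinset.1 h)).1
  · rw [orbitSum, Finset.sum_apply, Finset.sum_apply]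
    refine Finset.sum_nbij' (R.reflection i) (R.reflection i) ?_ ?_ ?_ ?_ ?_
    · intro w' h
      rw [Set.Finite.mem_toFinset] at h ⊢
      exact reflection_mem_weightOrbit h i
    · intro w' h
      rw [Set.Finite.mem_toFinset] at h ⊢
      exact reflection_mem_weightOrbit h i
    · exact fun w' _ => R.reflection_same i w'
    · exact fun w' _ => R.reflection_same i w'
    · exact fun w' _ => expWeight_coreflection w' i h

variable [R.IsCrystallographic]

/-- An invariant square-integrable function orthogonal to all invariant polynomials vanishes. -/
theorem ae_eq_zero_of_forall_integral_invariant_eq_zero (b : R.Base) {ψ : Torus R → ℂ}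
    (hψ : MemLp ψ 2 (haar R)) (hinv : ∀ i, (fun t => ψ (reflT R i t)) =ᵐ[haar R] ψ)
    (h : ∀ F ∈ invariantPolynomials R, ∫ t, ψ t * star (onTorus R F t) ∂haar R = 0) :
    ψ =ᵐ[haar R] 0 := by
  let J : M → ℂ := fun w => ∫ t, ψ t * star (onTorus R (expWeight R w) t) ∂haar R
  -- The Fourier coefficients of an invariant function are constant on Weyl orbits. Pairing with an
  -- orbit sum therefore gives the size of the orbit times one coefficient, which must vanish.
  have hJ : ∀ w ∈ weightLattice R, ∀ i, J (R.reflection i w) = J w := by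
    intro w hw i
    have h1 := (measurePreserving_reflT R i).integral_comp
      (MeasurableEquiv.ofInvolutive (reflT R i) (reflT_reflT R i)
        (continuous_reflT R i).measurable).measurableEmbedding
      (fun t => ψ t * star (onTorus R (expWeight R w) t))
    rw [← show _ = J w from h1]
    refine integral_congr_ae ?_
    filter_upwards [hinv i] with t ht
    rw [ht]
    congr 2
    obtain ⟨x, rfl⟩ := (Torus.isQuotientMap_mk R).surjective t
    rw [reflT_mk, onTorus_mk R (isPeriodic_expWeight hw),
      onTorus_mk R (isPeriodic_expWeight (reflection_mem_weightLattice hw i)),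
      expWeight_coreflection]
  refine ae_eq_zero_of_forall_integral_character_eq_zero b hψ fun w hw => ?_
  obtain ⟨N, hN⟩ := exists_mem_weightBox hw
  have hO : ∀ w' ∈ weightOrbit R w, J w' = J w := by
    intro w' hw'
    have hmem : ∀ w', w' ∈ weightOrbit R w → w' ∈ weightLattice R := fun w' h =>
      (weightOrbit_subset hN h).1
    induction hw' with
    | refl => rfl
    | tail h1 h2 ih =>
      obtain ⟨i, rfl⟩ := h2
      rw [hJ _ (hmem _ h1), ih]
  have hint : ∀ w ∈ weightLattice R,
      Integrable (fun t => ψ t * star (onTorus R (expWeight R w) t)) (haar R) := by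
    intro w hw
    have hc := continuous_onTorus (isPeriodic_expWeight hw) (contDiff_expWeight (n := 0) w).continuous
    exact hψ.integrable_mul (memLp_of_continuous hc).star
  have h1 := h _ (orbitSum_mem hw)
  have h2 : ∀ t, ψ t * star (onTorus R (orbitSum hw) t) =
      ∑ w' ∈ (finite_weightOrbit hw).toFinset, ψ t * star (onTorus R (expWeight R w') t) := by
    intro t
    rw [← Finset.mul_sum, ← star_sum, onTorus, orbitSum, Finset.sum_apply]
    rfl
  simp only [h2] at h1
  rw [integral_finsetSum _ fun w' h => hint w'
    (weightOrbit_subset hN ((finite_weightOrbit hw).mem_toFinset.1 h)).1] at h1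
  rw [Finset.sum_congr rfl fun w' h => hO w' ((finite_weightOrbit hw).mem_toFinset.1 h),
    Finset.sum_const, nsmul_eq_mul] at h1
  refine (mul_eq_zero.1 h1).resolve_left ?_
  have : w ∈ (finite_weightOrbit hw).toFinset :=
    (finite_weightOrbit hw).mem_toFinset.2 Relation.ReflTransGen.refl
  exact_mod_cast (Finset.card_pos.2 ⟨w, this⟩).ne'

/-- The products of invariant polynomials with a function that vanishes almost nowhere are dense. -/
theorem dense_of_range_polyMap_le (b : R.Base) {φ : V → ℂ} (hφ : IsPeriodic R φ)
    (hc : Continuous φ) (hinv : ∀ i x, φ (R.coreflection i x) = φ x)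
    (h0 : ∀ x, (∀ i, sinRoot R i x ≠ 0) → φ x ≠ 0) {D : Submodule ℂ (L2W R)}
    (hD : ∀ F, polyMap φ hφ hc hinv F ∈ D) : Dense (D : Set (L2W R)) := by
  rw [Submodule.dense_iff_topologicalClosure_eq_top, Submodule.topologicalClosure_eq_top_iff,
    Submodule.eq_bot_iff]
  intro u hu
  have hφc := continuous_onTorus hφ hc
  obtain ⟨C, -, hC⟩ := exists_bound_of_continuous_periodic hφ hc
  -- If `u` is orthogonal to all `Fφ`, then `star φ · u` is orthogonal to all invariant polynomials
  -- and hence zero; `φ` vanishes at most on the null set of the walls.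
  let ψ : Torus R → ℂ := fun t => star (onTorus R φ t) * (u : Lp ℂ 2 (haar R)) t
  have hψ : MemLp ψ 2 (haar R) := memLp_bdd_mul (C := C) hφc.star.aestronglyMeasurable
    (fun t => by rw [norm_star]; exact hC _) (Lp.memLp _)
  have hz : ψ =ᵐ[haar R] 0 := by
    refine ae_eq_zero_of_forall_integral_invariant_eq_zero b hψ (fun i => ?_) fun F hF => ?_
    · filter_upwards [(mem_invariantSubmodule_iff R).1 u.2 i] with t ht
      simp only [ψ, ht, onTorus_reflT hφ hinv]
    · have h1 := (Submodule.mem_orthogonal _ _).1 hu _ (hD ⟨F, hF⟩)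
      rw [inner_L2W] at h1
      rw [← h1]
      refine integral_congr_ae ?_
      filter_upwards [coeFn_polyMap φ hφ hc hinv ⟨F, hF⟩] with t ht
      rw [ht]
      simp only [ψ, onTorus, star_mul']
      ring
  apply L2W_ext
  refine Filter.EventuallyEq.trans ?_ (Lp.coeFn_zero ℂ 2 (haar R)).symm
  filter_upwards [hz, ae_regular (R := R)] with t h1 h2
  exact (mul_eq_zero.1 h1).resolve_left (star_ne_zero.2 (h0 _ h2))

end Density
end CalogeroMoser

end

noncomputable section
namespace CalogeroMoser
open MeasureTheory Laplacian

/-! ### Integrability forces vanishing on the walls -/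

section Walls
variable {ι M V : Type*} [AddCommGroup M] [Module ℝ M]
  [NormedAddCommGroup V] [InnerProductSpace ℝ V] [FiniteDimensional ℝ V]
  [Fintype ι] {R : RootPairing ι ℝ M V} [R.IsRootSystem] [R.IsCrystallographic]

theorem root'_half_coroot (i : ι) : R.root' i ((1 / 2 : ℝ) • R.coroot i) = 1 := by
  rw [map_smul, RootPairing.root'_coroot_eq_pairing, RootPairing.pairing_same]
  norm_num

theorem lintegral_Ioc_eq_top_of_inv_le {a c : ℝ} {F : ℝ → ENNReal} {ε : ℝ} (hε : 0 < ε) (hc : 0 < c)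
    (h : ∀ s ∈ Set.Ioc a (a + ε), ENNReal.ofReal (c * (s - a)⁻¹) ≤ F s) :
    ∫⁻ s in Set.Ioc a (a + ε), F s = ⊤ := by
  by_contra hne
  have h1 : ∫⁻ s in Set.Ioc a (a + ε), ENNReal.ofReal (c * (s - a)⁻¹) < ⊤ :=
    (setLIntegral_mono' measurableSet_Ioc h).trans_lt (lt_top_iff_ne_top.2 hne)
  have hm : Measurable fun s : ℝ => c * (s - a)⁻¹ := by fun_prop
  have h2 : IntegrableOn (fun s : ℝ => c * (s - a)⁻¹) (Set.Ioc a (a + ε)) := by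
    refine ⟨hm.aestronglyMeasurable, ?_⟩
    rw [hasFiniteIntegral_iff_ofReal]
    · exact h1
    · refine (ae_restrict_iff' measurableSet_Ioc).2 (ae_of_all _ fun s hs => ?_)
      have : 0 < s - a := by linarith [hs.1]
      simp only [Pi.zero_apply]
      positivity
  have h3 : IntegrableOn (fun s : ℝ => (s - a)⁻¹) (Set.Ioc a (a + ε)) := by
    refine (h2.const_mul c⁻¹).congr (ae_of_all _ fun s => ?_)
    simp only
    rw [← mul_assoc, inv_mul_cancel₀ hc.ne', one_mul]
  have h4 := (intervalIntegrable_iff_integrableOn_Ioc_of_le (by linarith : a ≤ a + ε)).2 h3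
  rcases intervalIntegrable_sub_inv_iff.1 h4 with h5 | h5
  · linarith
  · exact h5 Set.left_mem_uIcc

/-- By Tonelli and translation invariance, the integral over `t` of these line integrals is `b - a`
(or zero) times the total integral, hence finite. -/
theorem ae_lintegral_line_lt_top {F : Torus R → ENNReal} (hF : Measurable F)
    (hfin : ∫⁻ t, F t ∂haar R ≠ ⊤) (v : V) (a b : ℝ) :
    ∀ᵐ t ∂haar R, ∫⁻ s in Set.Ioo a b, F (t + Torus.mk R (s • v)) < ⊤ := by
  have hc : Continuous fun q : Torus R × ℝ => q.1 + Torus.mk R (q.2 • v) :=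
    continuous_fst.add ((Torus.isQuotientMap_mk R).continuous.comp
      (continuous_snd.smul continuous_const))
  have hm : Measurable fun q : Torus R × ℝ => F (q.1 + Torus.mk R (q.2 • v)) :=
    hF.comp hc.measurable
  refine ae_lt_top (Measurable.lintegral_prod_right' hm) ?_
  rw [lintegral_lintegral_swap hm.aemeasurable]
  simp only [lintegral_add_right_eq_self F]
  rw [lintegral_const]
  refine ENNReal.mul_ne_top hfin ?_
  simp

theorem sinRoot_wall_add {i : ι} {y v : V} (hy : sinRoot R i y = 0) (hv : R.root' i v = 1) (s : ℝ) :
    sinRoot R i (y + s • v) ^ 2 = Real.sin (s / 2) ^ 2 := by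
  obtain ⟨n, hn⟩ := Real.sin_eq_zero_iff.1 hy
  have h : R.root' i (y + s • v) = s + n * (2 * Real.pi) := by
    rw [map_add, map_smul, hv, smul_eq_mul]
    linarith
  rw [sinRoot, h, sin_sq_half_add_int]

/-- A continuous function divisible by `sin² (α/2)` up to an integrable function vanishes on the
walls of `α`. -/
theorem eq_zero_of_lintegral_div_sin_sq_ne_top {g : V → ℂ} (hg : IsPeriodic R g)
    (hgc : Continuous g) {i : ι}
    (hfin : ∫⁻ t, ENNReal.ofReal ‖onTorus R g t‖ /
      ENNReal.ofReal (sinRoot R i (Torus.rep R t) ^ 2) ∂haar R ≠ ⊤)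
    {x : V} (hx : sinRoot R i x = 0) : g x = 0 := by
  by_contra hgx
  let F : Torus R → ENNReal := fun t => ENNReal.ofReal ‖onTorus R g t‖ /
      ENNReal.ofReal (sinRoot R i (Torus.rep R t) ^ 2)
  have hFmk : ∀ y, F (Torus.mk R y) = ENNReal.ofReal ‖g y‖ / ENNReal.ofReal (sinRoot R i y ^ 2) := by
    intro y
    have h1 := onTorus_mk R (f := fun h => ((sinRoot R i h ^ 2 : ℝ) : ℂ))
      (isPeriodic_sinRoot_sq i).ofReal y
    have h2 : sinRoot R i (Torus.rep R (Torus.mk R y)) ^ 2 = sinRoot R i y ^ 2 :=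
      Complex.ofReal_injective h1
    simp only [F, h2, onTorus_mk R hg]
  have hF : Measurable F := by
    have h1 := continuous_onTorus hg hgc
    have h2 := (Complex.continuous_re.comp (continuous_onTorus (R := R)
      (f := fun h => ((sinRoot R i h ^ 2 : ℝ) : ℂ)) (isPeriodic_sinRoot_sq i).ofReal
      (by have := continuous_sinRoot (R := R) i; fun_prop)))
    exact (h1.norm.measurable.ennreal_ofReal).div h2.measurable.ennreal_ofReal
  let v : V := (1 / 2 : ℝ) • R.coroot i
  have hv : R.root' i v = 1 := root'_half_coroot i
  let c := ‖g x‖ / 2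
  have hc : 0 < c := by
    have := norm_pos_iff.2 hgx
    positivity
  have hO : IsOpen {y | c < ‖g y‖} := isOpen_lt continuous_const hgc.norm
  have hxO : x ∈ {y | c < ‖g y‖} := by
    have := norm_pos_iff.2 hgx
    simp only [c, Set.mem_ofPred_eq]
    linarith
  -- `σ y` is the time at which the line `y + s v` reaches the hyperplane of `x`. The open set `U`
  -- consists of the starting points whose line gets there at a time in `(0, 1)` and at a point
  -- where `|g| > c`; `x - v/2` is one of them.
  let σ : V → ℝ := fun y => R.root' i x - R.root' i y
  have hσc : Continuous σ := continuous_const.sub (continuous_root' i)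
  let U : Set V := {y | σ y ∈ Set.Ioo (0 : ℝ) 1} ∩ (fun y => y + σ y • v) ⁻¹' {y | c < ‖g y‖}
  have hU : IsOpen U := (isOpen_Ioo.preimage hσc).inter (hO.preimage (by fun_prop))
  have hne : (x - (1 / 2 : ℝ) • v) ∈ U := by
    have h1 : σ (x - (1 / 2 : ℝ) • v) = 1 / 2 := by
      simp only [σ, map_sub, map_smul, hv, smul_eq_mul]
      ring
    refine ⟨?_, ?_⟩
    · rw [Set.mem_ofPred_eq, h1]
      norm_num
    · rw [Set.mem_preimage, h1, sub_add_cancel]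
      exact hxO
  have hUo : IsOpen (Torus.mk R '' U) := QuotientAddGroup.isOpenMap_coe (N := periodLattice R) U hU
  obtain ⟨_, ht, y, ⟨hy1, hy2⟩, rfl⟩ := (Measure.dense_of_ae
    (ae_lintegral_line_lt_top hF hfin v 0 1)).exists_mem_open hUo ⟨_, _, hne, rfl⟩
  have hz : sinRoot R i (y + σ y • v) = 0 := by
    rw [← hx, sinRoot, sinRoot]
    congr 2
    rw [map_add, map_smul, hv, smul_eq_mul]
    simp only [σ]
    ring
  have hS : IsOpen ({s : ℝ | c < ‖g (y + s • v)‖} ∩ Set.Ioo 0 1) :=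
    (isOpen_lt continuous_const (by fun_prop)).inter isOpen_Ioo
  obtain ⟨δ, hδ, hball⟩ := Metric.isOpen_iff.1 hS (σ y) ⟨hy2, hy1⟩
  have hmem : ∀ s ∈ Set.Ioc (σ y) (σ y + δ / 2), c < ‖g (y + s • v)‖ ∧ s ∈ Set.Ioo (0 : ℝ) 1 := by
    intro s hs
    refine hball ?_
    rw [Metric.mem_ball, Real.dist_eq, abs_of_pos (by linarith [hs.1])]
    linarith [hs.2]
  -- Just after the crossing the integrand is at least `c / (s - σ y)`, because `sin² ((s - σ y)/2)
  -- ≤ s - σ y`. This already diverges, whereas almost every line integral is finite.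
  have htop := lintegral_Ioc_eq_top_of_inv_le (a := σ y) (F := fun s => F (Torus.mk R y + Torus.mk R (s • v)))
    (half_pos hδ) hc fun s hs => by
      have hs1 := hmem s hs
      have hs0 : 0 < s - σ y := by linarith [hs.1]
      have e : y + s • v = y + σ y • v + (s - σ y) • v := by module
      rw [← map_add, hFmk, e, sinRoot_wall_add hz hv, ← e, ← div_eq_mul_inv,
        ENNReal.ofReal_div_of_pos hs0]
      refine ENNReal.div_le_div (ENNReal.ofReal_le_ofReal hs1.1.le) (ENNReal.ofReal_le_ofReal ?_)
      have h1 : |Real.sin ((s - σ y) / 2)| ≤ 1 := Real.abs_sin_le_one _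
      have h2 : |Real.sin ((s - σ y) / 2)| ≤ |(s - σ y) / 2| := Real.abs_sin_le_abs
      rw [abs_of_pos (half_pos hs0)] at h2
      rw [← sq_abs]
      nlinarith [abs_nonneg (Real.sin ((s - σ y) / 2))]
  refine absurd htop (ne_of_lt (lt_of_le_of_lt (lintegral_mono_set fun s hs => (hmem s hs).2) ht))

/-- A continuous function whose product with `℘(⟨α, h⟩)` is square-integrable vanishes on the walls
of `α`. -/
theorem eq_zero_of_memLp_wp_mul {g : V → ℂ} (hg : IsPeriodic R g) (hgc : Continuous g) {i : ι}
    {p : Set.Ioo (-1 : ℝ) 1}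
    (h : MemLp (fun t => onTorus R (fun h => wp p (R.root' i h)) t * onTorus R g t) 2 (haar R))
    {x : V} (hx : sinRoot R i x = 0) : g x = 0 := by
  refine eq_zero_of_lintegral_div_sin_sq_ne_top hg hgc (i := i) ?_ hx
  obtain ⟨C, hC⟩ := exists_bound_wp_sub p
  -- On a probability space square-integrability implies integrability, and `1/sin² (α/2) ≤ 4
  -- (|℘(α)| + C)`.
  have h1 : Integrable (fun t => 4 * (‖onTorus R (fun h => wp p (R.root' i h)) t * onTorus R g t‖ +
      C * ‖onTorus R g t‖)) (haar R) :=
    ((h.integrable one_le_two).norm.add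
      ((integrable_of_continuous_periodic hg hgc).norm.const_mul C)).const_mul 4
  refine ne_of_lt (lt_of_le_of_lt (lintegral_mono_ae ?_) h1.lintegral_lt_top)
  filter_upwards [ae_regular (R := R)] with t ht
  have hs : 0 < sinRoot R i (Torus.rep R t) ^ 2 := by
    have := ht i
    exact lt_of_le_of_ne (sq_nonneg _) (pow_ne_zero 2 this).symm
  rw [← ENNReal.ofReal_div_of_pos hs]
  refine ENNReal.ofReal_le_ofReal ?_
  have h2 := hC (R.root' i (Torus.rep R t))
  have h3 : 1 / (4 * sinRoot R i (Torus.rep R t) ^ 2) ≤ ‖wp p (R.root' i (Torus.rep R t))‖ + C := by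
    have h4 := norm_sub_norm_le ((1 / (4 * sinRoot R i (Torus.rep R t) ^ 2) : ℝ) : ℂ)
      (wp p (R.root' i (Torus.rep R t)))
    rw [norm_sub_rev, Complex.norm_real, Real.norm_eq_abs, abs_of_pos (by positivity)] at h4
    change ‖wp p (R.root' i (Torus.rep R t)) -
      ((1 / (4 * sinRoot R i (Torus.rep R t) ^ 2) : ℝ) : ℂ)‖ ≤ C at h2
    linarith
  have h5 := mul_le_mul_of_nonneg_right h3 (norm_nonneg (onTorus R g t))
  have h6 : ‖onTorus R g t‖ / sinRoot R i (Torus.rep R t) ^ 2 =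
      4 * (1 / (4 * sinRoot R i (Torus.rep R t) ^ 2) * ‖onTorus R g t‖) := by
    field_simp
  have h7 : onTorus R (fun h => wp p (R.root' i h)) t = wp p (R.root' i (Torus.rep R t)) := rfl
  rw [h6, norm_mul, h7]
  linarith

section Reduced
variable [R.IsReduced]

/-- For each other root `β`, the projection of `β^∨` to the wall of `α` has `β`-value `2 - ⟨α,
β^∨⟩⟨β, α^∨⟩/2`. This is nonzero, since nonproportional roots have Coxeter weight different from 4.
Finitely many nonzero functionals on the wall then have a common non-zero. -/
theorem exists_root'_eq_zero_and_ne_zero (i : ι) :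
    ∃ u : V, R.root' i u = 0 ∧ ∀ j, j ≠ i → j ≠ R.reflectionPerm i i → R.root' j u ≠ 0 := by
  obtain ⟨u, hu, h⟩ := Module.Dual.exists_forall_mem_ne_zero_of_forall_exists
    (LinearMap.ker (R.root' i)) (fun j : {j // j ≠ i ∧ j ≠ R.reflectionPerm i i} => R.root' j) (by
    rintro ⟨j, hj, hj'⟩
    refine ⟨R.coroot j - (R.pairing i j / 2) • R.coroot i, ?_, ?_⟩
    · rw [LinearMap.mem_ker, map_sub, map_smul, RootPairing.root'_coroot_eq_pairing,
        RootPairing.root'_coroot_eq_pairing, RootPairing.pairing_same, smul_eq_mul]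
      ring
    · rw [map_sub, map_smul, RootPairing.root'_coroot_eq_pairing,
        RootPairing.root'_coroot_eq_pairing, RootPairing.pairing_same, smul_eq_mul]
      have hlin : LinearIndependent ℝ ![R.root i, R.root j] :=
        RootPairing.IsReduced.linearIndependent R (Ne.symm hj) fun h => by
          apply hj'
          apply R.root.injective
          rw [root_reflectionPerm_self R, h, neg_neg]
      have : IsAddTorsionFree M := .of_isTorsionFree ℝ M
      have h4 := R.coxeterWeight_ne_four_of_linearIndependent hlin
      rw [RootPairing.coxeterWeight] at h4
      intro h0
      apply h4
      linarith)
  exact ⟨u, hu, fun j h1 h2 => h ⟨j, h1, h2⟩⟩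

theorem eventually_sin_half_ne_zero (a : ℝ) {c : ℝ} (hc : c ≠ 0) :
    ∀ᶠ s in nhdsWithin (0 : ℝ) {0}ᶜ, Real.sin ((a + s * c) / 2) ≠ 0 := by
  by_cases h0 : Real.sin (a / 2) = 0
  · have hd : HasDerivAt (fun s : ℝ => Real.sin ((a + s * c) / 2)) (Real.cos (a / 2) * (c / 2)) 0 := by
      have h1 : HasDerivAt (fun s : ℝ => (a + s * c) / 2) (c / 2) 0 := by
        simpa using (((hasDerivAt_id (0 : ℝ)).mul_const c).const_add a).div_const 2
      simpa using h1.sin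
    refine hd.eventually_ne (mul_ne_zero ?_ (by positivity))
    intro hcos
    have := Real.sin_sq_add_cos_sq (a / 2)
    rw [h0, hcos] at this
    norm_num at this
  · have hcont : Continuous fun s : ℝ => Real.sin ((a + s * c) / 2) := by fun_prop
    have : (fun s : ℝ => Real.sin ((a + s * c) / 2)) 0 ≠ 0 := by simpa using h0
    exact (hcont.continuousAt.eventually_ne this).filter_mono nhdsWithin_le_nhds

open Classical in
/-- The product of the functions `sin² (β/2)` over the roots `β` not proportional to `α`. -/
def otherRootsProd (R : RootPairing ι ℝ M V) (i : ι) (h : V) : ℝ :=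
  ∏ j with j ≠ i ∧ j ≠ R.reflectionPerm i i, sinRoot R j h ^ 2

theorem continuous_otherRootsProd (i : ι) : Continuous (otherRootsProd R i) :=
  continuous_finsetProd _ fun j _ => (continuous_sinRoot j).pow 2

theorem isPeriodic_otherRootsProd (i : ι) : IsPeriodic R (otherRootsProd R i) :=
  fun x l hl => Finset.prod_congr rfl fun j _ => isPeriodic_sinRoot_sq j x l hl

open Classical in
/-- A continuous function vanishing on the generic part of the walls of `α` vanishes there. -/
theorem eq_zero_of_otherRootsProd_mul_eq_zero {g : V → ℂ} (hgc : Continuous g) {i : ι}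
    (h : ∀ x, sinRoot R i x = 0 → otherRootsProd R i x * g x = 0)
    {x : V} (hx : sinRoot R i x = 0) : g x = 0 := by
  -- Moving from `x` inside the wall along `u` leaves all other walls at once, and continuity brings
  -- the vanishing back to `x`.
  obtain ⟨u, hu, hu'⟩ := exists_root'_eq_zero_and_ne_zero (R := R) i
  have h1 : ∀ᶠ s in nhdsWithin (0 : ℝ) {0}ᶜ, ∀ j : {j // j ≠ i ∧ j ≠ R.reflectionPerm i i},
      sinRoot R j (x + s • u) ≠ 0 := by
    refine Filter.eventually_all.2 fun j => ?_
    filter_upwards [eventually_sin_half_ne_zero (R.root' j x) (hu' j j.2.1 j.2.2)] with s hs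
    rwa [sinRoot, map_add, map_smul, smul_eq_mul]
  have h2 : ∀ᶠ s in nhdsWithin (0 : ℝ) {0}ᶜ, g (x + s • u) = 0 := by
    filter_upwards [h1] with s hs
    have h3 := h (x + s • u) (by rwa [sinRoot, map_add, map_smul, hu, smul_zero, add_zero])
    refine (mul_eq_zero.1 h3).resolve_left ?_
    refine Complex.ofReal_ne_zero.2 (Finset.prod_ne_zero_iff.2 ?_)
    intro j hj
    exact pow_ne_zero 2 (hs ⟨j, (Finset.mem_filter.1 hj).2⟩)
  have hcont : Continuous fun s : ℝ => g (x + s • u) := by fun_prop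
  have h3 : Filter.Tendsto (fun s : ℝ => g (x + s • u)) (nhdsWithin (0 : ℝ) {0}ᶜ) (nhds (g x)) := by
    have := (hcont.tendsto 0).mono_left (nhdsWithin_le_nhds (s := {0}ᶜ))
    simpa using this
  exact tendsto_nhds_unique (h3.congr' h2) tendsto_const_nhds

end Reduced

end Walls
end CalogeroMoser

end

noncomputable section
namespace CalogeroMoser
open MeasureTheory Laplacian

/-! ### Second-order vanishing of the functions in the domain -/

section DomainWalls
variable {ι M V : Type*} [AddCommGroup M] [Module ℝ M]
  [NormedAddCommGroup V] [InnerProductSpace ℝ V] [FiniteDimensional ℝ V]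
  [Fintype ι] {R : RootPairing ι ℝ M V} [R.IsRootSystem] [R.IsCrystallographic] [R.IsReduced]
  [IsWeylInvariantInner R] {k : ι → ℝ}

theorem potentialCoeff_ne_zero {i : ι} (h0 : k i ≠ 0) (h1 : k i ≠ 1) :
    potentialCoeff R k i ≠ 0 := by
  have h2 : rootNormSq R i ≠ 0 := by
    rw [rootNormSq_eq_gram, gram, real_inner_self_eq_norm_sq, rootVec]
    have h3 := coroot_norm_sq_pos R i
    have h4 : R.coroot i ≠ 0 := fun h => by simp [h] at h3
    exact pow_ne_zero 2 (norm_ne_zero_iff.2 (smul_ne_zero (div_pos two_pos h3).ne' h4))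
  exact mul_ne_zero (mul_ne_zero h0 (sub_ne_zero.2 h1)) h2

-- In the half sum over all roots, `α` and `-α` contribute equally, so the coefficient of `℘(α)` is
-- not halved.
open Classical in
theorem potential_eq_add (b : R.Base) (hk : ∀ i j, k (R.reflectionPerm i j) = k j)
    (p : Set.Ioo (-1 : ℝ) 1) (i : ι) (h : V) :
    potential R b k p h = potentialCoeff R k i * wp p (R.root' i h) +
      1 / 2 * ∑ j with j ≠ i ∧ j ≠ R.reflectionPerm i i,
        (potentialCoeff R k j : ℂ) * wp p (R.root' j h) := by
  have hne : i ≠ R.reflectionPerm i i := by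
    intro h
    have h1 := congr_arg (fun j => R.pairing j i) h
    simp only [R.pairing_reflectionPerm_self_left, R.pairing_same] at h1
    norm_num at h1
  have hfil : (Finset.univ.filter fun j => ¬(j ≠ i ∧ j ≠ R.reflectionPerm i i)) =
      {i, R.reflectionPerm i i} := by
    ext j
    simp only [Finset.mem_filter, Finset.mem_univ, true_and, Finset.mem_insert,
      Finset.mem_singleton]
    tauto
  rw [potential_eq_sum b hk, ← Finset.sum_filter_not_add_sum_filter Finset.univ
    (fun j => j ≠ i ∧ j ≠ R.reflectionPerm i i), hfil, Finset.sum_pair hne,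
    potentialCoeff_reflectionPerm hk, root'_reflectionPerm_self, wp_neg]
  ring

open Classical in
theorem exists_bound_otherRootsProd_mul_wp (p : Set.Ioo (-1 : ℝ) 1) (i : ι) {j : ι}
    (hj : j ≠ i ∧ j ≠ R.reflectionPerm i i) :
    ∃ C : ℝ, ∀ h : V, ‖(otherRootsProd R i h : ℂ) * wp p (R.root' j h)‖ ≤ C := by
  obtain ⟨C, hC⟩ := exists_bound_wp_mul_sin_sq p
  refine ⟨C, fun h => le_trans ?_ (hC (R.root' j h))⟩
  rw [norm_mul, mul_comm, Complex.norm_real, Real.norm_eq_abs]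
  refine mul_le_mul_of_nonneg_left ?_ (norm_nonneg _)
  rw [abs_of_nonneg (Finset.prod_nonneg fun j _ => sq_nonneg _), otherRootsProd,
    ← Finset.mul_prod_erase _ _ (Finset.mem_filter.2 ⟨Finset.mem_univ j, hj⟩)]
  exact mul_le_of_le_one_right (sq_nonneg _)
    (Finset.prod_le_one (fun _ _ => sq_nonneg _) fun l _ => sinRoot_sq_le_one l h)

theorem aestronglyMeasurable_wp (b : R.Base) (p : Set.Ioo (-1 : ℝ) 1) (i : ι) :
    AEStronglyMeasurable (onTorus R fun h => wp p (R.root' i h)) (haar R) := by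
  borelize V
  exact (measurable_onTorus b (fun x l hl => wp_periodic R p i x l hl)
    ((measurable_wp p).comp (continuous_root' i).measurable)).aestronglyMeasurable

open Classical in
/-- A continuous function whose product with the potential is square-integrable vanishes on the
walls. -/
theorem eq_zero_of_memLp_potential_mul (b : R.Base) (hk : ∀ i j, k (R.reflectionPerm i j) = k j)
    {p : Set.Ioo (-1 : ℝ) 1} {g : V → ℂ} (hg : IsPeriodic R g) (hgc : Continuous g) {i : ι}
    (h0 : k i ≠ 0) (h1 : k i ≠ 1)
    (h : MemLp (fun t => onTorus R (potential R b k p) t * onTorus R g t) 2 (haar R))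
    {x : V} (hx : sinRoot R i x = 0) : g x = 0 := by
  have hDc := continuous_otherRootsProd (R := R) i
  have hDp := isPeriodic_otherRootsProd (R := R) i
  have hDcc : Continuous fun h => (otherRootsProd R i h : ℂ) := by fun_prop
  have hDt := continuous_onTorus (R := R) (f := fun h => (otherRootsProd R i h : ℂ)) hDp.ofReal hDcc
  have hgL := memLp_of_continuous (continuous_onTorus hg hgc)
  obtain ⟨C, -, hC⟩ := exists_bound_of_continuous_periodic (R := R)
    (f := fun h => (otherRootsProd R i h : ℂ)) hDp.ofReal hDcc
  refine eq_zero_of_otherRootsProd_mul_eq_zero hgc (fun y hy => ?_) hx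
  -- Multiplication by `otherRootsProd` makes every other `℘(β)` bounded. The product of `℘(α)` with
  -- `otherRootsProd · g` is then square-integrable, after division by the nonzero coefficient
  -- `potentialCoeff`.
  refine eq_zero_of_memLp_wp_mul (p := p) (g := fun h => (otherRootsProd R i h : ℂ) * g h)
    (hDp.ofReal.mul hg) (hDcc.mul hgc) ?_ hy
  have hc := potentialCoeff_ne_zero (R := R) h0 h1
  have hA := memLp_bdd_mul hDt.aestronglyMeasurable (fun t => hC _) h
  have hB : MemLp (fun t => ∑ j with j ≠ i ∧ j ≠ R.reflectionPerm i i, (potentialCoeff R k j : ℂ) *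
      ((onTorus R (fun h => (otherRootsProd R i h : ℂ)) t * onTorus R (fun h => wp p (R.root' j h)) t) *
        onTorus R g t)) 2 (haar R) := by
    refine memLp_finsetSum _ fun j hj => MemLp.const_mul ?_ _
    obtain ⟨C', hC'⟩ := exists_bound_otherRootsProd_mul_wp p i (Finset.mem_filter.1 hj).2
    exact memLp_bdd_mul (hDt.aestronglyMeasurable.mul (aestronglyMeasurable_wp b p j))
      (fun t => hC' _) hgL
  refine ((hA.sub (hB.const_mul (1 / 2))).const_mul ((potentialCoeff R k i : ℂ)⁻¹)).ae_eq
    (ae_of_all _ fun t => ?_)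
  have hc' : (potentialCoeff R k i : ℂ) ≠ 0 := by exact_mod_cast hc
  have hpot : onTorus R (potential R b k p) t = _ := potential_eq_add b hk p i (Torus.rep R t)
  simp only [Pi.sub_apply, hpot]
  simp only [onTorus]
  have e : ∑ j with j ≠ i ∧ j ≠ R.reflectionPerm i i, (potentialCoeff R k j : ℂ) *
      ((otherRootsProd R i (Torus.rep R t) : ℂ) * wp p (R.root' j (Torus.rep R t)) *
        g (Torus.rep R t)) = (otherRootsProd R i (Torus.rep R t) : ℂ) * g (Torus.rep R t) *
      ∑ j with j ≠ i ∧ j ≠ R.reflectionPerm i i,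
        (potentialCoeff R k j : ℂ) * wp p (R.root' j (Torus.rep R t)) := by
    rw [Finset.mul_sum]
    exact Finset.sum_congr rfl fun j _ => by ring
  rw [e]
  field_simp
  ring

/-- An even twice differentiable function vanishing at `0` is bounded by a multiple of the square. -/
theorem norm_le_mul_sq_of_even {φ φ' φ'' : ℝ → ℂ} {C : ℝ} (h1 : ∀ s, HasDerivAt φ (φ' s) s)
    (h2 : ∀ s, HasDerivAt φ' (φ'' s) s) (hC : ∀ s, ‖φ'' s‖ ≤ C) (he : ∀ s, φ (-s) = φ s)
    (h0 : φ 0 = 0) (s : ℝ) : ‖φ s‖ ≤ C * s ^ 2 := by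
  have hd0 : φ' 0 = 0 := by
    have h3 : HasDerivAt (fun s => φ (-s)) (-φ' 0) 0 := by
      have := (h1 (-0)).scomp (0 : ℝ) (hasDerivAt_neg (0 : ℝ))
      simpa [Function.comp_def] using this
    rw [show (fun s => φ (-s)) = φ from funext he] at h3
    have h4 := h3.unique (h1 0)
    exact self_eq_neg.1 h4.symm
  have hC0 : 0 ≤ C := (norm_nonneg _).trans (hC 0)
  have h5 : ∀ s, ‖φ' s‖ ≤ C * |s| := by
    intro s
    have := convex_univ.norm_image_sub_le_of_norm_hasDerivWithin_le (f := φ') (f' := φ'')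
      (fun x _ => (h2 x).hasDerivWithinAt) (fun x _ => hC x) (Set.mem_univ 0) (Set.mem_univ s)
    simpa [hd0] using this
  have h6 := (convex_Icc (-|s|) |s|).norm_image_sub_le_of_norm_hasDerivWithin_le (f := φ) (f' := φ')
    (C := C * |s|) (fun x _ => (h1 x).hasDerivWithinAt)
    (fun x hx => (h5 x).trans (mul_le_mul_of_nonneg_left (abs_le.2 hx) hC0))
    (x := 0) (y := s) ⟨by simp, by simp⟩ ⟨neg_abs_le s, le_abs_self s⟩
  rw [h0, sub_zero, sub_zero, Real.norm_eq_abs, mul_assoc, abs_mul_abs_self, ← sq] at h6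
  exact h6

theorem exists_sub_int_mul_two_pi_abs_le (x : ℝ) :
    ∃ n : ℤ, |x - n * (2 * Real.pi)| ≤ Real.pi := by
  refine ⟨round (x / (2 * Real.pi)), ?_⟩
  have h := abs_sub_round (x / (2 * Real.pi))
  have hpi : 0 < 2 * Real.pi := by positivity
  have e : x - round (x / (2 * Real.pi)) * (2 * Real.pi) =
      (x / (2 * Real.pi) - round (x / (2 * Real.pi))) * (2 * Real.pi) := by
    field_simp
  rw [e, abs_mul, abs_of_pos hpi]
  nlinarith

theorem sq_le_pi_sq_mul_sin_sq {r : ℝ} (h : |r| ≤ Real.pi) :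
    r ^ 2 ≤ Real.pi ^ 2 * Real.sin (r / 2) ^ 2 := by
  have h1 := Real.mul_abs_le_abs_sin (x := r / 2) (by rw [abs_div, abs_two]; linarith)
  have hpi := Real.pi_pos
  rw [abs_div, abs_two] at h1
  have h2 : |r| ≤ Real.pi * |Real.sin (r / 2)| := by
    have := mul_le_mul_of_nonneg_left h1 hpi.le
    field_simp at this
    linarith
  rw [← sq_abs r, ← sq_abs (Real.sin (r / 2)), ← mul_pow]
  exact pow_le_pow_left₀ (abs_nonneg _) h2 2

/-- An invariant `C²` function vanishing on the walls of `α` is bounded by a multiple of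
`sin² (α/2)`. -/
theorem exists_norm_le_mul_sinRoot_sq {g : V → ℂ} (hg : ContDiff ℝ 2 g) (hgp : IsPeriodic R g)
    {i : ι} (hinv : ∀ h, g (R.coreflection i h) = g h)
    (h0 : ∀ x, sinRoot R i x = 0 → g x = 0) :
    ∃ C : ℝ, 0 ≤ C ∧ ∀ h, ‖g h‖ ≤ C * sinRoot R i h ^ 2 := by
  let v : V := (1 / 2 : ℝ) • R.coroot i
  have hv : R.root' i v = 1 := root'_half_coroot i
  have hvc : R.coroot i = (2 : ℝ) • v := by simp only [v]; module
  obtain ⟨C, hC0, hC⟩ := exists_bound_of_continuous_periodic (hgp.secondDeriv v)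
    (ContDiff.continuous_secondDeriv hg v)
  -- `C` bounds the second normal derivative, and `π²` comes from `r² ≤ π² sin² (r/2)` for `|r| ≤
  -- π`, where `r` is the value of `α` reduced modulo `2π`.
  refine ⟨C * Real.pi ^ 2, by positivity, fun h => ?_⟩
  obtain ⟨n, hn⟩ := exists_sub_int_mul_two_pi_abs_le (R.root' i h)
  set r := R.root' i h - n * (2 * Real.pi) with hr
  let y := h - r • v
  have hy : R.root' i y = n * (2 * Real.pi) := by
    simp only [y, map_sub, map_smul, hv, smul_eq_mul, hr]
    ring
  have hys : sinRoot R i y = 0 := by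
    rw [sinRoot, hy, Real.sin_eq_zero_iff]
    exact ⟨n, by ring⟩
  have hl : ∀ s : ℝ, HasDerivAt (fun s : ℝ => y + s • v) v s := by
    intro s
    simpa using ((hasDerivAt_id s).smul_const v).const_add y
  have hφ := norm_le_mul_sq_of_even (φ := fun s : ℝ => g (y + s • v))
    (φ' := fun s => fderiv ℝ g (y + s • v) v) (φ'' := fun s => secondDeriv g v (y + s • v))
    (fun s => ((hg.differentiable two_ne_zero) _).hasFDerivAt.comp_hasDerivAt s (hl s))
    (fun s => (((ContDiff.fderiv_apply_const hg v).differentiable one_ne_zero)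
      _).hasFDerivAt.comp_hasDerivAt s (hl s))
    -- Evenness: as `α(y) = 2πn`, the reflection sends `y + s v` to `y - s v - n · 2π α^∨`, which is
    -- `y - s v` up to the period lattice.
    (fun s => hC _) (fun s => by
      have hlat : (-(n : ℝ)) • ((2 * Real.pi) • R.coroot i) ∈ periodLattice R := by
        rw [neg_smul, Int.cast_smul_eq_zsmul]
        exact neg_mem (zsmul_mem (AddSubgroup.subset_closure (Set.mem_range_self i)) n)
      rw [← hinv (y + s • v), ← hgp (y + -s • v) _ hlat]
      congr 1
      rw [R.coreflection_apply, map_add, map_smul, hv, hy, hvc, smul_eq_mul]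
      module)
    (by simpa using h0 y hys) r
  have e : y + r • v = h := sub_add_cancel _ _
  simp only [e] at hφ
  have hsin : sinRoot R i h ^ 2 = Real.sin (r / 2) ^ 2 := by
    rw [← e, sinRoot_wall_add hys hv]
  rw [hsin]
  have h3 := mul_le_mul_of_nonneg_left (sq_le_pi_sq_mul_sin_sq hn) hC0
  linarith

end DomainWalls
end CalogeroMoser

end

noncomputable section
namespace CalogeroMoser
open MeasureTheory Laplacian

/-! ### Symmetry of the conjugated Laplacian -/

section GroundMap
variable {ι M V : Type*} [AddCommGroup M] [Module ℝ M]
  [NormedAddCommGroup V] [InnerProductSpace ℝ V] [FiniteDimensional ℝ V]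
  [Fintype ι] {R : RootPairing ι ℝ M V} [R.IsRootSystem] [R.IsCrystallographic] {k : ι → ℝ}

/-- Multiplication of invariant polynomials by the ground state. -/
def groundMap (hk : ∀ i j, k (R.reflectionPerm i j) = k j) (hk0 : ∀ i, 0 ≤ k i) :
    invariantPolynomials R →ₗ[ℂ] L2W R :=
  polyMap (fun h => (phiReg R k 0 h : ℂ)) (isPeriodic_phiReg 0).ofReal
    (Complex.continuous_ofReal.comp (continuous_phiReg hk0 0))
    fun i x => by rw [phiReg_coreflection hk]

theorem coeFn_groundMap (hk : ∀ i j, k (R.reflectionPerm i j) = k j) (hk0 : ∀ i, 0 ≤ k i)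
    (F : invariantPolynomials R) : ((groundMap hk hk0 F : L2W R) : Lp ℂ 2 (haar R)) =ᵐ[haar R]
      onTorus R fun h => F.1 h * phiReg R k 0 h := coeFn_polyMap _ _ _ _ _

theorem mem_polySpace_iff (b : R.Base) (hk : ∀ i j, k (R.reflectionPerm i j) = k j)
    (hk0 : ∀ i, 0 ≤ k i) {u : L2W R} :
    u ∈ polySpace R b k ↔ ∃ F, groundMap hk hk0 F = u := by
  have h : ∀ F : V → ℂ, (onTorus R fun h => F h * groundState R b k h) =
      onTorus R fun h => F h * phiReg R k 0 h := fun F => by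
    simp only [groundState_eq_phiReg b hk]
  constructor
  · rintro ⟨F, hF, hu⟩
    refine ⟨⟨F, hF⟩, L2W_ext ?_⟩
    rw [h] at hu
    exact (coeFn_groundMap hk hk0 _).trans hu.symm
  · rintro ⟨F, rfl⟩
    refine ⟨F, F.2, ?_⟩
    rw [h]
    exact coeFn_groundMap hk hk0 F

theorem fderiv_star_apply (F : V → ℂ) (h v : V) :
    fderiv ℝ (fun h => star (F h)) h v = star (fderiv ℝ F h v) := by
  rw [fderiv_star]
  rfl

theorem laplacian_star {F : V → ℂ} (hF : ContDiff ℝ 2 F) (h : V) :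
    laplacian (fun h => star (F h)) h = star (laplacian F h) := by
  have hF' : ContDiff ℝ 2 fun h => star (F h) := (starL' ℝ : ℂ ≃L[ℝ] ℂ).contDiff.comp hF
  rw [laplacian_eq_sum_secondDeriv (stdOrthonormalBasis ℝ V) hF',
    laplacian_eq_sum_secondDeriv (stdOrthonormalBasis ℝ V) hF, star_sum]
  refine Finset.sum_congr rfl fun i _ => ?_
  simp only [secondDeriv, fderiv_star_apply]

theorem driftReg_star (ε : ℝ) (F : V → ℂ) (h : V) :
    driftReg R k ε (fun h => star (F h)) h = star (driftReg R k ε F h) := by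
  have hr : ∀ r : ℝ, star (r : ℂ) = r := Complex.conj_ofReal
  simp only [driftReg, star_sum, star_mul', hr, fderiv_star_apply]

variable (R k) in
/-- The Laplacian conjugated by the ground state, without its zeroth-order term. -/
def conjLaplacian (F : V → ℂ) (h : V) : ℂ := laplacian F h + 2 * driftReg R k 0 F h

theorem conjLaplacian_star {F : V → ℂ} (hF : ContDiff ℝ 2 F) (h : V) :
    conjLaplacian R k (fun h => star (F h)) h = star (conjLaplacian R k F h) := by
  rw [conjLaplacian, conjLaplacian, laplacian_star hF, driftReg_star, star_add, star_mul',
    star_ofNat]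

variable [IsWeylInvariantInner R]

theorem exists_conjLaplacian_eq (hk : ∀ i j, k (R.reflectionPerm i j) = k j) {N : ℕ}
    (F : invariantPolynomials R) (hF : F.1 ∈ polyBox R N) :
    ∃ G : invariantPolynomials R, G.1 ∈ polyBox R N ∧
      ∀ h, (∀ i, sinRoot R i h ≠ 0) → G.1 h = conjLaplacian R k F.1 h := by
  obtain ⟨G, h1, h2, h3⟩ := exists_conjugated_laplacian_eq hk hF F.2.2
  exact ⟨⟨G, polyBox_le N h1, h2⟩, h1, h3⟩

theorem contDiff_invariantPolynomial (F : invariantPolynomials R) {n : WithTop ℕ∞} :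
    ContDiff ℝ n F.1 := contDiff_of_mem_span F.2.1

theorem isPeriodic_invariantPolynomial (F : invariantPolynomials R) : IsPeriodic R F.1 :=
  isPeriodic_of_mem_span F.2.1

/-- The complex conjugate of an invariant polynomial. -/
def starPoly (F : invariantPolynomials R) : invariantPolynomials R :=
  ⟨fun h => star (F.1 h), star_mem_invariantPolynomials F.2⟩

/-- Both sides equal minus the Dirichlet form with weight `Φ²`, which is symmetric in `F` and `G`.
The integration by parts is legitimate because derivatives of invariant polynomials vanish on the
walls. -/
theorem integral_conjLaplacian (hk0 : ∀ i, 0 ≤ k i) (F G : invariantPolynomials R) :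
    ∫ t, onTorus R (fun h => G.1 h * phiReg R k 0 h ^ 2 * conjLaplacian R k F.1 h) t ∂haar R =
      ∫ t, onTorus R (fun h => F.1 h * phiReg R k 0 h ^ 2 * conjLaplacian R k G.1 h) t ∂haar R := by
  have key : ∀ F G : invariantPolynomials R,
      ∫ t, onTorus R (fun h => G.1 h * phiReg R k 0 h ^ 2 * conjLaplacian R k F.1 h) t ∂haar R =
      -∫ t, onTorus R (fun h => phiReg R k 0 h ^ 2 * ∑ v, fderiv ℝ F.1 h (stdOrthonormalBasis ℝ V v) *
        fderiv ℝ G.1 h (stdOrthonormalBasis ℝ V v)) t ∂haar R := by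
    intro F G
    obtain ⟨N, hN⟩ := exists_mem_polyBox F.2.1
    obtain ⟨C, hC, hb⟩ := exists_norm_fderiv_le hN F.2.2
    exact integral_conjugated_laplacian hk0 (contDiff_invariantPolynomial F)
      (isPeriodic_invariantPolynomial F) (contDiff_invariantPolynomial G)
      (isPeriodic_invariantPolynomial G) hC (fun i _ => hb i) _
  rw [key, key]
  simp only [mul_comm (fderiv ℝ F.1 _ _)]

/-- The conjugated Laplacian is symmetric. -/
theorem inner_groundMap_conjLaplacian (hk : ∀ i j, k (R.reflectionPerm i j) = k j)
    (hk0 : ∀ i, 0 ≤ k i) {F G F' G' : invariantPolynomials R}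
    (hG : ∀ h, (∀ i, sinRoot R i h ≠ 0) → G.1 h = conjLaplacian R k F.1 h)
    (hG' : ∀ h, (∀ i, sinRoot R i h ≠ 0) → G'.1 h = conjLaplacian R k F'.1 h) :
    inner ℂ (groundMap hk hk0 G) (groundMap hk hk0 F') =
      inner ℂ (groundMap hk hk0 F) (groundMap hk hk0 G') := by
  have hr : ∀ r : ℝ, star (r : ℂ) = r := Complex.conj_ofReal
  rw [inner_L2W, inner_L2W]
  refine Eq.trans ?_ ((integral_conjLaplacian hk0 (starPoly F) F').trans ?_)
  · refine integral_congr_ae ?_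
    filter_upwards [coeFn_groundMap hk hk0 G, coeFn_groundMap hk hk0 F', ae_regular (R := R)]
      with t h1 h2 h3
    rw [h1, h2]
    simp only [onTorus, star_mul', hG _ h3, hr, starPoly]
    rw [conjLaplacian_star (contDiff_invariantPolynomial F)]
    ring
  · refine integral_congr_ae ?_
    filter_upwards [coeFn_groundMap hk hk0 F, coeFn_groundMap hk hk0 G', ae_regular (R := R)]
      with t h1 h2 h3
    rw [h1, h2]
    simp only [onTorus, star_mul', hG' _ h3, hr, starPoly]
    ring

end GroundMap

/-! ### The adjoint of the Hamiltonian on the polynomial space -/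

section AdjointFormula
variable {ι M V : Type*} [AddCommGroup M] [Module ℝ M]
  [NormedAddCommGroup V] [InnerProductSpace ℝ V] [FiniteDimensional ℝ V]
  [Fintype ι] {R : RootPairing ι ℝ M V} [R.IsRootSystem] [R.IsCrystallographic] [R.IsReduced]
  [IsWeylInvariantInner R] {k : ι → ℝ}

/-- Walls with `k_α = 0` are exempt because the ground state is not singular there. -/
theorem exists_norm_c2Rep_le {u : L2W R} (hu : u ∈ c2Submodule R)
    (hw : ∀ i, k i ≠ 0 → ∀ x, sinRoot R i x = 0 → c2Rep u hu (Torus.mk R x) = 0) :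
    ∃ C : ℝ, 0 ≤ C ∧ ∀ i, k i ≠ 0 → ∀ h, ‖c2Rep u hu (Torus.mk R h)‖ ≤ C * sinRoot R i h ^ 2 := by
  have h0 : ∀ i, ∃ C : ℝ, 0 ≤ C ∧
      (k i ≠ 0 → ∀ h, ‖c2Rep u hu (Torus.mk R h)‖ ≤ C * sinRoot R i h ^ 2) := by
    intro i
    by_cases hi : k i = 0
    · exact ⟨0, le_rfl, fun h => absurd hi h⟩
    · obtain ⟨C, hC, hb⟩ := exists_norm_le_mul_sinRoot_sq (R := R) (i := i) (isC2_c2Rep hu)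
        (isPeriodic_comp_mk _) (fun h => c2Rep_reflT hu i (Torus.mk R h)) (hw i hi)
      exact ⟨C, hC, fun _ => hb⟩
  choose C hC hb using h0
  refine ⟨∑ i, C i, Finset.sum_nonneg fun i _ => hC i, fun i hi h => (hb i hi h).trans ?_⟩
  exact mul_le_mul_of_nonneg_right (Finset.single_le_sum (fun i _ => hC i) (Finset.mem_univ i))
    (sq_nonneg _)

/-- The formal adjoint of the Hamiltonian on the products of invariant polynomials with the ground
state. -/
theorem inner_groundMap_hamiltonian (b : R.Base) (hk : ∀ i j, k (R.reflectionPerm i j) = k j)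
    (hk0 : ∀ i, 0 ≤ k i) (p : Set.Ioo (-1 : ℝ) 1) {A : L2W R →L[ℂ] L2W R}
    (hA : ∀ u : L2W R, (A u : Lp ℂ 2 (haar R)) =ᵐ[haar R]
      fun t => onTorus R (multiplier hk p) t * (u : Lp ℂ 2 (haar R)) t)
    {F G : invariantPolynomials R}
    (hG : ∀ h, (∀ i, sinRoot R i h ≠ 0) → G.1 h = conjLaplacian R k F.1 h)
    (u : (hamiltonian R b k hk p).domain)
    (hw : ∀ i, k i ≠ 0 → ∀ x, sinRoot R i x = 0 → c2Rep u.1 u.2.1 (Torus.mk R x) = 0) :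
    inner ℂ (A (groundMap hk hk0 F) - groundMap hk hk0 G) (u : L2W R) =
      inner ℂ (groundMap hk hk0 F) (hamiltonian R b k hk p u) := by
  have hr : ∀ r : ℝ, star (r : ℂ) = r := Complex.conj_ofReal
  set g := c2Rep u.1 u.2.1 with hg
  let f : V → ℂ := fun h => g (Torus.mk R h)
  have hf : ContDiff ℝ 2 f := isC2_c2Rep u.2.1
  have hfp : IsPeriodic R f := isPeriodic_comp_mk g
  obtain ⟨C, hC, hb⟩ := exists_norm_c2Rep_le u.2.1 hw
  let F' := starPoly F
  have hF' := contDiff_invariantPolynomial F' (n := 2)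
  have hFp := isPeriodic_invariantPolynomial F'
  have hgreen := green hk0 hF' hFp hf hfp hC hb
  have hφ : Continuous fun h => (phiReg R k 0 h : ℂ) :=
    Complex.continuous_ofReal.comp (continuous_phiReg hk0 0)
  have hFφ : Continuous (onTorus R fun h => F'.1 h * phiReg R k 0 h) :=
    continuous_onTorus (hFp.mul (isPeriodic_phiReg 0).ofReal) (hF'.continuous.mul hφ)
  let v := potential R b k p
  have hV : MemLp (fun t => onTorus R v t * g t) 2 (haar R) :=
    u.2.2.ae_eq (by filter_upwards [c2Rep_ae_eq u.2.1] with t ht; rw [ht])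
  have hI1 : Integrable (fun t => onTorus R v t * g t * onTorus R (fun h => F'.1 h * phiReg R k 0 h) t)
      (haar R) := hV.integrable_mul (memLp_of_continuous hFφ)
  have hI2 : Integrable (onTorus R fun h => F'.1 h * phiReg R k 0 h * laplacian f h) (haar R) :=
    integrable_of_continuous_periodic ((hFp.mul (isPeriodic_phiReg 0).ofReal).mul hfp.laplacian)
      ((hF'.continuous.mul hφ).mul (CalogeroMoser.continuous_laplacian hf))
  have hI3 : Integrable (fun t => (u.1 : Lp ℂ 2 (haar R)) t *
      star (((A (groundMap hk hk0 F) - groundMap hk hk0 G : L2W R) : Lp ℂ 2 (haar R)) t)) (haar R) :=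
    (Lp.memLp _).integrable_mul (Lp.memLp _).star
  have e1 : inner ℂ (groundMap hk hk0 F) (hamiltonian R b k hk p u) =
      ∫ t, onTorus R v t * g t * onTorus R (fun h => F'.1 h * phiReg R k 0 h) t ∂haar R -
        ∫ t, onTorus R (fun h => F'.1 h * phiReg R k 0 h * laplacian f h) t ∂haar R := by
    rw [inner_L2W, ← integral_sub hI1 hI2]
    refine integral_congr_ae ?_
    have h1 : ((hamiltonian R b k hk p u : L2W R) : Lp ℂ 2 (haar R)) =ᵐ[haar R]
        schrodingerFun v u.1 u.2.1 := (memLp_schrodingerFun v u.2).coeFn_toLp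
    filter_upwards [h1, coeFn_groundMap hk hk0 F] with t h2 h3
    rw [h2, h3, schrodingerFun]
    have h4 : torusLaplacian R g t = laplacian f (Torus.rep R t) := rfl
    rw [← hg, h4]
    simp only [onTorus, star_mul', hr, F', starPoly]
    ring
  -- At regular points the zeroth-order term `quadReg` is the potential minus `multiplier`, so the
  -- right side of Green's formula is the potential term minus the pairing of `u` with `A(FΦ) - GΦ`.
  have e2 : ∫ t, onTorus R (fun h => f h * (phiReg R k 0 h *
      (laplacian F'.1 h + 2 * driftReg R k 0 F'.1 h + F'.1 h * quadReg R k 0 h))) t ∂haar R =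
      ∫ t, onTorus R v t * g t * onTorus R (fun h => F'.1 h * phiReg R k 0 h) t ∂haar R -
        inner ℂ (A (groundMap hk hk0 F) - groundMap hk hk0 G) (u : L2W R) := by
    rw [inner_L2W, ← integral_sub hI1 hI3]
    refine integral_congr_ae ?_
    filter_upwards [c2Rep_ae_eq u.2.1, coeFn_groundMap hk hk0 F, coeFn_groundMap hk hk0 G,
      hA (groundMap hk hk0 F), ae_regular (R := R),
      Lp.coeFn_sub ((A (groundMap hk hk0 F) : L2W R) : Lp ℂ 2 (haar R)) (groundMap hk hk0 G)]
      with t h1 h2 h3 h4 h5 h6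
    have h7 := multiplier_eq hk p b h5
    have h8 : g t = f (Torus.rep R t) := congr_arg g (Torus.mk_rep R t).symm
    have h9 := conjLaplacian_star (R := R) (k := k) (contDiff_invariantPolynomial F) (Torus.rep R t)
    rw [conjLaplacian] at h9
    rw [Submodule.coe_sub, h6, Pi.sub_apply, h4, h2, h3, h1, ← hg, h8]
    simp only [onTorus, star_sub, star_mul', hr, F', starPoly, hG _ h5, star_multiplier]
    rw [h9, h7]
    simp only [v]
    ring
  rw [e1, hgreen, e2]
  ring

end AdjointFormula
end CalogeroMoser

end

noncomputable section
namespace CalogeroMoser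
open MeasureTheory Laplacian

/-! ### Density of the domains -/

section Domain
variable {ι M V : Type*} [AddCommGroup M] [Module ℝ M]
  [NormedAddCommGroup V] [InnerProductSpace ℝ V] [FiniteDimensional ℝ V]
  [Fintype ι] {R : RootPairing ι ℝ M V} [R.IsRootSystem] [R.IsCrystallographic]
  [IsWeylInvariantInner R] {k : ι → ℝ}

/-- The product of the functions `sin² (α/2)` over all roots. -/
def rootsProd (R : RootPairing ι ℝ M V) (h : V) : ℝ := ∏ i, sinRoot R i h ^ 2

theorem contDiff_rootsProd {n : WithTop ℕ∞} : ContDiff ℝ n fun h => (rootsProd R h : ℂ) := by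
  refine Complex.ofRealCLM.contDiff.comp (contDiff_prod fun i _ => ContDiff.pow ?_ 2)
  have h : ContDiff ℝ n (R.root' i) :=
    (LinearMap.toContinuousLinearMap (R.root' i)).contDiff
  exact Real.contDiff_sin.comp (h.div_const 2)

theorem isPeriodic_rootsProd : IsPeriodic R (rootsProd R) :=
  fun x l hl => Finset.prod_congr rfl fun i _ => isPeriodic_sinRoot_sq i x l hl

theorem rootsProd_coreflection (i : ι) (h : V) :
    rootsProd R (R.coreflection i h) = rootsProd R h := by
  have : ∀ j, sinRoot R j (R.coreflection i h) ^ 2 = sinRoot R (R.reflectionPerm i j) h ^ 2 := by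
    intro j
    rw [sinRoot, sinRoot, root'_reflectionPerm]
  rw [rootsProd, rootsProd]
  simp only [this]
  exact Equiv.prod_comp (R.reflectionPerm i) fun j => sinRoot R j h ^ 2

theorem exists_bound_wp_mul_rootsProd (p : Set.Ioo (-1 : ℝ) 1) (i : ι) :
    ∃ C : ℝ, ∀ h : V, ‖wp p (R.root' i h) * (rootsProd R h : ℂ)‖ ≤ C := by
  classical
  obtain ⟨C, hC⟩ := exists_bound_wp_mul_sin_sq p
  refine ⟨C, fun h => le_trans ?_ (hC (R.root' i h))⟩
  rw [norm_mul, Complex.norm_real, Real.norm_eq_abs]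
  refine mul_le_mul_of_nonneg_left ?_ (norm_nonneg _)
  rw [rootsProd, abs_of_nonneg (Finset.prod_nonneg fun j _ => sq_nonneg _),
    ← Finset.mul_prod_erase _ _ (Finset.mem_univ i)]
  exact mul_le_of_le_one_right (sq_nonneg _)
    (Finset.prod_le_one (fun _ _ => sq_nonneg _) fun l _ => sinRoot_sq_le_one l h)

theorem wpDomain_le_mulDomain_potential (b : R.Base)
    (hk : ∀ i j, k (R.reflectionPerm i j) = k j) (p : Set.Ioo (-1 : ℝ) 1) :
    wpDomain R p ≤ mulDomain R (potential R b k p) := by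
  intro u hu
  have h1 : ∀ i, MemLp (fun t => onTorus R (fun h => wp p (R.root' i h)) t *
      (u : Lp ℂ 2 (haar R)) t) 2 (haar R) := (Submodule.mem_iInf _).1 hu
  have h2 : MemLp (fun t => ∑ i, (potentialCoeff R k i : ℂ) *
      (onTorus R (fun h => wp p (R.root' i h)) t * (u : Lp ℂ 2 (haar R)) t)) 2 (haar R) :=
    memLp_finsetSum _ fun i _ => (h1 i).const_mul _
  refine (h2.const_mul (1 / 2)).ae_eq (ae_of_all _ fun t => ?_)
  have h3 : onTorus R (potential R b k p) t = _ := potential_eq_sum b hk p (Torus.rep R t)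
  simp only [h3]
  rw [mul_assoc, Finset.sum_mul]
  congr 1
  exact Finset.sum_congr rfl fun i _ => (mul_assoc _ _ _).symm

/-- The test functions are invariant polynomials times `rootsProd`: they are smooth, the factor
cancels the double pole of every `℘(α)`, and it is nonzero off the walls. -/
theorem dense_of_wpDomain_inf_c2Submodule_le [R.IsReduced] (b : R.Base) (p : Set.Ioo (-1 : ℝ) 1)
    {D : Submodule ℂ (L2W R)} (hD : wpDomain R p ⊓ c2Submodule R ≤ D) :
    Dense (D : Set (L2W R)) := by
  refine dense_of_range_polyMap_le b (φ := fun h => (rootsProd R h : ℂ))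
    isPeriodic_rootsProd.ofReal (contDiff_rootsProd (n := 0)).continuous
    (fun i x => by rw [rootsProd_coreflection]) (fun x hx => ?_) fun F => hD ⟨?_, ?_⟩
  · exact Complex.ofReal_ne_zero.2 (Finset.prod_ne_zero_iff.2 fun i _ => pow_ne_zero 2 (hx i))
  · refine (Submodule.mem_iInf _).2 fun i => ?_
    obtain ⟨C, hC⟩ := exists_bound_wp_mul_rootsProd (R := R) p i
    have hc := continuous_onTorus (R := R) (f := fun h => (rootsProd R h : ℂ))
      isPeriodic_rootsProd.ofReal (contDiff_rootsProd (n := 0)).continuous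
    have h1 := memLp_bdd_mul ((aestronglyMeasurable_wp b p i).mul hc.aestronglyMeasurable)
      (fun t => hC _) (memLp_of_continuous (continuous_onTorus (isPeriodic_invariantPolynomial F)
        (contDiff_invariantPolynomial F (n := 0)).continuous))
    refine h1.ae_eq ?_
    filter_upwards [coeFn_polyMap (fun h => (rootsProd R h : ℂ)) isPeriodic_rootsProd.ofReal
      (contDiff_rootsProd (n := 0)).continuous (fun i x => by rw [rootsProd_coreflection]) F]
      with t ht
    rw [ht]
    simp only [onTorus, Pi.mul_apply]
    ring
  · refine ⟨_, ?_, coeFn_polyMap _ _ _ _ F⟩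
    have hP : IsPeriodic R fun h => F.1 h * (rootsProd R h : ℂ) :=
      (isPeriodic_invariantPolynomial F).mul isPeriodic_rootsProd.ofReal
    have : (fun h => onTorus R (fun h => F.1 h * (rootsProd R h : ℂ)) (Torus.mk R h)) =
        fun h => F.1 h * (rootsProd R h : ℂ) := onTorus_comp_mk hP
    rw [IsC2, this]
    exact (contDiff_invariantPolynomial F).mul contDiff_rootsProd

end Domain

/-! ### Essential self-adjointness on the polynomial space -/

section EssentialSelfAdjointness
variable {ι M V : Type*} [AddCommGroup M] [Module ℝ M]
  [NormedAddCommGroup V] [InnerProductSpace ℝ V] [FiniteDimensional ℝ V]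
  [Fintype ι] {R : RootPairing ι ℝ M V} [R.IsRootSystem] [R.IsCrystallographic] [R.IsReduced]
  [IsWeylInvariantInner R] {k : ι → ℝ}

theorem dense_of_polySpace_le (b : R.Base) (hk : ∀ i j, k (R.reflectionPerm i j) = k j)
    (hk0 : ∀ i, 0 ≤ k i) {D : Submodule ℂ (L2W R)} (hD : polySpace R b k ≤ D) :
    Dense (D : Set (L2W R)) :=
  dense_of_range_polyMap_le b _ _ _
    (fun _ hx => Complex.ofReal_ne_zero.2 (phiReg_zero_ne_zero hx))
    fun F => hD ((mem_polySpace_iff b hk hk0).2 ⟨F, rfl⟩)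

theorem exists_multiplier_operator (b : R.Base) (hk : ∀ i j, k (R.reflectionPerm i j) = k j)
    (p : Set.Ioo (-1 : ℝ) 1) : ∃ A : L2W R →L[ℂ] L2W R,
      (∀ u : L2W R, (A u : Lp ℂ 2 (haar R)) =ᵐ[haar R]
        fun t => onTorus R (multiplier hk p) t * (u : Lp ℂ 2 (haar R)) t) ∧
      ∀ u v, inner ℂ (A u) v = inner ℂ u (A v) := by
  borelize V
  obtain ⟨C, hC⟩ := exists_bound_multiplier (R := R) hk p
  obtain ⟨A, hA⟩ := exists_multiplication_operator (g := onTorus R (multiplier hk p))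
    (measurable_onTorus b (isPeriodic_multiplier hk p)
      (measurable_multiplier hk p)).aestronglyMeasurable (fun t => hC _)
    (onTorus_reflT (isPeriodic_multiplier hk p) (multiplier_coreflection hk p))
  refine ⟨A, hA, fun u v => ?_⟩
  rw [inner_L2W, inner_L2W]
  refine integral_congr_ae ?_
  filter_upwards [hA u, hA v] with t h1 h2
  rw [h1, h2, star_mul', onTorus, star_multiplier]
  ring

open LinearPMap in
/-- The adjoint of a restriction of the Hamiltonian to a dense space of functions that vanish on
the walls is essentially self-adjoint on the products of the invariant polynomials with the ground
state. -/
theorem isEssentiallySelfAdjointOn_adjoint (b : R.Base)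
    (hk : ∀ i j, k (R.reflectionPerm i j) = k j) (hk0 : ∀ i, 0 ≤ k i) (p : Set.Ioo (-1 : ℝ) 1)
    {S : L2W R →ₗ.[ℂ] L2W R} (hS : S ≤ hamiltonian R b k hk p) (hd : Dense (S.domain : Set (L2W R)))
    (hw : ∀ u (hu : u ∈ S.domain), ∀ i, k i ≠ 0 → ∀ x, sinRoot R i x = 0 →
      c2Rep u (hS.1 hu).1 (Torus.mk R x) = 0) :
    IsEssentiallySelfAdjointOn S.adjoint (polySpace R b k) := by
  obtain ⟨A, hA, hAs⟩ := exists_multiplier_operator (R := R) b hk p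
  have hinner : ∀ F G : invariantPolynomials R,
      (∀ h, (∀ i, sinRoot R i h ≠ 0) → G.1 h = conjLaplacian R k F.1 h) → ∀ u : S.domain,
      inner ℂ (A (groundMap hk hk0 F) - groundMap hk hk0 G) (u : L2W R) =
        inner ℂ (groundMap hk hk0 F) (S u) := by
    intro F G hG u
    have h1 : S u = hamiltonian R b k hk p ⟨u, hS.1 u.2⟩ := hS.2 rfl
    rw [h1]
    exact inner_groundMap_hamiltonian b hk hk0 p hA hG ⟨u, hS.1 u.2⟩ (hw u u.2)
  have hG : ∀ F : invariantPolynomials R, ∃ G : invariantPolynomials R,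
      (∀ N, F.1 ∈ polyBox R N → G.1 ∈ polyBox R N) ∧
      ∀ h, (∀ i, sinRoot R i h ≠ 0) → G.1 h = conjLaplacian R k F.1 h := by
    intro F
    have hex : ∃ N, F.1 ∈ polyBox R N := exists_mem_polyBox F.2.1
    classical
    -- Taking the smallest box that contains `F` yields a `G` that lies in every box containing `F`.
    obtain ⟨G, h1, h2⟩ := exists_conjLaplacian_eq hk F (Nat.find_spec hex)
    exact ⟨G, fun N hN => polyBox_mono (Nat.find_min' hex hN) h1, h2⟩
  choose G hGN hG using hG
  have hle : polySpace R b k ≤ S.adjoint.domain := by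
    intro u hu
    obtain ⟨F, rfl⟩ := (mem_polySpace_iff b hk hk0).1 hu
    exact mem_adjoint_domain_of_exists _ ⟨_, hinner F (G F) (hG F)⟩
  have hmem : ∀ F, groundMap hk hk0 F ∈ polySpace R b k := fun F =>
    (mem_polySpace_iff b hk hk0).2 ⟨F, rfl⟩
  let B := S.adjoint.domRestrict (polySpace R b k)
  have hBd : ∀ F, groundMap hk hk0 F ∈ B.domain := fun F => ⟨hmem F, hle (hmem F)⟩
  -- On `𝒫` the adjoint is the bounded operator `A` minus the conjugated Laplacian, which is the
  -- form that the finite-dimensional criterion requires.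
  have hB : ∀ F (hF : groundMap hk hk0 F ∈ B.domain),
      B ⟨groundMap hk hk0 F, hF⟩ - A (groundMap hk hk0 F) = -groundMap hk hk0 (G F) := by
    intro F hF
    have h1 : B ⟨groundMap hk hk0 F, hF⟩ = S.adjoint ⟨groundMap hk hk0 F, hF.2⟩ :=
      domRestrict_apply rfl
    rw [h1, adjoint_apply_eq hd ⟨groundMap hk hk0 F, hF.2⟩ (hinner F (G F) (hG F))]
    abel
  refine ⟨hle, isEssentiallySelfAdjoint_of_finiteDimensional_invariant
    (dense_of_polySpace_le b hk hk0 (le_inf le_rfl hle)) A hAs ?_ ?_⟩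
  · rintro ⟨x, hx⟩ ⟨y, hy⟩
    obtain ⟨F, rfl⟩ := (mem_polySpace_iff b hk hk0).1 hx.1
    obtain ⟨F', rfl⟩ := (mem_polySpace_iff b hk hk0).1 hy.1
    have h1 := hB F hx
    have h2 := hB F' hy
    simp only [B] at h1 h2
    rw [h1, h2, inner_neg_left, inner_neg_right,
      inner_groundMap_conjLaplacian hk hk0 (hG F) (hG F')]
  · rintro ⟨x, hx⟩
    obtain ⟨F, rfl⟩ := (mem_polySpace_iff b hk hk0).1 hx.1
    obtain ⟨N, hN⟩ := exists_mem_polyBox F.2.1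
    -- The invariant finite-dimensional space is the image of the invariant polynomials with weights
    -- in one box.
    refine ⟨((polyBox R N).comap (invariantPolynomials R).subtype).map (groundMap hk hk0),
      finiteDimensional_map_polyMap N _, ⟨F, hN, rfl⟩, ?_⟩
    rintro _ ⟨F', hF', rfl⟩
    refine ⟨hBd F', ?_⟩
    have h1 := hB F' (hBd F')
    simp only [B] at h1
    rw [h1]
    exact neg_mem ⟨G F', hGN F' N hF', rfl⟩

end EssentialSelfAdjointness
end CalogeroMoser

end

/-! ### The theorem -/

open CalogeroMoser in
theorem mainTheorem5 {ι M V : Type*} [Fintype ι] [AddCommGroup M] [Module ℝ M]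
    [NormedAddCommGroup V] [InnerProductSpace ℝ V] [FiniteDimensional ℝ V]
    (R : RootPairing ι ℝ M V) [R.IsRootSystem] [R.IsCrystallographic] [R.IsReduced]
    [IsWeylInvariantInner R] (b : R.Base)
    (k : ι → ℝ) (hk : ∀ i j, k (R.reflectionPerm i j) = k j) (hk0 : ∀ i, 0 ≤ k i)
    (p : Set.Ioo (-1 : ℝ) 1) :
    (Dense (((hamiltonian R b k hk p).domRestrict (wpDomain R p)).domain : Set (L2W R)) ∧
      IsEssentiallySelfAdjointOn ((hamiltonian R b k hk p).domRestrict (wpDomain R p)).adjoint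
        (polySpace R b k)) ∧
    ((∀ i, k i ≠ 1) →
      Dense ((hamiltonian R b k hk p).domain : Set (L2W R)) ∧
      IsEssentiallySelfAdjointOn (hamiltonian R b k hk p).adjoint (polySpace R b k)) := by
  have hpot := wpDomain_le_mulDomain_potential (R := R) b hk p
  have hd1 : Dense (((hamiltonian R b k hk p).domRestrict (wpDomain R p)).domain : Set (L2W R)) :=
    dense_of_wpDomain_inf_c2Submodule_le b p fun u hu => ⟨hu.1, hu.2, hpot hu.1⟩
  have hd2 : Dense ((hamiltonian R b k hk p).domain : Set (L2W R)) :=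
    dense_of_wpDomain_inf_c2Submodule_le b p fun u hu => ⟨hu.2, hpot hu.1⟩
  -- The domain conditions concern classes in `L²`; vanishing on the null set of the walls only
  -- makes sense for the `C²` representative.
  have hmem : ∀ {u : L2W R} (hu : u ∈ c2Submodule R) {v : V → ℂ}, u ∈ mulDomain R v →
      MeasureTheory.MemLp (fun t => onTorus R v t *
        onTorus R (fun h => c2Rep u hu (Torus.mk R h)) t) 2 (haar R) := by
    intro u hu v h
    refine MeasureTheory.MemLp.ae_eq ?_ h
    filter_upwards [c2Rep_ae_eq hu] with t ht
    rw [ht, onTorus_comp_mk_apply]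
  refine ⟨⟨hd1, isEssentiallySelfAdjointOn_adjoint b hk hk0 p LinearPMap.domRestrict_le hd1
    fun u hu i _ x hx => ?_⟩, fun hk1 => ⟨hd2, isEssentiallySelfAdjointOn_adjoint b hk hk0 p le_rfl hd2
    fun u hu i hi x hx => ?_⟩⟩
  · exact eq_zero_of_memLp_wp_mul (isPeriodic_comp_mk _) (ContDiff.continuous (isC2_c2Rep hu.2.1))
      (hmem hu.2.1 ((Submodule.mem_iInf _).1 hu.1 i)) hx
  · exact eq_zero_of_memLp_potential_mul b hk (isPeriodic_comp_mk _)
      (ContDiff.continuous (isC2_c2Rep hu.1)) hi (hk1 i) (hmem hu.1 hu.2) hx
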